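/- Let $TL_\infty=TL_\infty(0)=\bigcup_n TL_n(0)$ be the infinite Temperley–Lieb algebra over $\mathbb C$ with loop parameter $\delta=0$ (so $q=\pm i$ and $l=2$), with generators $e_1,e_2,\dots$, where $e_i^2=0$, $e_ie_{i\pm1}e_i=e_i$, $e_ie_j=e_je_i$ for $|i-j|>1$. Let $\dagger$ be the linear anti-automorphism that reflects diagrams about the horizontal axis. For odd $m$ let $f_m\in TL_m$ be the Jones–Wenzl idempotent, the unique non-zero idempotent with $e_if_m=f_me_i=0$ for $1\le i<m$. For odd $n$ the matrix units of $TL_n$ are built as follows. Write $\cup_i^{m}$ for the half diagram from $m$ to $m+2$ points with a cup joining the top points $i,i+1$ and vertical strands elsewhere, and write a half diagram also for the one obtained from it by adding vertical strands on the right. For odd $m$ put $R_m=f_m\cup^m_{m+1}f_m$ and $L_m=f_m\cup^m_{m}f_m$, and for odd $m\ge3$ put $T_m=f_m\,\cup^{m}_{m}\cup^{m-2}_{m-1}\,f_{m-2}$ (two nested cups). Starting with $v_\emptyset=1$ on one point, a half diagram $v_p$ from $m$ to $n$ points ($m,n$ odd) is extended to half diagrams with $n+2$ top points: $$v_{p0}=v_pf_{m+2},\quad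 v_{p+}=\tfrac1{\sqrt2}v_p(R_m+L_m),\quad v_{p-}=\tfrac{i}{\sqrt2}v_p(R_m-L_m),\quad v_{p2}=i\sqrt{\tfrac{m-1}{m+1}}\,v_pT_m\ (m\ge3).$$ For paths $p,q$ of the same length that end at the same $m$ put $v_{p,q}=v_pv_q^\dagger\in TL_n$. Then: 1. There is exactly one conjugate-linear map $\diamond$ on $TL_\infty$ with $(xy)^\diamond=y^\diamond x^\diamond$, $(x^\diamond)^\diamond=x$, and $v_{p,q}^\diamond=v_{q,p}$ for all such $p,q$ (the corrected involution). 2. For every $\gamma\in\mathbb C$ there is exactly one linear functional $\chi$ on $TL_\infty$ with $\chi(1)=1$, $\chi(xy)=\chi(yx)$, $\chi(x\otimes y)=\chi(x)\chi(y)$ for all $x\in TL_m$, $y\in TL_\infty$, $m\ge0$ (where $x\otimes y$ places $x$ on the first $m$ strands and $y$ on the remaining ones), and $\chi(e_1e_2)=\gamma$. 3. Let $\chi$ be an extremal trace, that is, either a multiplicative normalized trace as in 2, or an extreme point of the convex set of traces $\chi$ with $\chi(1)=1$ and $\chi(xx^\diamond)\ge0$ for all $x$. Put $\gamma=\chi(e_1e_2)$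 and $\|x\|^2_{\diamond,\infty,2}=\chi(xx^\diamond)$. Then $$\|e_n\|^2_{\diamond,\infty,2}=4\gamma\quad\text{for } n>2 \text{ odd},\qquad \|e_n\|^2_{\diamond,\infty,2}=\gamma\quad\text{for } n=1 \text{ and for } n\ge 2 \text{ even}.$$ -/

import Mathlib

open scoped ComplexConjugate

noncomputable section

namespace TLZero

/-! Stable Temperley-Lieb diagrams with loop parameter zero.

A planar diagram with finitely many cups and caps, all of whose strands far enough to the right are
vertical up to a shift, stands for a planar diagram from `m` bottom points to `n` top points together
with all the diagrams obtained from it by adding vertical strands on the right. -/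

/-- Generators: `cup i` creates two neighbouring top points, at the positions `i` and `i + 1`
(positions are counted from `0`), joined by an arc; the strands at positions `≥ i` move two places
to the right. `cap i` is its reflection about the horizontal axis. -/
inductive Gen : Type
  | cup (i : ℕ)
  | cap (i : ℕ)

abbrev fcup (i : ℕ) : FreeAlgebra ℂ Gen := FreeAlgebra.ι ℂ (Gen.cup i)

abbrev fcap (i : ℕ) : FreeAlgebra ℂ Gen := FreeAlgebra.ι ℂ (Gen.cap i)

/-- Planar isotopy, together with the rule that a closed loop is replaced by `0`. A product `a * b`
is the diagram `a` on top of the diagram `b`. -/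
inductive Rel : FreeAlgebra ℂ Gen → FreeAlgebra ℂ Gen → Prop
  | loop (i : ℕ) : Rel (fcap i * fcup i) 0
  | zigzag_left (i : ℕ) : Rel (fcap i * fcup (i + 1)) 1
  | zigzag_right (i : ℕ) : Rel (fcap (i + 1) * fcup i) 1
  | cap_cup (i j : ℕ) : i ≤ j → Rel (fcap i * fcup (j + 2)) (fcup j * fcap i)
  | cup_cap (i j : ℕ) : i ≤ j → Rel (fcap (j + 2) * fcup i) (fcup i * fcap j)
  | cup_cup (i j : ℕ) : i ≤ j → Rel (fcup i * fcup j) (fcup (j + 2) * fcup i)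
  | cap_cap (i j : ℕ) : i ≤ j → Rel (fcap j * fcap i) (fcap i * fcap (j + 2))

/-- The algebra of stable planar diagrams at loop parameter `0`. -/
abbrev Diag : Type := RingQuot Rel

def cup (i : ℕ) : Diag := RingQuot.mkAlgHom ℂ Rel (fcup i)

def cap (i : ℕ) : Diag := RingQuot.mkAlgHom ℂ Rel (fcap i)

theorem cap_mul_cup_self (i : ℕ) : cap i * cup i = 0 := by
  simpa [cup, cap] using RingQuot.mkAlgHom_rel ℂ (Rel.loop i)

theorem cap_mul_cup_succ (i : ℕ) : cap i * cup (i + 1) = 1 := by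
  simpa [cup, cap] using RingQuot.mkAlgHom_rel ℂ (Rel.zigzag_left i)

theorem cap_succ_mul_cup (i : ℕ) : cap (i + 1) * cup i = 1 := by
  simpa [cup, cap] using RingQuot.mkAlgHom_rel ℂ (Rel.zigzag_right i)

theorem cap_mul_cup_of_le {i j : ℕ} (h : i ≤ j) : cap i * cup (j + 2) = cup j * cap i := by
  simpa [cup, cap] using RingQuot.mkAlgHom_rel ℂ (Rel.cap_cup i j h)

theorem cap_mul_cup_of_ge {i j : ℕ} (h : i ≤ j) : cap (j + 2) * cup i = cup i * cap j := by
  simpa [cup, cap] using RingQuot.mkAlgHom_rel ℂ (Rel.cup_cap i j h)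

theorem cup_mul_cup {i j : ℕ} (h : i ≤ j) : cup i * cup j = cup (j + 2) * cup i := by
  simpa [cup, cap] using RingQuot.mkAlgHom_rel ℂ (Rel.cup_cup i j h)

theorem cap_mul_cap {i j : ℕ} (h : i ≤ j) : cap j * cap i = cap i * cap (j + 2) := by
  simpa [cup, cap] using RingQuot.mkAlgHom_rel ℂ (Rel.cap_cap i j h)

/-- The Temperley-Lieb generator `e_i`, `1 ≤ i`: a cup and a cap joining the `i`-th and the
`(i+1)`-st points (positions `i - 1` and `i`). -/
def gen (i : ℕ) : Diag := cup (i - 1) * cap (i - 1)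

/-- `TL_n(0)`, generated by `e_1, …, e_{n-1}`. -/
def TL (n : ℕ) : Subalgebra ℂ Diag :=
  Algebra.adjoin ℂ {x | ∃ i, 1 ≤ i ∧ i < n ∧ x = gen i}

/-- `TL_∞(0)`, the union of the algebras `TL_n(0)`: it is generated by all `e_i`, `1 ≤ i`. -/
def TLInf : Subalgebra ℂ Diag :=
  Algebra.adjoin ℂ {x | ∃ i, 1 ≤ i ∧ x = gen i}

theorem gen_mem (i : ℕ) : gen i ∈ TLInf := by
  rcases Nat.eq_zero_or_pos i with rfl | h
  · exact Algebra.subset_adjoin ⟨1, le_refl 1, rfl⟩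
  · exact Algebra.subset_adjoin ⟨i, h, rfl⟩

/-- The generator `e_i`, `1 ≤ i`, as an element of `TL_∞(0)`. -/
def genInf (i : ℕ) : TLInf := ⟨gen i, gen_mem i⟩

/-! Reflection about the horizontal axis. -/

def daggerGen : Gen → Diagᵐᵒᵖ
  | Gen.cup i => MulOpposite.op (cap i)
  | Gen.cap i => MulOpposite.op (cup i)

/-- The linear anti-automorphism `†`, as a homomorphism to the opposite algebra. -/
def daggerHom : Diag →ₐ[ℂ] Diagᵐᵒᵖ :=
  RingQuot.liftAlgHom ℂ ⟨FreeAlgebra.lift ℂ daggerGen, by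
    intro a b h
    cases h with
    | loop i => simp [daggerGen, ← MulOpposite.op_mul, cap_mul_cup_self]
    | zigzag_left i => simp [daggerGen, ← MulOpposite.op_mul, cap_succ_mul_cup]
    | zigzag_right i => simp [daggerGen, ← MulOpposite.op_mul, cap_mul_cup_succ]
    | cap_cup i j h => simp [daggerGen, ← MulOpposite.op_mul, cap_mul_cup_of_ge h]
    | cup_cap i j h => simp [daggerGen, ← MulOpposite.op_mul, cap_mul_cup_of_le h]
    | cup_cup i j h => simp [daggerGen, ← MulOpposite.op_mul, cap_mul_cap h]
    | cap_cap i j h => simp [daggerGen, ← MulOpposite.op_mul, cup_mul_cup h]⟩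

/-- Reflection of diagrams about the horizontal axis, extended linearly. -/
def dagger (x : Diag) : Diag := (daggerHom x).unop

/-! Placing a diagram to the right of `m` vertical strands. -/

def shiftGen (m : ℕ) : Gen → Diag
  | Gen.cup i => cup (i + m)
  | Gen.cap i => cap (i + m)

/-- Adds `m` vertical strands on the left of a diagram. -/
def shift (m : ℕ) : Diag →ₐ[ℂ] Diag :=
  RingQuot.liftAlgHom ℂ ⟨FreeAlgebra.lift ℂ (shiftGen m), by
    intro a b h
    cases h with
    | loop i => simp [shiftGen, cap_mul_cup_self]
    | zigzag_left i => simp [shiftGen, Nat.add_right_comm i 1 m, cap_mul_cup_succ]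
    | zigzag_right i => simp [shiftGen, Nat.add_right_comm i 1 m, cap_succ_mul_cup]
    | cap_cup i j h =>
      simp [shiftGen, Nat.add_right_comm j 2 m, cap_mul_cup_of_le (Nat.add_le_add_right h m)]
    | cup_cap i j h =>
      simp [shiftGen, Nat.add_right_comm j 2 m, cap_mul_cup_of_ge (Nat.add_le_add_right h m)]
    | cup_cup i j h =>
      simp [shiftGen, Nat.add_right_comm j 2 m, cup_mul_cup (Nat.add_le_add_right h m)]
    | cap_cap i j h =>
      simp [shiftGen, Nat.add_right_comm j 2 m, cap_mul_cap (Nat.add_le_add_right h m)]⟩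

/-! The matrix decomposition of `TL_n(0)`, `n` odd. -/

/-- `f` is the Jones-Wenzl idempotent on `m` strands. -/
structure IsJonesWenzl (m : ℕ) (f : Diag) : Prop where
  mem : f ∈ TL m
  ne_zero : f ≠ 0
  idem : f * f = f
  gen_mul : ∀ i, 1 ≤ i → i < m → gen i * f = 0
  mul_gen : ∀ i, 1 ≤ i → i < m → f * gen i = 0

open Classical in
/-- The Jones-Wenzl idempotent `f_m`. At loop parameter `0` it exists for `m = 0` and `m` odd;
it is used for odd `m` only. -/
def jw (m : ℕ) : Diag := if h : ∃ f, IsJonesWenzl m f then h.choose else 0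

/-- The half diagram from `m` to `m + 2` points: `f_m`, and a cup joining the last two points. -/
def fusionRight (m : ℕ) : Diag := jw m * cup m * jw m

/-- The half diagram from `m` to `m + 2` points: `f_m` at the bottom, a cup joining the points
`m` and `m + 1`, and `f_m` on the first `m` points at the top. -/
def fusionLeft (m : ℕ) : Diag := jw m * cup (m - 1) * jw m

/-- The half diagram from `m - 2` to `m + 2` points, `m ≥ 3`: `f_{m-2}` at the bottom, two nested
cups on the last four points, and `f_m` on the first `m` points at the top. -/
def fusionTwo (m : ℕ) : Diag := jw m * (cup (m - 1) * cup (m - 2)) * jw (m - 2)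

/-- `Path j k` is the type of descending paths in the Bratteli diagram for `l = 2` from the vertex
`(1, 0)` to the vertex `(n, i)`, where `n = 2 * j + 1` and `n - 2 * i = 2 * k + 1` (so `i = j - k`).
Edges from an odd level to the next even level are unique and are not recorded. From a vertex with
`m` through strands on an odd level there are, to the next odd level, a single edge to the vertex
with `m + 2` through strands (`zero`), a double edge to the one with `m` (`plus`, `minus`), and, if
`m ≥ 3`, a single edge to the one with `m - 2` (`two`). -/
inductive Path : ℕ → ℕ → Type
  | nil : Path 0 0
  | zero {j k : ℕ} (p : Path j k) : Path (j + 1) (k + 1)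
  | plus {j k : ℕ} (p : Path j k) : Path (j + 1) k
  | minus {j k : ℕ} (p : Path j k) : Path (j + 1) k
  | two {j k : ℕ} (p : Path j (k + 1)) : Path (j + 1) k

/-- The half diagram `v_p`, from `2 * k + 1` to `2 * j + 1` points, of a path `p`, built by the
fusion rules for `l = 2`, normalised by `v_p† v_p = f_{2k+1}`. -/
def half : {j k : ℕ} → Path j k → Diag
  | _, _, Path.nil => 1
  | _, _, @Path.zero _ k p => half p * jw (2 * k + 3)
  | _, _, @Path.plus _ k p =>
      ((1 / Real.sqrt 2 : ℝ) : ℂ) • (half p * (fusionRight (2 * k + 1) + fusionLeft (2 * k + 1)))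
  | _, _, @Path.minus _ k p =>
      (Complex.I * ((1 / Real.sqrt 2 : ℝ) : ℂ)) •
        (half p * (fusionRight (2 * k + 1) - fusionLeft (2 * k + 1)))
  | _, _, @Path.two _ k p =>
      (Complex.I * ((Real.sqrt ((k + 1 : ℝ) / (k + 2 : ℝ)) : ℝ) : ℂ)) •
        (half p * fusionTwo (2 * k + 3))

/-- The matrix element `v_{p,q} = v_p v_q†` of `TL_n(0)`, `n = 2 * j + 1`, belonging to two paths
that end at the same vertex. -/
def matrixElt {j k : ℕ} (p q : Path j k) : Diag := half p * dagger (half q)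

/-- The corrected involution `◇` on `TL_∞(0)`: the conjugate-linear involution that exchanges
`v_{p,q}` and `v_{q,p}`. -/
structure IsCorrectedInvolution (d : TLInf →ₛₗ[starRingEnd ℂ] TLInf) : Prop where
  map_mul : ∀ x y, d (x * y) = d y * d x
  involutive : ∀ x, d (d x) = x
  map_matrixElt : ∀ {j k : ℕ} (p q : Path j k) (x y : TLInf),
    (x : Diag) = matrixElt p q → (y : Diag) = matrixElt q p → d x = y

/-! Traces. -/

structure IsNormalizedTrace (χ : TLInf →ₗ[ℂ] ℂ) : Prop where
  map_one : χ 1 = 1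
  map_mul_comm : ∀ x y, χ (x * y) = χ (y * x)

/-- `χ (x ⊗ y) = χ x * χ y` for `x ∈ TL_m(0)` and `y ∈ TL_∞(0)`, where `x ⊗ y` is `x` on the first
`m` strands and `y` on the remaining ones. -/
def IsMultiplicative (χ : TLInf →ₗ[ℂ] ℂ) : Prop :=
  ∀ (m : ℕ) (x y z : TLInf), (x : Diag) ∈ TL m → (z : Diag) = (x : Diag) * shift m (y : Diag) →
    χ z = χ x * χ y

/-- `‖x‖²_{◇,χ} = χ (x x^◇)`. -/
def sqNorm (d : TLInf →ₛₗ[starRingEnd ℂ] TLInf) (χ : TLInf →ₗ[ℂ] ℂ) (x : TLInf) : ℂ :=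
  χ (x * d x)

/-- The normalized traces that are positive with respect to the involution `d`. -/
def positiveTraces (d : TLInf →ₛₗ[starRingEnd ℂ] TLInf) : Set (TLInf →ₗ[ℂ] ℂ) :=
  {χ | IsNormalizedTrace χ ∧ ∀ x, 0 ≤ (sqNorm d χ x).re ∧ (sqNorm d χ x).im = 0}

/-- Extremal traces: multiplicative normalized traces, and extreme points of the convex set of
positive normalized traces. (The theorem is stated for both descriptions, so that it does not
rest on their equivalence in the positive case.) -/
def IsExtremalTrace (d : TLInf →ₛₗ[starRingEnd ℂ] TLInf) (χ : TLInf →ₗ[ℂ] ℂ) : Prop :=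
  (IsNormalizedTrace χ ∧ IsMultiplicative χ) ∨ χ ∈ Set.extremePoints ℝ (positiveTraces d)

end TLZero

end

open scoped ComplexConjugate

noncomputable section

namespace TLZero

/-! ### Diagram calculus -/

/-! Write f_k for `oddJW k`, the idempotent on 2k+1 strands, and R, L, T for `stepRight`,
`stepLeft`, `stepTwo`. The engine is the splitting `oddJW_eq_sum`: on two more strands, f_k =
f_{k+1} + RL† + LR† − k/(k+1) TT†. It comes from a Wenzl recursion in steps of two, the even
idempotents being unavailable. Since R†R = L†L = 0 and R†L = f_k, the steps R and L span a
hyperbolic plane, and T†T is a negative multiple of an idempotent; the factors 1/√2 and i in `half`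
turn these into an orthonormal system for the bilinear pairing given by † (`half_norm`,
`half_orthogonal`). The half diagrams of one level also detect zero (`eq_zero_of_mul_half`).

Conjugating coefficients with respect to the v_p exchanges R and L and changes the sign of T. The
splitting respects this, so the maps v_{p,q} ↦ v_{q,p} on successive levels are compatible
(`DiamondPair.succ`) and single-valued (`DiamondPair.unique`). They reach all of TL_∞ because the
generators are in their domain: an even generator is a sum of terms (v_p R)(v_p R)†, while an odd
one past e_1 straddles two steps. Comparing the words in two steps on either side gives the closed
form `DiamondPair.gen_odd`.

For odd n > 2, multiplying the closed form of e_n◇ by e_n and taking the trace leaves four terms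
equal to γ and two containing e_n². For even n the involution is applied to the closed form of
e_{n+1}◇; commutation of distant elements and the trace property cancel everything except χ(e_n
e_n◇) and χ(e_n e_{n+1}) = γ.

A multiplicative trace is determined by γ because TL_{n+1} = TL_n + TL_n e_n TL_n reduces every
value to runs e_1 e_2 ⋯ e_r, and these satisfy a two-step recursion. It exists because the spin
chain with cup |01⟩ + i|10⟩ has operators preserving the number of sites in each state, so a product
functional with site weights of sum 1 and product γ is a trace. -/

theorem cap_mul_cup_self_assoc (i : ℕ) (x : Diag) : cap i * (cup i * x) = 0 := by
  rw [← mul_assoc, cap_mul_cup_self, zero_mul]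

theorem cap_mul_cup_succ_assoc (i : ℕ) (x : Diag) : cap i * (cup (i + 1) * x) = x := by
  rw [← mul_assoc, cap_mul_cup_succ, one_mul]

theorem cap_succ_mul_cup_assoc (i : ℕ) (x : Diag) : cap (i + 1) * (cup i * x) = x := by
  rw [← mul_assoc, cap_succ_mul_cup, one_mul]

theorem cap_mul_cup_of_le_assoc {i j : ℕ} (h : i ≤ j) (x : Diag) :
    cap i * (cup (j + 2) * x) = cup j * (cap i * x) := by
  rw [← mul_assoc, cap_mul_cup_of_le h, mul_assoc]

theorem cap_mul_cup_of_ge_assoc {i j : ℕ} (h : i ≤ j) (x : Diag) :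
    cap (j + 2) * (cup i * x) = cup i * (cap j * x) := by
  rw [← mul_assoc, cap_mul_cup_of_ge h, mul_assoc]

theorem cup_mul_cup_assoc {i j : ℕ} (h : i ≤ j) (x : Diag) :
    cup i * (cup j * x) = cup (j + 2) * (cup i * x) := by
  rw [← mul_assoc, cup_mul_cup h, mul_assoc]

theorem cap_mul_cap_assoc {i j : ℕ} (h : i ≤ j) (x : Diag) :
    cap j * (cap i * x) = cap i * (cap (j + 2) * x) := by
  rw [← mul_assoc, cap_mul_cap h, mul_assoc]

@[simp] theorem gen_succ (i : ℕ) : gen (i + 1) = cup i * cap i := rfl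

theorem gen_mem_TL {i n : ℕ} (hi : 1 ≤ i) (hn : i < n) : gen i ∈ TL n :=
  Algebra.subset_adjoin ⟨i, hi, hn, rfl⟩

theorem TL_mono {m n : ℕ} (h : m ≤ n) : TL m ≤ TL n :=
  Algebra.adjoin_mono fun _ ⟨i, h1, h2, h3⟩ => ⟨i, h1, h2.trans_le h, h3⟩

theorem TL_le_TLInf (n : ℕ) : TL n ≤ TLInf :=
  Algebra.adjoin_mono fun _ ⟨i, h1, _, h3⟩ => ⟨i, h1, h3⟩

theorem exists_mem_TL {x : Diag} (hx : x ∈ TLInf) : ∃ n, x ∈ TL n := by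
  refine Algebra.adjoin_induction ?_ ?_ ?_ ?_ hx
  · rintro _ ⟨i, hi, rfl⟩
    exact ⟨i + 1, gen_mem_TL hi (Nat.lt_succ_self i)⟩
  · exact fun r => ⟨0, (TL 0).algebraMap_mem r⟩
  · rintro x y _ _ ⟨m, hm⟩ ⟨n, hn⟩
    exact ⟨max m n, add_mem (TL_mono (le_max_left _ _) hm) (TL_mono (le_max_right _ _) hn)⟩
  · rintro x y _ _ ⟨m, hm⟩ ⟨n, hn⟩
    exact ⟨max m n, mul_mem (TL_mono (le_max_left _ _) hm) (TL_mono (le_max_right _ _) hn)⟩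

theorem gen_sq (i : ℕ) : gen i * gen i = 0 := by
  simp [gen, mul_assoc, cap_mul_cup_self_assoc]

theorem gen_mul_gen_succ {i : ℕ} (hi : 1 ≤ i) : gen i * gen (i + 1) = cup (i - 1) * cap i := by
  obtain ⟨i, rfl⟩ := Nat.exists_eq_add_of_le' hi
  simp [mul_assoc, cap_mul_cup_succ_assoc]

theorem gen_succ_mul_gen {i : ℕ} (hi : 1 ≤ i) : gen (i + 1) * gen i = cup i * cap (i - 1) := by
  obtain ⟨i, rfl⟩ := Nat.exists_eq_add_of_le' hi
  simp [mul_assoc, cap_succ_mul_cup_assoc]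

theorem gen_mul_gen_succ_mul_gen {i : ℕ} (hi : 1 ≤ i) : gen i * gen (i + 1) * gen i = gen i := by
  obtain ⟨i, rfl⟩ := Nat.exists_eq_add_of_le' hi
  simp [mul_assoc, cap_succ_mul_cup_assoc, cap_mul_cup_succ_assoc]

theorem gen_succ_mul_gen_mul_gen_succ {i : ℕ} (hi : 1 ≤ i) :
    gen (i + 1) * gen i * gen (i + 1) = gen (i + 1) := by
  obtain ⟨i, rfl⟩ := Nat.exists_eq_add_of_le' hi
  simp [mul_assoc, cap_succ_mul_cup_assoc, cap_mul_cup_succ_assoc]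

/-- Elements of `TL_n` commute with cups and caps to the right of the first `n` strands. -/
theorem mul_cup_of_mem_TL {n i : ℕ} {x : Diag} (hx : x ∈ TL n) (hi : n ≤ i) :
    x * cup i = cup i * x := by
  refine Algebra.adjoin_induction (p := fun x _ => x * cup i = cup i * x) ?_ ?_ ?_ ?_ hx
  · rintro _ ⟨l, h1, h2, rfl⟩
    obtain ⟨l, rfl⟩ := Nat.exists_eq_add_of_le' h1
    obtain ⟨j, rfl⟩ := Nat.exists_eq_add_of_le' (show l + 2 ≤ i by omega)
    have : l ≤ j + l := by omega
    rw [gen_succ, ← add_assoc, mul_assoc, cap_mul_cup_of_le this, ← mul_assoc, cup_mul_cup this,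
      mul_assoc]
  · exact fun r => Algebra.commutes r _
  · intro x y _ _ h1 h2; rw [add_mul, mul_add, h1, h2]
  · intro x y _ _ h1 h2; rw [mul_assoc, h2, ← mul_assoc, h1, mul_assoc]

theorem mul_cap_of_mem_TL {n i : ℕ} {x : Diag} (hx : x ∈ TL n) (hi : n ≤ i) :
    x * cap i = cap i * x := by
  refine Algebra.adjoin_induction (p := fun x _ => x * cap i = cap i * x) ?_ ?_ ?_ ?_ hx
  · rintro _ ⟨l, h1, h2, rfl⟩
    obtain ⟨l, rfl⟩ := Nat.exists_eq_add_of_le' h1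
    obtain ⟨j, rfl⟩ := Nat.exists_eq_add_of_le' (show l + 2 ≤ i by omega)
    have : l ≤ j + l := by omega
    rw [gen_succ, ← add_assoc, mul_assoc, ← cap_mul_cap this, ← mul_assoc, ← mul_assoc,
      cap_mul_cup_of_ge this]
  · exact fun r => Algebra.commutes r _
  · intro x y _ _ h1 h2; rw [add_mul, mul_add, h1, h2]
  · intro x y _ _ h1 h2; rw [mul_assoc, h2, ← mul_assoc, h1, mul_assoc]

/-! ### Reflection -/

@[simp] theorem dagger_cup (i : ℕ) : dagger (cup i) = cap i := by
  simp [dagger, daggerHom, cup, daggerGen]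

@[simp] theorem dagger_cap (i : ℕ) : dagger (cap i) = cup i := by
  simp [dagger, daggerHom, cap, daggerGen]

@[simp] theorem dagger_mul (x y : Diag) : dagger (x * y) = dagger y * dagger x := by simp [dagger]

@[simp] theorem dagger_add (x y : Diag) : dagger (x + y) = dagger x + dagger y := by simp [dagger]

@[simp] theorem dagger_sub (x y : Diag) : dagger (x - y) = dagger x - dagger y := by simp [dagger]

@[simp] theorem dagger_neg (x : Diag) : dagger (-x) = -dagger x := by simp [dagger]

@[simp] theorem dagger_zero : dagger 0 = 0 := by simp [dagger]

@[simp] theorem dagger_one : dagger 1 = 1 := by simp [dagger]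

@[simp] theorem dagger_smul (c : ℂ) (x : Diag) : dagger (c • x) = c • dagger x := by simp [dagger]

@[simp] theorem dagger_gen (i : ℕ) : dagger (gen i) = gen i := by simp [gen]

theorem dagger_mem_TL {n : ℕ} {x : Diag} (hx : x ∈ TL n) : dagger x ∈ TL n := by
  refine Algebra.adjoin_induction (p := fun x _ => dagger x ∈ TL n) ?_ ?_ ?_ ?_ hx
  · rintro _ ⟨l, h1, h2, rfl⟩
    simpa using gen_mem_TL h1 h2
  · intro r
    rw [Algebra.algebraMap_eq_smul_one, dagger_smul, dagger_one]
    exact Subalgebra.smul_mem _ (one_mem _) _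
  · intro x y _ _ h1 h2; rw [dagger_add]; exact add_mem h1 h2
  · intro x y _ _ h1 h2; rw [dagger_mul]; exact mul_mem h2 h1

@[simp] theorem dagger_dagger (x : Diag) : dagger (dagger x) = x := by
  obtain ⟨x, rfl⟩ := RingQuot.mkAlgHom_surjective ℂ Rel x
  induction x using FreeAlgebra.induction with
  | grade0 r => simp [Algebra.algebraMap_eq_smul_one]
  | grade1 g =>
    cases g with
    | cup i => exact (congrArg dagger (dagger_cup i)).trans (dagger_cap i)
    | cap i => exact (congrArg dagger (dagger_cap i)).trans (dagger_cup i)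
  | mul a b ha hb => simp [ha, hb]
  | add a b ha hb => simp [ha, hb]

/-! ### The spin chain representation

The space `ℕ → ℂ` is identified with two copies of itself through the binary digits; the isometries
`push b` and their inverses `pull b` satisfy the relations of the Cuntz algebra on two generators,
and a spin chain with sites in `Bool` is realised by products of them. -/

abbrev Chain : Type := Module.End ℂ (ℕ → ℂ)

def push (b : Bool) : Chain where
  toFun g n := if n.bodd = b then g n.div2 else 0
  map_add' f g := by ext n; by_cases h : n.bodd = b <;> simp [h]
  map_smul' c g := by ext n; by_cases h : n.bodd = b <;> simp [h]

def pull (b : Bool) : Chain where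
  toFun g n := g (Nat.bit b n)
  map_add' _ _ := rfl
  map_smul' _ _ := rfl

@[simp] theorem pull_mul_push_self (b : Bool) : pull b * push b = 1 := by
  ext g n; simp [pull, push, Nat.bodd_bit, Nat.div2_bit]

@[simp] theorem pull_true_mul_push_false : pull true * push false = 0 := by
  refine LinearMap.ext fun g => funext fun n => ?_
  simp [pull, push]

@[simp] theorem pull_false_mul_push_true : pull false * push true = 0 := by
  refine LinearMap.ext fun g => funext fun n => ?_
  simp [pull, push]

theorem push_mul_pull_add : push false * pull false + push true * pull true = 1 := by
  refine LinearMap.ext fun g => funext fun n => ?_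
  have := congrArg g (Nat.bit_bodd_div2 n)
  rcases h : n.bodd with _ | _ <;> rw [h] at this <;> simpa [pull, push, h] using this

@[simp] theorem pull_mul_push_self_assoc (b : Bool) (x : Chain) : pull b * (push b * x) = x := by
  rw [← mul_assoc, pull_mul_push_self, one_mul]

@[simp] theorem pull_true_mul_push_false_assoc (x : Chain) : pull true * (push false * x) = 0 := by
  rw [← mul_assoc, pull_true_mul_push_false, zero_mul]

@[simp] theorem pull_false_mul_push_true_assoc (x : Chain) : pull false * (push true * x) = 0 := by
  rw [← mul_assoc, pull_false_mul_push_true, zero_mul]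

/-- Adds a site on the left of the chain. -/
def addSite (x : Chain) : Chain := push false * x * pull false + push true * x * pull true

theorem addSite_mul (x y : Chain) : addSite (x * y) = addSite x * addSite y := by
  simp [addSite, mul_add, add_mul, mul_assoc]

theorem addSite_one : addSite 1 = 1 := by simpa [addSite] using push_mul_pull_add

theorem addSite_zero : addSite 0 = 0 := by simp [addSite]

def addSites (m : ℕ) (x : Chain) : Chain := addSite^[m] x

theorem addSites_succ (m : ℕ) (x : Chain) : addSites (m + 1) x = addSite (addSites m x) :=
  Function.iterate_succ_apply' _ _ _

theorem addSites_add (m n : ℕ) (x : Chain) : addSites (m + n) x = addSites m (addSites n x) :=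
  Function.iterate_add_apply _ _ _ _

theorem addSites_mul (m : ℕ) (x y : Chain) : addSites m (x * y) = addSites m x * addSites m y := by
  induction m with
  | zero => rfl
  | succ m ih => simp only [addSites_succ, ih, addSite_mul]

theorem addSites_one (m : ℕ) : addSites m 1 = 1 := by
  induction m with
  | zero => rfl
  | succ m ih => simp only [addSites_succ, ih, addSite_one]

/-- Creates a pair of neighbouring sites. -/
def pairCup : Chain := push false * push true + Complex.I • (push true * push false)

/-- Annihilates a pair of neighbouring sites. -/
def pairCap : Chain := pull false * pull true + (-Complex.I) • (pull true * pull false)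

/-- The two mixed pairings contribute i and −i; this cancellation is loop parameter 0. -/
theorem pairCap_mul_pairCup : pairCap * pairCup = 0 := by
  simp only [pairCap, pairCup, mul_add, add_mul, mul_assoc, smul_mul_assoc, mul_smul_comm,
    pull_mul_push_self_assoc, pull_mul_push_self, pull_true_mul_push_false_assoc,
    pull_false_mul_push_true_assoc, mul_zero, smul_zero, add_zero, zero_add]
  rw [← add_smul, neg_add_cancel, zero_smul]

theorem pairCap_mul_addSite_pairCup : pairCap * addSite pairCup = 1 := by
  rw [← push_mul_pull_add]
  simp [-neg_smul, pairCap, pairCup, addSite, mul_add, add_mul, mul_assoc, smul_smul]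

theorem addSite_pairCap_mul_pairCup : addSite pairCap * pairCup = 1 := by
  rw [← push_mul_pull_add]
  simp [-neg_smul, pairCap, pairCup, addSite, mul_add, add_mul, mul_assoc, smul_smul, add_comm]

/-- With its companion for `pairCup` this gives all four distant-commutation relations of `Rel`,
once the shift `addSites i` is factored out. -/
theorem pairCap_mul_addSite_addSite (x : Chain) : pairCap * addSite (addSite x) = x * pairCap := by
  simp [-neg_smul, pairCap, addSite, mul_add, add_mul, mul_assoc, add_comm]

theorem addSite_addSite_mul_pairCup (x : Chain) : addSite (addSite x) * pairCup = pairCup * x := by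
  simp [pairCup, addSite, mul_add, add_mul, mul_assoc, add_comm]

def chainGen : Gen → Chain
  | Gen.cup i => addSites i pairCup
  | Gen.cap i => addSites i pairCap

/-- The representation of stable diagrams on the spin chain. -/
def chainRep : Diag →ₐ[ℂ] Chain :=
  RingQuot.liftAlgHom ℂ ⟨FreeAlgebra.lift ℂ chainGen, by
    intro a b h
    cases h with
    | loop i =>
      simp only [map_mul, FreeAlgebra.lift_ι_apply, chainGen, ← addSites_mul, pairCap_mul_pairCup,
        map_zero]
      induction i with
      | zero => rfl
      | succ i ih => rw [addSites_succ, ih, addSite_zero]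
    | zigzag_left i =>
      simp only [map_mul, FreeAlgebra.lift_ι_apply, chainGen, addSites_add i 1, ← addSites_mul,
        map_one]
      exact (congrArg _ pairCap_mul_addSite_pairCup).trans (addSites_one i)
    | zigzag_right i =>
      simp only [map_mul, FreeAlgebra.lift_ι_apply, chainGen, addSites_add i 1, ← addSites_mul,
        map_one]
      exact (congrArg _ addSite_pairCap_mul_pairCup).trans (addSites_one i)
    | cap_cup i j h =>
      obtain ⟨j, rfl⟩ := Nat.exists_eq_add_of_le h
      simp only [map_mul, FreeAlgebra.lift_ι_apply, chainGen, add_assoc, addSites_add i,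
        ← addSites_mul, add_comm j 2, addSites_add 2]
      exact congrArg _ (pairCap_mul_addSite_addSite _)
    | cup_cap i j h =>
      obtain ⟨j, rfl⟩ := Nat.exists_eq_add_of_le h
      simp only [map_mul, FreeAlgebra.lift_ι_apply, chainGen, add_assoc, addSites_add i,
        ← addSites_mul, add_comm j 2, addSites_add 2]
      exact congrArg _ (addSite_addSite_mul_pairCup _)
    | cup_cup i j h =>
      obtain ⟨j, rfl⟩ := Nat.exists_eq_add_of_le h
      simp only [map_mul, FreeAlgebra.lift_ι_apply, chainGen, add_assoc, addSites_add i,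
        ← addSites_mul, add_comm j 2, addSites_add 2]
      exact congrArg _ (addSite_addSite_mul_pairCup _).symm
    | cap_cap i j h =>
      obtain ⟨j, rfl⟩ := Nat.exists_eq_add_of_le h
      simp only [map_mul, FreeAlgebra.lift_ι_apply, chainGen, add_assoc, addSites_add i,
        ← addSites_mul, add_comm j 2, addSites_add 2]
      exact congrArg _ (pairCap_mul_addSite_addSite _).symm⟩

@[simp] theorem chainRep_cup (i : ℕ) : chainRep (cup i) = addSites i pairCup := by
  simp [chainRep, cup, chainGen]

@[simp] theorem chainRep_cap (i : ℕ) : chainRep (cap i) = addSites i pairCap := by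
  simp [chainRep, cap, chainGen]

/-- A quotient by relations might collapse, so a model is needed to see 1 ≠ 0. This starts the
Jones–Wenzl induction, as f_1 = 1. -/
instance : Nontrivial Diag := by
  refine ⟨⟨1, 0, fun h => ?_⟩⟩
  have h1 := congrArg chainRep h
  rw [map_one, map_zero] at h1
  have h2 := congrFun (LinearMap.congr_fun h1 fun _ => 1) 0
  simp at h2

/-! ### Jones-Wenzl idempotents -/

/-- Only the identity coefficient of x survives against something killed by every generator. The
same scalar serves on both sides. -/
theorem exists_scalar_of_mem_TL {m : ℕ} {x : Diag} (hx : x ∈ TL m) : ∃ α : ℂ,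
    (∀ g, (∀ i, 1 ≤ i → i < m → gen i * g = 0) → x * g = α • g) ∧
    (∀ g, (∀ i, 1 ≤ i → i < m → g * gen i = 0) → g * x = α • g) := by
  refine Algebra.adjoin_induction (p := fun x _ => ∃ α : ℂ,
    (∀ g, (∀ i, 1 ≤ i → i < m → gen i * g = 0) → x * g = α • g) ∧
    (∀ g, (∀ i, 1 ≤ i → i < m → g * gen i = 0) → g * x = α • g)) ?_ ?_ ?_ ?_ hx
  · rintro _ ⟨i, h1, h2, rfl⟩
    exact ⟨0, fun g hg => by rw [hg i h1 h2, zero_smul], fun g hg => by rw [hg i h1 h2, zero_smul]⟩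
  · intro r
    exact ⟨r, fun g _ => (Algebra.smul_def r g).symm, fun g _ => by
      rw [← Algebra.commutes, Algebra.smul_def]⟩
  · rintro x y _ _ ⟨α, h1, h2⟩ ⟨β, h3, h4⟩
    exact ⟨α + β, fun g hg => by rw [add_mul, h1 g hg, h3 g hg, add_smul],
      fun g hg => by rw [mul_add, h2 g hg, h4 g hg, add_smul]⟩
  · rintro x y _ _ ⟨α, h1, h2⟩ ⟨β, h3, h4⟩
    exact ⟨α * β, fun g hg => by
        rw [mul_assoc, h3 g hg, mul_smul_comm, h1 g hg, smul_smul, mul_comm],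
      fun g hg => by rw [← mul_assoc, h2 g hg, smul_mul_assoc, h4 g hg, smul_smul]⟩

namespace IsJonesWenzl

variable {m : ℕ} {f : Diag}

theorem scalar_eq_one (hf : IsJonesWenzl m f) {α : ℂ} (h : f * f = α • f) : α = 1 := by
  rw [hf.idem] at h
  by_contra hα
  have h1 : (1 - α) • f = 0 := (sub_smul 1 α f).trans (by rw [one_smul, ← h, sub_self])
  rcases smul_eq_zero.1 h1 with h2 | h2
  · exact hα (sub_eq_zero.1 h2).symm
  · exact hf.ne_zero h2

/-- The element f acts on all such g by one scalar, and the choice g = f shows that it is 1. -/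
theorem mul_eq (hf : IsJonesWenzl m f) {g : Diag} (hg : ∀ i, 1 ≤ i → i < m → gen i * g = 0) :
    f * g = g := by
  obtain ⟨α, h1, -⟩ := exists_scalar_of_mem_TL hf.mem
  rw [h1 g hg, hf.scalar_eq_one (h1 f hf.gen_mul), one_smul]

theorem eq_mul (hf : IsJonesWenzl m f) {g : Diag} (hg : ∀ i, 1 ≤ i → i < m → g * gen i = 0) :
    g * f = g := by
  obtain ⟨α, -, h2⟩ := exists_scalar_of_mem_TL hf.mem
  rw [h2 g hg, hf.scalar_eq_one (h2 f hf.mul_gen), one_smul]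

theorem unique (hf : IsJonesWenzl m f) {g : Diag} (hg : IsJonesWenzl m g) : f = g :=
  (hg.eq_mul hf.mul_gen).symm.trans (hf.mul_eq hg.gen_mul)

theorem dagger_eq (hf : IsJonesWenzl m f) : dagger f = f := by
  refine IsJonesWenzl.unique ⟨dagger_mem_TL hf.mem, fun h => hf.ne_zero ?_, ?_, ?_, ?_⟩ hf
  · rw [← dagger_dagger f, h, dagger_zero]
  · rw [← dagger_mul, hf.idem]
  · intro i h1 h2
    rw [← dagger_gen, ← dagger_mul, hf.mul_gen i h1 h2, dagger_zero]
  · intro i h1 h2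
    rw [← dagger_gen, ← dagger_mul, hf.gen_mul i h1 h2, dagger_zero]

theorem jw_eq (hf : IsJonesWenzl m f) : jw m = f := by
  have h : ∃ f, IsJonesWenzl m f := ⟨f, hf⟩
  rw [jw, dif_pos h]
  exact h.choose_spec.unique hf

/-- Composing e_{i+1} with `cap (i + 1)` straightens its cup and leaves `cap i`. -/
theorem cap_mul (hf : IsJonesWenzl m f) {i : ℕ} (hi : i + 1 < m) : cap i * f = 0 := by
  rw [← cap_succ_mul_cup_assoc i (cap i * f), ← mul_assoc (cup i), ← gen_succ,
    hf.gen_mul (i + 1) (by omega) hi, mul_zero]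

theorem mul_cup (hf : IsJonesWenzl m f) {i : ℕ} (hi : i + 1 < m) : f * cup i = 0 := by
  rw [← hf.dagger_eq, ← dagger_cap, ← dagger_mul, hf.cap_mul hi, dagger_zero]

end IsJonesWenzl

theorem isJonesWenzl_one : IsJonesWenzl 1 1 :=
  ⟨one_mem _, one_ne_zero, one_mul 1, fun _ _ _ => by omega, fun _ _ _ => by omega⟩

/-! ### The two-step Wenzl recursion -/

/-- The diagrams to be inserted between two copies of the Jones-Wenzl idempotent on `2 * k + 1`
strands in order to obtain the one on `2 * k + 3` strands. -/
def wenzl (k : ℕ) : Diag :=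
  1 - cup (2 * k + 1) * cap (2 * k) - cup (2 * k) * cap (2 * k + 1) +
    ((k : ℂ) / (k + 1)) • (cup (2 * k) * (cup (2 * k - 1) * (cap (2 * k - 1) * cap (2 * k))))

theorem wenzl_mem (k : ℕ) : wenzl k ∈ TL (2 * k + 3) := by
  refine add_mem (sub_mem (sub_mem (one_mem _) ?_) ?_) ?_
  · have := gen_succ_mul_gen (i := 2 * k + 1) (by omega)
    rw [Nat.add_sub_cancel] at this
    rw [← this]
    exact mul_mem (gen_mem_TL (by omega) (by omega)) (gen_mem_TL (by omega) (by omega))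
  · have := gen_mul_gen_succ (i := 2 * k + 1) (by omega)
    rw [Nat.add_sub_cancel] at this
    rw [← this]
    exact mul_mem (gen_mem_TL (by omega) (by omega)) (gen_mem_TL (by omega) (by omega))
  · cases k with
    | zero => simp
    | succ k =>
      refine Subalgebra.smul_mem _ ?_ _
      have : cup (2 * (k + 1)) * (cup (2 * (k + 1) - 1) * (cap (2 * (k + 1) - 1) *
          cap (2 * (k + 1)))) = gen (2 * k + 3) * gen (2 * k + 2) * gen (2 * k + 4) *
            gen (2 * k + 3) := by
        have h : 2 * (k + 1) - 1 = 2 * k + 1 := by omega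
        rw [h]
        simp only [gen_succ, mul_assoc, mul_add, mul_one]
        rw [cap_succ_mul_cup_assoc, cap_succ_mul_cup_assoc (2 * k + 2),
          cap_mul_cup_of_le_assoc (le_refl (2 * k + 1))]
      rw [this]
      exact mul_mem (mul_mem (mul_mem (gen_mem_TL (by omega) (by omega))
        (gen_mem_TL (by omega) (by omega))) (gen_mem_TL (by omega) (by omega)))
        (gen_mem_TL (by omega) (by omega))

theorem dagger_wenzl (k : ℕ) : dagger (wenzl k) = wenzl k := by
  simp [wenzl, mul_assoc]
  abel


/-- The Jones-Wenzl idempotent on `2 * k + 1` strands. -/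
def oddJW (k : ℕ) : Diag := jw (2 * k + 1)

def oddJWCandidate (k : ℕ) : Diag := oddJW k * wenzl k * oddJW k

theorem zero_sub_sub_add_smul {A : Type*} [Ring A] [Algebra ℂ A] (c : ℂ) (x : A) :
    0 - x - x + c • x = (-1 - 1 + c) • x := by
  module

/-- Closing the last strand of `f_{2k+3}`. -/
theorem partial_trace {k : ℕ} (h : IsJonesWenzl (2 * k + 1) (oddJW k)) :
    cap (2 * k + 2) * (oddJW k * (wenzl k * (oddJW k * cup (2 * k + 2)))) =
      (-((k + 2 : ℂ) / (k + 1))) • (oddJW k * (cup (2 * k) * (cap (2 * k) * oddJW k))) := by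
  have h1 : cap (2 * k + 2) * (wenzl k * cup (2 * k + 2)) =
      (-((k + 2 : ℂ) / (k + 1))) • (cup (2 * k) * cap (2 * k)) := by
    have h2 : cap (2 * k + 2) * (cup (2 * k + 1) * (cap (2 * k) * cup (2 * k + 2))) =
        cup (2 * k) * cap (2 * k) := by
      rw [cap_succ_mul_cup_assoc, cap_mul_cup_of_le le_rfl]
    have h3 : cap (2 * k + 2) * (cup (2 * k) * (cap (2 * k + 1) * cup (2 * k + 2))) =
        cup (2 * k) * cap (2 * k) := by
      rw [cap_mul_cup_succ, mul_one, cap_mul_cup_of_ge le_rfl]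
    have h4 : ((k : ℂ) / (k + 1)) • (cap (2 * k + 2) * (cup (2 * k) * (cup (2 * k - 1) *
        (cap (2 * k - 1) * (cap (2 * k) * cup (2 * k + 2)))))) =
        ((k : ℂ) / (k + 1)) • (cup (2 * k) * cap (2 * k)) := by
      cases k with
      | zero => simp
      | succ k =>
        rw [show 2 * (k + 1) - 1 = 2 * k + 1 by omega, show 2 * (k + 1) = 2 * k + 2 by ring,
          cap_mul_cup_of_ge_assoc le_rfl, cap_succ_mul_cup_assoc, cap_mul_cup_of_le le_rfl,
          cap_mul_cup_succ_assoc]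
    simp only [wenzl, mul_add, add_mul, mul_sub, sub_mul, mul_assoc, one_mul, mul_smul_comm,
      smul_mul_assoc, h2, h3, h4, cap_mul_cup_self]
    -- The identity term of `wenzl k` closes to a loop and gives 0, the two bends give −1 each, and
    -- the double cup gives k/(k+1).
    have h5 : (-((k + 2 : ℂ) / (k + 1))) = -1 - 1 + (k : ℂ) / (k + 1) := by
      have : (k + 1 : ℂ) ≠ 0 := Nat.cast_add_one_ne_zero k
      field_simp
      ring
    rw [h5]
    exact zero_sub_sub_add_smul _ _
  rw [mul_cup_of_mem_TL h.mem (by omega), ← mul_assoc (cap _) (oddJW k),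
    ← mul_cap_of_mem_TL h.mem (by omega), mul_assoc, ← mul_assoc (wenzl k),
    ← mul_assoc (cap (2 * k + 2)), h1]
  simp only [mul_assoc, mul_smul_comm, smul_mul_assoc]

/-- Against `cap (2 * k + 1)` the identity cancels one bend and the other forms a loop. The rest
begins with `cup (2 * k - 1)`, which f_k kills; for k = 0 its coefficient is 0. -/
theorem cap_succ_mul_candidate {k : ℕ} (h : IsJonesWenzl (2 * k + 1) (oddJW k)) :
    cap (2 * k + 1) * oddJWCandidate k = 0 := by
  have h1 : cap (2 * k + 1) * wenzl k =
      ((k : ℂ) / (k + 1)) • (cup (2 * k - 1) * (cap (2 * k - 1) * cap (2 * k))) := by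
    simp only [wenzl, mul_add, mul_sub, mul_one, cap_mul_cup_self_assoc, cap_succ_mul_cup_assoc,
      mul_smul_comm]
    abel
  have h2 : ((k : ℂ) / (k + 1)) • (oddJW k * cup (2 * k - 1)) = 0 := by
    cases k with
    | zero => simp
    | succ k => rw [h.mul_cup (by omega), smul_zero]
  rw [oddJWCandidate, ← mul_assoc, ← mul_assoc, ← mul_cap_of_mem_TL h.mem le_rfl,
    mul_assoc (oddJW k), h1, mul_smul_comm, ← mul_assoc, ← smul_mul_assoc, h2, zero_mul, zero_mul]

theorem cap_mul_candidate_zero : cap 0 * oddJWCandidate 0 = 0 := by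
  have h : oddJW 0 = 1 := isJonesWenzl_one.jw_eq
  have h1 := cap_mul_cup_succ_assoc 0 (cap 0)
  rw [zero_add] at h1
  simp [oddJWCandidate, h, wenzl, mul_sub, h1, cap_mul_cup_self_assoc]

/-- Expansion of a partial closure of `f_{2k+3}`. -/
theorem oddJW_mul_cap_mul {k : ℕ} (h : IsJonesWenzl (2 * k + 1) (oddJW k))
    (h' : IsJonesWenzl (2 * k + 3) (oddJW (k + 1))) (hr : oddJW (k + 1) = oddJWCandidate k) :
    oddJW (k + 1) * (cap (2 * k + 2) * oddJW (k + 1)) = cap (2 * k + 2) * oddJW (k + 1) -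
      oddJW k * (cup (2 * k) * (cap (2 * k + 1) * (cap (2 * k + 2) * oddJW (k + 1)))) := by
  have habs : oddJW k * oddJW (k + 1) = oddJW (k + 1) :=
    h.mul_eq fun i h1 h2 => h'.gen_mul i h1 (by omega)
  have hz : cap (2 * k) * (cap (2 * k + 2) * oddJW (k + 1)) = 0 := by
    rw [← cap_mul_cap_assoc le_rfl, h'.cap_mul (by omega), mul_zero]
  have hc : oddJW k * (cap (2 * k + 2) * oddJW (k + 1)) = cap (2 * k + 2) * oddJW (k + 1) := by
    rw [← mul_assoc, mul_cap_of_mem_TL h.mem (by omega), mul_assoc, habs]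
  conv_lhs => enter [1]; rw [hr]
  rw [oddJWCandidate, mul_assoc, mul_assoc, hc, wenzl]
  simp only [add_mul, sub_mul, one_mul, mul_assoc, smul_mul_assoc, hz, mul_zero, smul_zero,
    sub_zero, add_zero, mul_sub, hc]

/-- This is what dictates the coefficient in `wenzl`. The identity term gives cap·f_{k+1}, one bend
gives f_{k+1}·cap·f_{k+1}, which `oddJW_mul_cap_mul` expands, and the other vanishes. The double cup
carries the partial-trace factor times (k+1)/(k+2), that is −1, and cancels the remaining
correction. -/
theorem cap_mul_candidate {k : ℕ} (h : IsJonesWenzl (2 * k + 1) (oddJW k))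
    (h' : IsJonesWenzl (2 * k + 3) (oddJW (k + 1))) (hr : oddJW (k + 1) = oddJWCandidate k) :
    cap (2 * k + 2) * oddJWCandidate (k + 1) = 0 := by
  have habs : oddJW k * oddJW (k + 1) = oddJW (k + 1) :=
    h.mul_eq fun i h1 h2 => h'.gen_mul i h1 (by omega)
  have hp : cap (2 * k + 2) * (oddJW (k + 1) * cup (2 * k + 2)) =
      (-((k + 2 : ℂ) / (k + 1))) • (oddJW k * (cup (2 * k) * (cap (2 * k) * oddJW k))) := by
    rw [← partial_trace h, hr, oddJWCandidate, mul_assoc, mul_assoc]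
  have h1 : cap (2 * k + 2) * (oddJW (k + 1) * (cup (2 * k + 3) * (cap (2 * k + 2) *
      oddJW (k + 1)))) = oddJW (k + 1) * (cap (2 * k + 2) * oddJW (k + 1)) := by
    rw [← mul_assoc (oddJW (k + 1)), mul_cup_of_mem_TL h'.mem le_rfl, mul_assoc,
      cap_mul_cup_succ_assoc]
  have h2 : cap (2 * k + 2) * (oddJW (k + 1) * (cup (2 * k + 2) * (cap (2 * k + 3) *
      oddJW (k + 1)))) = 0 := by
    rw [← mul_cap_of_mem_TL h'.mem le_rfl, ← mul_assoc, ← mul_assoc, mul_assoc (cap _), hp]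
    simp only [smul_mul_assoc, mul_assoc]
    rw [← mul_assoc (oddJW k) (oddJW (k + 1)), habs, ← mul_assoc (cap (2 * k)),
      h'.cap_mul (by omega)]
    simp
  have h3 : (((k + 1 : ℕ) : ℂ) / ((k + 1 : ℕ) + 1)) • (cap (2 * k + 2) * (oddJW (k + 1) *
      (cup (2 * k + 2) * (cup (2 * k + 1) * (cap (2 * k + 1) * (cap (2 * k + 2) *
        oddJW (k + 1))))))) =
      - (oddJW k * (cup (2 * k) * (cap (2 * k + 1) * (cap (2 * k + 2) * oddJW (k + 1))))) := by
    rw [← mul_assoc (oddJW (k + 1)), ← mul_assoc (cap _), hp]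
    simp only [smul_mul_assoc, mul_assoc, smul_smul]
    have h4 : ((k + 1 : ℕ) : ℂ) / ((k + 1 : ℕ) + 1) * (-((k + 2 : ℂ) / (k + 1))) = -1 := by
      have : (k + 1 : ℂ) ≠ 0 := Nat.cast_add_one_ne_zero k
      have : (k + 2 : ℂ) ≠ 0 := by exact_mod_cast (show k + 2 ≠ 0 by omega)
      have : (k + 1 + 1 : ℂ) ≠ 0 := by exact_mod_cast (show k + 1 + 1 ≠ 0 by omega)
      push_cast
      field_simp
      ring
    rw [h4, ← mul_assoc (oddJW k) (cup (2 * k + 1)), mul_cup_of_mem_TL h.mem le_rfl, mul_assoc,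
      cap_mul_cup_succ_assoc, ← mul_assoc (oddJW k) (cap (2 * k + 1)),
      mul_cap_of_mem_TL h.mem le_rfl, mul_assoc, ← mul_assoc (oddJW k) (cap (2 * k + 2)),
      mul_cap_of_mem_TL h.mem (by omega), mul_assoc, habs]
    simp
  rw [oddJWCandidate, wenzl, show 2 * (k + 1) = 2 * k + 2 by ring,
    show 2 * k + 2 - 1 = 2 * k + 1 by omega, show 2 * k + 2 + 1 = 2 * k + 3 by ring]
  simp only [add_mul, sub_mul, mul_one, mul_assoc, smul_mul_assoc, mul_add, mul_sub, h1,
    h2, h3, mul_smul_comm, h'.idem, oddJW_mul_cap_mul h h' hr]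
  abel

/-- Otherwise the partial trace would force f_k·cup·cap·f_k = 0, and straightening this between `cap
(2 * k + 1)` and `cup (2 * k + 1)` would return f_k = 0. -/
theorem candidate_ne_zero {k : ℕ} (h : IsJonesWenzl (2 * k + 1) (oddJW k)) :
    oddJWCandidate k ≠ 0 := by
  intro hz
  have h1 := partial_trace h
  rw [← mul_assoc (wenzl k), ← mul_assoc (oddJW k), ← mul_assoc (oddJW k), ← oddJWCandidate, hz,
    zero_mul, mul_zero] at h1
  have hk : -((k + 2 : ℂ) / (k + 1)) ≠ 0 :=
    neg_ne_zero.2 (div_ne_zero (by exact_mod_cast (show k + 2 ≠ 0 by omega))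
      (Nat.cast_add_one_ne_zero k))
  have h2 := congrArg (fun x => cap (2 * k + 1) * (x * cup (2 * k + 1)))
    ((smul_eq_zero.1 h1.symm).resolve_left hk)
  simp only [mul_assoc] at h2
  rw [mul_cup_of_mem_TL h.mem le_rfl, cap_mul_cup_succ_assoc, ← mul_assoc,
    ← mul_cap_of_mem_TL h.mem le_rfl, mul_assoc, cap_succ_mul_cup_assoc, h.idem, zero_mul,
    mul_zero] at h2
  exact h.ne_zero h2

/-- Smaller generators are killed by the outer f_k and the last one by `cap_succ_mul_candidate`, so
only `cap (2 * k)` has to be assumed. Idempotence follows because `wenzl k` fixes whatever its two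
caps kill; reflection gives the right-hand relations. -/
theorem isJonesWenzl_candidate {k : ℕ} (h : IsJonesWenzl (2 * k + 1) (oddJW k))
    (hc : cap (2 * k) * oddJWCandidate k = 0) :
    IsJonesWenzl (2 * k + 3) (oddJWCandidate k) := by
  have hd : dagger (oddJWCandidate k) = oddJWCandidate k := by
    simp [oddJWCandidate, dagger_wenzl, h.dagger_eq, mul_assoc]
  have hc' := cap_succ_mul_candidate h
  have hg : ∀ i, 1 ≤ i → i < 2 * k + 3 → gen i * oddJWCandidate k = 0 := by
    intro i h1 h2
    rcases Nat.lt_or_ge i (2 * k + 1) with h3 | h3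
    · rw [oddJWCandidate, ← mul_assoc, ← mul_assoc, h.gen_mul i h1 h3, zero_mul, zero_mul]
    · obtain rfl | rfl : i = 2 * k + 1 ∨ i = 2 * k + 2 := by omega
      · rw [gen_succ, mul_assoc, hc, mul_zero]
      · rw [gen_succ, mul_assoc, hc', mul_zero]
  have hm : oddJWCandidate k ∈ TL (2 * k + 3) :=
    mul_mem (mul_mem (TL_mono (by omega) h.mem) (wenzl_mem k)) (TL_mono (by omega) h.mem)
  have hf : oddJW k * oddJWCandidate k = oddJWCandidate k := by
    rw [oddJWCandidate, ← mul_assoc, ← mul_assoc, h.idem]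
  have hw : wenzl k * oddJWCandidate k = oddJWCandidate k := by
    simp [wenzl, add_mul, sub_mul, mul_assoc, hc, hc']
  refine ⟨hm, candidate_ne_zero h, ?_, hg, ?_⟩
  · nth_rewrite 1 [oddJWCandidate]
    rw [mul_assoc, mul_assoc, hf, hw, hf]
  · intro i h1 h2
    rw [← hd, ← dagger_gen, ← dagger_mul, hg i h1 h2, dagger_zero]

/-- The three claims travel together: the next step needs f_k, f_{k+1} and the recursion between
them. -/
theorem isJonesWenzl_oddJW_and (k : ℕ) : IsJonesWenzl (2 * k + 1) (oddJW k) ∧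
    IsJonesWenzl (2 * k + 3) (oddJW (k + 1)) ∧ oddJW (k + 1) = oddJWCandidate k := by
  have key : ∀ k, IsJonesWenzl (2 * k + 3) (oddJWCandidate k) →
      IsJonesWenzl (2 * k + 3) (oddJW (k + 1)) ∧ oddJW (k + 1) = oddJWCandidate k := by
    intro k hk
    have : oddJW (k + 1) = oddJWCandidate k := hk.jw_eq
    exact ⟨this ▸ hk, this⟩
  induction k with
  | zero =>
    have h : IsJonesWenzl (2 * 0 + 1) (oddJW 0) := by
      have h : oddJW 0 = 1 := isJonesWenzl_one.jw_eq
      rw [h]; exact isJonesWenzl_one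
    exact ⟨h, key 0 (isJonesWenzl_candidate h cap_mul_candidate_zero)⟩
  | succ k ih =>
    obtain ⟨h, h', hr⟩ := ih
    exact ⟨h', key (k + 1) (isJonesWenzl_candidate h' (cap_mul_candidate h h' hr))⟩

theorem isJonesWenzl_oddJW (k : ℕ) : IsJonesWenzl (2 * k + 1) (oddJW k) :=
  (isJonesWenzl_oddJW_and k).1

theorem oddJW_succ (k : ℕ) : oddJW (k + 1) = oddJW k * (wenzl k * oddJW k) := by
  rw [(isJonesWenzl_oddJW_and k).2.2, oddJWCandidate, mul_assoc]

theorem oddJW_zero : oddJW 0 = 1 := isJonesWenzl_one.jw_eq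

theorem oddJW_ne_zero (k : ℕ) : oddJW k ≠ 0 := (isJonesWenzl_oddJW k).ne_zero

@[simp] theorem dagger_oddJW (k : ℕ) : dagger (oddJW k) = oddJW k :=
  (isJonesWenzl_oddJW k).dagger_eq

theorem oddJW_mul_of_le {k l : ℕ} (h : k ≤ l) : oddJW k * oddJW l = oddJW l :=
  (isJonesWenzl_oddJW k).mul_eq fun i h1 h2 =>
    (isJonesWenzl_oddJW l).gen_mul i h1 (by omega)

theorem oddJW_mul_of_le_assoc {k l : ℕ} (h : k ≤ l) (x : Diag) :
    oddJW k * (oddJW l * x) = oddJW l * x := by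
  rw [← mul_assoc, oddJW_mul_of_le h]

theorem oddJW_mul_of_ge {k l : ℕ} (h : k ≤ l) : oddJW l * oddJW k = oddJW l :=
  (isJonesWenzl_oddJW k).eq_mul fun i h1 h2 =>
    (isJonesWenzl_oddJW l).mul_gen i h1 (by omega)

theorem oddJW_mul_of_ge_assoc {k l : ℕ} (h : k ≤ l) (x : Diag) :
    oddJW l * (oddJW k * x) = oddJW l * x := by
  rw [← mul_assoc, oddJW_mul_of_ge h]

theorem oddJW_idem (k : ℕ) : oddJW k * oddJW k = oddJW k := oddJW_mul_of_le le_rfl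

theorem oddJW_idem_assoc (k : ℕ) (x : Diag) : oddJW k * (oddJW k * x) = oddJW k * x :=
  oddJW_mul_of_le_assoc le_rfl x

theorem cap_mul_oddJW {i k : ℕ} (h : i < 2 * k) : cap i * oddJW k = 0 :=
  (isJonesWenzl_oddJW k).cap_mul (by omega)

theorem oddJW_mul_cup_eq_zero {i k : ℕ} (h : i < 2 * k) : oddJW k * cup i = 0 :=
  (isJonesWenzl_oddJW k).mul_cup (by omega)

theorem oddJW_mul_cup_eq_zero_assoc {i k : ℕ} (h : i < 2 * k) (x : Diag) :
    oddJW k * (cup i * x) = 0 := by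
  rw [← mul_assoc, oddJW_mul_cup_eq_zero h, zero_mul]

theorem oddJW_mul_cup {i k : ℕ} (h : 2 * k < i) : oddJW k * cup i = cup i * oddJW k :=
  mul_cup_of_mem_TL (isJonesWenzl_oddJW k).mem h

theorem oddJW_mul_cup_assoc {i k : ℕ} (h : 2 * k < i) (x : Diag) :
    oddJW k * (cup i * x) = cup i * (oddJW k * x) := by
  rw [← mul_assoc, oddJW_mul_cup h, mul_assoc]

theorem oddJW_mul_cap {i k : ℕ} (h : 2 * k < i) : oddJW k * cap i = cap i * oddJW k :=
  mul_cap_of_mem_TL (isJonesWenzl_oddJW k).mem h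

theorem oddJW_mul_cap_assoc {i k : ℕ} (h : 2 * k < i) (x : Diag) :
    oddJW k * (cap i * x) = cap i * (oddJW k * x) := by
  rw [← mul_assoc, oddJW_mul_cap h, mul_assoc]

theorem cap_mul_oddJW_mul_cup (k : ℕ) :
    cap (2 * k + 2) * (oddJW (k + 1) * cup (2 * k + 2)) =
      (-((k + 2 : ℂ) / (k + 1))) • (oddJW k * (cup (2 * k) * (cap (2 * k) * oddJW k))) := by
  rw [← partial_trace (isJonesWenzl_oddJW k), oddJW_succ, mul_assoc, mul_assoc]

/-- For positive k the partial trace produces a cap running into a Jones–Wenzl idempotent. This is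
what makes L isotropic. -/
theorem cap_mul_oddJW_mul_cup_mul_oddJW (k : ℕ) :
    cap (2 * k) * (oddJW k * (cup (2 * k) * oddJW k)) = 0 := by
  cases k with
  | zero => simp [oddJW_zero, cap_mul_cup_self]
  | succ k =>
    have h := congrArg (· * oddJW (k + 1)) (cap_mul_oddJW_mul_cup k)
    simp only [mul_assoc, smul_mul_assoc] at h
    rw [show 2 * (k + 1) = 2 * k + 2 by ring, h, oddJW_mul_of_le (by omega : k ≤ k + 1),
      cap_mul_oddJW (by omega)]
    simp

/-! ### Steps of the Bratteli diagram -/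

def stepRight (k : ℕ) : Diag := cup (2 * k + 1) * oddJW k

def stepLeft (k : ℕ) : Diag := oddJW k * (cup (2 * k) * oddJW k)

/-- The step that removes two of `2 * k + 1` through strands. -/
def stepTwo (k : ℕ) : Diag :=
  -- A single through strand admits no such step; the value 0 keeps the later identities uniform in
  -- k, where the term has coefficient k/(k+1) anyway.
  if k = 0 then 0 else oddJW k * (cup (2 * k) * cup (2 * k - 1))

theorem stepTwo_zero : stepTwo 0 = 0 := rfl

theorem stepTwo_succ (k : ℕ) :
    stepTwo (k + 1) = oddJW (k + 1) * (cup (2 * k + 2) * cup (2 * k + 1)) := rfl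

theorem fusionRight_eq (k : ℕ) : fusionRight (2 * k + 1) = stepRight k := by
  change oddJW k * cup (2 * k + 1) * oddJW k = _
  rw [mul_assoc, oddJW_mul_cup_assoc (by omega), oddJW_idem, stepRight]

theorem fusionLeft_eq (k : ℕ) : fusionLeft (2 * k + 1) = stepLeft k := mul_assoc _ _ _

theorem fusionTwo_eq (k : ℕ) : fusionTwo (2 * k + 3) = stepTwo (k + 1) := by
  change oddJW (k + 1) * (cup (2 * k + 2) * cup (2 * k + 1)) * oddJW k = _
  rw [mul_assoc, mul_assoc, ← oddJW_mul_cup (by omega), ← oddJW_mul_cup_assoc (by omega),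
    oddJW_mul_of_ge_assoc (by omega), stepTwo_succ]

@[simp] theorem dagger_stepRight (k : ℕ) :
    dagger (stepRight k) = oddJW k * cap (2 * k + 1) := by simp [stepRight]

@[simp] theorem dagger_stepLeft (k : ℕ) :
    dagger (stepLeft k) = oddJW k * (cap (2 * k) * oddJW k) := by simp [stepLeft, mul_assoc]

theorem dagger_stepTwo_succ (k : ℕ) :
    dagger (stepTwo (k + 1)) = cap (2 * k + 1) * (cap (2 * k + 2) * oddJW (k + 1)) := by
  simp [stepTwo_succ, mul_assoc]

theorem oddJW_mul_stepRight (k : ℕ) : oddJW k * stepRight k = stepRight k := by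
  rw [stepRight, oddJW_mul_cup_assoc (by omega), oddJW_idem]

theorem oddJW_mul_stepLeft (k : ℕ) : oddJW k * stepLeft k = stepLeft k := by
  rw [stepLeft, oddJW_idem_assoc]

theorem oddJW_mul_stepTwo (k : ℕ) : oddJW k * stepTwo k = stepTwo k := by
  cases k with
  | zero => simp [stepTwo_zero]
  | succ k => rw [stepTwo_succ, oddJW_idem_assoc]

theorem oddJW_mul_stepRight_assoc (k : ℕ) (x : Diag) :
    oddJW k * (stepRight k * x) = stepRight k * x := by
  rw [← mul_assoc, oddJW_mul_stepRight]

theorem oddJW_mul_stepLeft_assoc (k : ℕ) (x : Diag) :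
    oddJW k * (stepLeft k * x) = stepLeft k * x := by
  rw [← mul_assoc, oddJW_mul_stepLeft]

theorem oddJW_mul_stepTwo_assoc (k : ℕ) (x : Diag) :
    oddJW k * (stepTwo k * x) = stepTwo k * x := by
  rw [← mul_assoc, oddJW_mul_stepTwo]

theorem stepRight_mul_oddJW (k : ℕ) : stepRight k * oddJW k = stepRight k := by
  rw [stepRight, mul_assoc, oddJW_idem]

theorem stepLeft_mul_oddJW (k : ℕ) : stepLeft k * oddJW k = stepLeft k := by
  rw [stepLeft, mul_assoc, mul_assoc, oddJW_idem]

theorem stepTwo_succ_mul_oddJW (k : ℕ) : stepTwo (k + 1) * oddJW k = stepTwo (k + 1) := by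
  rw [stepTwo_succ, mul_assoc, mul_assoc, ← oddJW_mul_cup (by omega),
    ← oddJW_mul_cup_assoc (by omega), oddJW_mul_of_ge_assoc (by omega)]

/-- A closed loop. With the next three identities: R and L are isotropic and pair to f_k, so R ± L
are orthogonal, of square ±2f_k. -/
theorem stepRight_stepRight (k : ℕ) : dagger (stepRight k) * stepRight k = 0 := by
  simp [stepRight, mul_assoc, cap_mul_cup_self_assoc]

theorem stepRight_stepLeft (k : ℕ) : dagger (stepRight k) * stepLeft k = oddJW k := by
  rw [dagger_stepRight, stepLeft, mul_assoc, ← oddJW_mul_cap_assoc (by omega),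
    cap_succ_mul_cup_assoc, oddJW_idem, oddJW_idem]

theorem stepLeft_stepRight (k : ℕ) : dagger (stepLeft k) * stepRight k = oddJW k := by
  rw [← dagger_dagger (stepRight k), ← dagger_mul, stepRight_stepLeft, dagger_oddJW]

theorem stepLeft_stepLeft (k : ℕ) : dagger (stepLeft k) * stepLeft k = 0 := by
  rw [dagger_stepLeft, stepLeft, mul_assoc, mul_assoc, oddJW_idem_assoc,
    cap_mul_oddJW_mul_cup_mul_oddJW, mul_zero]

theorem oddJW_succ_mul_stepRight (k : ℕ) : oddJW (k + 1) * stepRight k = 0 := by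
  rw [stepRight, oddJW_mul_cup_eq_zero_assoc (by omega)]

theorem oddJW_succ_mul_stepLeft (k : ℕ) : oddJW (k + 1) * stepLeft k = 0 := by
  rw [stepLeft, oddJW_mul_of_ge_assoc (by omega), oddJW_mul_cup_eq_zero_assoc (by omega)]

theorem oddJW_succ_mul_stepTwo (k : ℕ) : oddJW (k + 1) * stepTwo k = 0 := by
  cases k with
  | zero => simp [stepTwo_zero]
  | succ k =>
    rw [stepTwo_succ, oddJW_mul_of_ge_assoc (by omega), oddJW_mul_cup_eq_zero_assoc (by omega)]

theorem stepRight_stepTwo (k : ℕ) : dagger (stepRight k) * stepTwo k = 0 := by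
  cases k with
  | zero => simp [stepTwo_zero]
  | succ k =>
    rw [dagger_stepRight, stepTwo_succ, mul_assoc, ← oddJW_mul_cap_assoc (by omega),
      show 2 * (k + 1) + 1 = 2 * k + 2 + 1 by ring, cap_succ_mul_cup_assoc,
      oddJW_idem_assoc, oddJW_mul_cup_eq_zero (by omega)]

theorem cap_mul_stepTwo_succ (k : ℕ) :
    cap (2 * k + 2) * stepTwo (k + 1) = (-((k + 2 : ℂ) / (k + 1))) • stepLeft k := by
  have h := congrArg (· * cup (2 * k + 1)) (cap_mul_oddJW_mul_cup k)
  simp only [mul_assoc, smul_mul_assoc] at h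
  rw [stepTwo_succ, h, oddJW_mul_cup (by omega), cap_mul_cup_succ_assoc, stepLeft]

theorem stepLeft_stepTwo (k : ℕ) : dagger (stepLeft k) * stepTwo k = 0 := by
  cases k with
  | zero => simp [stepTwo_zero]
  | succ k =>
    rw [dagger_stepLeft, mul_assoc, mul_assoc, oddJW_mul_stepTwo,
      show 2 * (k + 1) = 2 * k + 2 by ring, cap_mul_stepTwo_succ, mul_smul_comm,
      oddJW_succ_mul_stepLeft, smul_zero]

/-- The negative sign is the reason for the factor i in the normalisation of `Path.two`. -/
theorem stepTwo_stepTwo (k : ℕ) :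
    dagger (stepTwo (k + 1)) * stepTwo (k + 1) = (-((k + 2 : ℂ) / (k + 1))) • oddJW k := by
  rw [dagger_stepTwo_succ, mul_assoc, mul_assoc, oddJW_mul_stepTwo, cap_mul_stepTwo_succ,
    mul_smul_comm, stepLeft, ← oddJW_mul_cap_assoc (by omega), cap_succ_mul_cup_assoc, oddJW_idem]

/-- Decomposition of `f_{2k+1}` on two more strands. -/
theorem oddJW_eq_sum (k : ℕ) : oddJW k = oddJW (k + 1) + stepRight k * dagger (stepLeft k) +
    stepLeft k * dagger (stepRight k) -
      ((k : ℂ) / (k + 1)) • (stepTwo k * dagger (stepTwo k)) := by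
  have h1 : stepRight k * dagger (stepLeft k) =
      oddJW k * (cup (2 * k + 1) * (cap (2 * k) * oddJW k)) := by
    rw [dagger_stepLeft, stepRight, mul_assoc, oddJW_idem_assoc, oddJW_mul_cup_assoc (by omega)]
  have h2 : stepLeft k * dagger (stepRight k) =
      oddJW k * (cup (2 * k) * (cap (2 * k + 1) * oddJW k)) := by
    rw [dagger_stepRight, stepLeft, mul_assoc, mul_assoc, oddJW_idem_assoc,
      oddJW_mul_cap (by omega)]
  have h3 : ((k : ℂ) / (k + 1)) • (stepTwo k * dagger (stepTwo k)) = ((k : ℂ) / (k + 1)) •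
      (oddJW k * (cup (2 * k) * (cup (2 * k - 1) * (cap (2 * k - 1) *
        (cap (2 * k) * oddJW k))))) := by
    cases k with
    | zero => simp
    | succ k =>
      rw [dagger_stepTwo_succ, stepTwo_succ, mul_assoc, mul_assoc]
      rfl
  rw [h1, h2, h3, oddJW_succ, wenzl]
  simp only [add_mul, sub_mul, one_mul, mul_assoc, smul_mul_assoc, mul_add, mul_sub, oddJW_idem,
    mul_smul_comm]
  abel

/-! ### Products of two steps -/

/-- The cup at 2k+2 straddles the two pairs of strands added by consecutive steps, so it has to be
expanded in words of two steps. Splitting f_k below it starts that expansion. -/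
theorem oddJW_mul_cup_eq_sum (k : ℕ) : oddJW k * cup (2 * k + 2) =
    oddJW (k + 1) * cup (2 * k + 2) +
      stepRight k * (oddJW k * (cup (2 * k) * (cap (2 * k) * oddJW k))) + stepLeft k -
      ((k : ℂ) / (k + 1)) • (stepTwo k * (cap (2 * k) * oddJW k)) := by
  have h1 : dagger (stepLeft k) * cup (2 * k + 2) =
      oddJW k * (cup (2 * k) * (cap (2 * k) * oddJW k)) := by
    rw [dagger_stepLeft, mul_assoc, mul_assoc, oddJW_mul_cup (by omega),
      cap_mul_cup_of_le_assoc le_rfl]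
  have h2 : dagger (stepRight k) * cup (2 * k + 2) = oddJW k := by
    rw [dagger_stepRight, mul_assoc, cap_mul_cup_succ, mul_one]
  have h3 : ((k : ℂ) / (k + 1)) • (stepTwo k * (dagger (stepTwo k) * cup (2 * k + 2))) =
      ((k : ℂ) / (k + 1)) • (stepTwo k * (cap (2 * k) * oddJW k)) := by
    cases k with
    | zero => simp
    | succ k =>
      congr 2
      rw [dagger_stepTwo_succ, mul_assoc, mul_assoc, oddJW_mul_cup (by omega),
        show 2 * (k + 1) + 2 = 2 * k + 2 + 2 by ring, cap_mul_cup_of_le_assoc le_rfl,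
        cap_mul_cup_succ_assoc]
      rfl
  conv_lhs => rw [oddJW_eq_sum]
  simp only [add_mul, sub_mul, mul_assoc, smul_mul_assoc, h1, h2, h3, stepLeft_mul_oddJW]

theorem cup_mul_oddJW_succ (k : ℕ) : oddJW k * (cup (2 * k + 2) * oddJW (k + 1)) =
    oddJW (k + 1) * stepLeft (k + 1) + stepLeft k * oddJW (k + 1) := by
  rw [← mul_assoc, oddJW_mul_cup_eq_sum]
  simp only [add_mul, sub_mul, mul_assoc, smul_mul_assoc, oddJW_mul_of_le (Nat.le_succ k),
    cap_mul_oddJW (show 2 * k < 2 * (k + 1) by omega), mul_zero, smul_zero, oddJW_mul_stepLeft,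
    add_zero, sub_zero]
  rfl

theorem stepLeft_mul_stepRight (k : ℕ) : stepLeft k * stepRight k =
    oddJW k * (cup (2 * k) * (cup (2 * k + 1) * oddJW k)) := by
  rw [stepLeft, mul_assoc, mul_assoc, oddJW_mul_stepRight, stepRight]

theorem stepRight_mul_stepRight (k : ℕ) : stepRight k * stepRight k =
    oddJW k * (cup (2 * k + 1) * (cup (2 * k + 1) * oddJW k)) := by
  rw [stepRight, mul_assoc, oddJW_mul_cup_assoc (by omega), oddJW_mul_cup_assoc (by omega),
    oddJW_mul_cup_assoc (by omega), oddJW_idem]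

theorem cup_mul_stepRight (k : ℕ) : oddJW k * (cup (2 * k + 2) * stepRight k) =
    oddJW (k + 1) * stepTwo (k + 1) + stepLeft k * stepRight k + stepRight k * stepLeft k -
      ((k : ℂ) / (k + 1)) • (stepTwo k * oddJW k) := by
  have h1 : cap (2 * k) * (oddJW k * stepRight k) = oddJW k := by
    rw [oddJW_mul_stepRight, stepRight, cap_mul_cup_succ_assoc]
  have h2 : oddJW (k + 1) * (cup (2 * k + 2) * stepRight k) =
      oddJW (k + 1) * stepTwo (k + 1) := by
    rw [stepTwo_succ, oddJW_idem_assoc, stepRight, ← oddJW_mul_cup (by omega),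
      ← oddJW_mul_cup_assoc (by omega), oddJW_mul_of_ge_assoc (by omega)]
  rw [← mul_assoc, oddJW_mul_cup_eq_sum]
  simp only [add_mul, sub_mul, mul_assoc, smul_mul_assoc, h1, h2]
  rw [← stepLeft]
  abel

theorem cup_mul_stepLeft (k : ℕ) : oddJW k * (cup (2 * k + 2) * stepLeft k) =
    stepLeft k * stepLeft k := by
  have h1 : cap (2 * k) * (oddJW k * stepLeft k) = 0 := by
    rw [oddJW_mul_stepLeft, stepLeft, cap_mul_oddJW_mul_cup_mul_oddJW]
  have h2 : oddJW (k + 1) * (cup (2 * k + 2) * stepLeft k) = 0 := by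
    rw [stepLeft, ← oddJW_mul_cup_assoc (by omega), oddJW_mul_of_ge_assoc (by omega),
      ← cup_mul_cup_assoc le_rfl, oddJW_mul_cup_eq_zero_assoc (by omega)]
  rw [← mul_assoc, oddJW_mul_cup_eq_sum]
  simp only [add_mul, sub_mul, mul_assoc, smul_mul_assoc, h1, h2, mul_zero, smul_zero, zero_add,
    sub_zero]

theorem cup_mul_stepTwo_succ (k : ℕ) :
    oddJW (k + 1) * (cup (2 * (k + 1) + 2) * stepTwo (k + 1)) =
      stepLeft (k + 1) * stepTwo (k + 1) + stepTwo (k + 1) * stepLeft k := by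
  have h1 : cap (2 * (k + 1)) * (oddJW (k + 1) * stepTwo (k + 1)) =
      (-((k + 2 : ℂ) / (k + 1))) • stepLeft k := by
    rw [oddJW_mul_stepTwo, ← cap_mul_stepTwo_succ]
    rfl
  have h2 : oddJW (k + 1 + 1) * (cup (2 * (k + 1) + 2) * stepTwo (k + 1)) = 0 := by
    rw [stepTwo_succ, ← oddJW_mul_cup_assoc (by omega), oddJW_mul_of_ge_assoc (by omega),
      show 2 * k + 2 = 2 * (k + 1) by ring,
      ← cup_mul_cup_assoc le_rfl, oddJW_mul_cup_eq_zero_assoc (by omega)]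
  have h3 : oddJW (k + 1) * (cup (2 * (k + 1)) * stepLeft k) = 0 := by
    rw [stepLeft, ← oddJW_mul_cup_assoc (by omega), oddJW_mul_of_ge_assoc (by omega),
      show 2 * (k + 1) = 2 * k + 2 by ring, ← cup_mul_cup_assoc le_rfl,
      oddJW_mul_cup_eq_zero_assoc (by omega)]
  have h4 : ((k + 1 : ℕ) : ℂ) / ((k + 1 : ℕ) + 1) * (-((k + 2 : ℂ) / (k + 1))) = -1 := by
    have : (k + 1 : ℂ) ≠ 0 := Nat.cast_add_one_ne_zero k
    have : (k + 2 : ℂ) ≠ 0 := by exact_mod_cast (show k + 2 ≠ 0 by omega)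
    have : (k + 1 + 1 : ℂ) ≠ 0 := by exact_mod_cast (show k + 1 + 1 ≠ 0 by omega)
    push_cast
    field_simp
    ring
  rw [← mul_assoc, oddJW_mul_cup_eq_sum]
  simp only [add_mul, sub_mul, mul_assoc, smul_mul_assoc, h1, h2, mul_zero, smul_zero, zero_add,
    mul_smul_comm, h3, smul_smul, h4]
  simp

/-- The words here are those of `cup_mul_oddJW_succ` with L replaced by R. The identities for `cup
(2 * k + 1) + cup (2 * k + 3)` supply the images of the straddling cup under the exchange of R and
L. -/
theorem cups_mul_oddJW_succ (k : ℕ) :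
    oddJW k * ((cup (2 * k + 1) + cup (2 * k + 3)) * oddJW (k + 1)) =
      stepRight k * oddJW (k + 1) + oddJW (k + 1) * stepRight (k + 1) := by
  rw [add_mul, mul_add, ← oddJW_mul_cup (show 2 * (k + 1) < 2 * k + 3 by omega),
    oddJW_mul_of_le_assoc (by omega), oddJW_mul_cup_assoc (by omega),
    oddJW_mul_stepRight, oddJW_mul_cup (by omega), stepRight, stepRight, mul_assoc]
  rfl

theorem cups_mul_stepRight (k : ℕ) :
    oddJW k * ((cup (2 * k + 1) + cup (2 * k + 3)) * stepRight k) =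
      stepRight k * stepRight k + stepRight k * stepRight k := by
  have h : cup (2 * k + 3) * stepRight k = cup (2 * k + 1) * stepRight k := by
    rw [stepRight, cup_mul_cup_assoc (le_refl (2 * k + 1))]
  rw [add_mul, mul_add, h, stepRight_mul_stepRight, stepRight]

theorem cups_mul_stepLeft (k : ℕ) :
    oddJW k * ((cup (2 * k + 1) + cup (2 * k + 3)) * stepLeft k) =
      stepRight k * stepLeft k + stepLeft k * stepRight k := by
  have h : oddJW k * (cup (2 * k + 3) * stepLeft k) = stepLeft k * stepRight k := by
    rw [stepLeft, ← oddJW_mul_cup_assoc (by omega), oddJW_idem_assoc, ← stepLeft,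
      stepLeft_mul_stepRight, ← cup_mul_cup_assoc (Nat.le_succ (2 * k))]
  rw [add_mul, mul_add, h, oddJW_mul_cup_assoc (by omega), stepRight, mul_assoc]

theorem cups_mul_stepTwo_succ (k : ℕ) :
    oddJW (k + 1) * ((cup (2 * (k + 1) + 1) + cup (2 * (k + 1) + 3)) * stepTwo (k + 1)) =
      stepRight (k + 1) * stepTwo (k + 1) + stepTwo (k + 1) * stepRight k := by
  have h : oddJW (k + 1) * (cup (2 * (k + 1) + 3) * stepTwo (k + 1)) =
      stepTwo (k + 1) * stepRight k := by
    rw [← stepTwo_succ_mul_oddJW k, mul_assoc, oddJW_mul_stepRight, stepTwo_succ, stepRight]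
    simp only [mul_assoc]
    rw [← oddJW_mul_cup_assoc (show 2 * (k + 1) < 2 * (k + 1) + 3 by omega), oddJW_idem_assoc, show 2 * (k + 1) + 3 = 2 * k + 3 + 2 by ring,
      ← cup_mul_cup_assoc (show 2 * k + 2 ≤ 2 * k + 3 by omega),
      ← cup_mul_cup_assoc (le_refl (2 * k + 1))]
  rw [add_mul, mul_add, h, oddJW_mul_cup_assoc (by omega), ← mul_assoc (cup (2 * (k + 1) + 1)),
    ← stepRight]

/-! ### Half diagrams -/

theorem half_nil : half Path.nil = 1 := by rw [half]

theorem half_zero {j k : ℕ} (p : Path j k) : half p.zero = half p * oddJW (k + 1) := by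
  rw [half]; rfl

theorem half_plus {j k : ℕ} (p : Path j k) : half p.plus =
    ((1 / Real.sqrt 2 : ℝ) : ℂ) • (half p * (stepRight k + stepLeft k)) := by
  rw [half, fusionRight_eq, fusionLeft_eq]

theorem half_minus {j k : ℕ} (p : Path j k) : half p.minus =
    (Complex.I * ((1 / Real.sqrt 2 : ℝ) : ℂ)) • (half p * (stepRight k - stepLeft k)) := by
  rw [half, fusionRight_eq, fusionLeft_eq]

theorem half_two {j k : ℕ} (p : Path j (k + 1)) : half p.two =
    (Complex.I * ((Real.sqrt ((k + 1 : ℝ) / (k + 2 : ℝ)) : ℝ) : ℂ)) •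
      (half p * stepTwo (k + 1)) := by
  rw [half, fusionTwo_eq]

theorem half_mul_oddJW {j k : ℕ} (p : Path j k) : half p * oddJW k = half p := by
  cases p with
  | nil => rw [half_nil, oddJW_zero, mul_one]
  | zero p => rw [half_zero, mul_assoc, oddJW_idem]
  | plus p =>
    rw [half_plus, smul_mul_assoc, mul_assoc, add_mul, stepRight_mul_oddJW, stepLeft_mul_oddJW]
  | minus p =>
    rw [half_minus, smul_mul_assoc, mul_assoc, sub_mul, stepRight_mul_oddJW, stepLeft_mul_oddJW]
  | two p => rw [half_two, smul_mul_assoc, mul_assoc, stepTwo_succ_mul_oddJW]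

theorem oddJW_mul_dagger_half {j k : ℕ} (p : Path j k) :
    oddJW k * dagger (half p) = dagger (half p) := by
  rw [← dagger_oddJW, ← dagger_mul, half_mul_oddJW]

theorem inv_sqrt_two_sq :
    ((1 / Real.sqrt 2 : ℝ) : ℂ) * ((1 / Real.sqrt 2 : ℝ) : ℂ) = 1 / 2 := by
  rw [← Complex.ofReal_mul, div_mul_div_comm, Real.mul_self_sqrt (by norm_num)]
  norm_num

theorem sqrt_ratio_sq (k : ℕ) :
    ((Real.sqrt ((k + 1 : ℝ) / (k + 2 : ℝ)) : ℝ) : ℂ) *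
      ((Real.sqrt ((k + 1 : ℝ) / (k + 2 : ℝ)) : ℝ) : ℂ) = (k + 1 : ℂ) / (k + 2 : ℂ) := by
  rw [← Complex.ofReal_mul, Real.mul_self_sqrt (by positivity)]
  push_cast
  rfl

theorem neg_half_smul_neg_sub {A : Type*} [Ring A] [Algebra ℂ A] (x : A) :
    ((-1 : ℂ) * (1 / 2)) • (-x - x) = x := by
  module

theorem eq_zero_of_add_of_sub {A : Type*} [Ring A] [Algebra ℂ A] {x y : A} (h1 : x + y = 0)
    (h2 : x - y = 0) : y = 0 := by
  have h : (2 : ℂ) • y = 0 := by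
    rw [two_smul, ← sub_self (0 : A)]
    nth_rewrite 1 [← h1]
    rw [← h2]
    abel
  exact (smul_eq_zero.1 h).resolve_left two_ne_zero

theorem stepRight_mul_cup (k i : ℕ) :
    stepRight k * cup (2 * k + 1 + i) = cup (2 * k + 1 + (i + 2)) * stepRight k := by
  rw [stepRight, mul_assoc, oddJW_mul_cup (by omega),
    cup_mul_cup_assoc (show 2 * k + 1 ≤ 2 * k + 1 + i by omega)]
  rfl

theorem stepLeft_mul_cup (k i : ℕ) :
    stepLeft k * cup (2 * k + 1 + i) = cup (2 * k + 1 + (i + 2)) * stepLeft k := by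
  rw [stepLeft, mul_assoc, mul_assoc, oddJW_mul_cup (by omega),
    cup_mul_cup_assoc (show 2 * k ≤ 2 * k + 1 + i by omega), oddJW_mul_cup_assoc (by omega)]
  rfl

theorem stepTwo_mul_cup (k i : ℕ) : stepTwo (k + 1) * cup (2 * k + 1 + i) =
    cup (2 * (k + 1) + 1 + (i + 2)) * stepTwo (k + 1) := by
  rw [stepTwo_succ, mul_assoc, mul_assoc, cup_mul_cup (show 2 * k + 1 ≤ 2 * k + 1 + i by omega),
    cup_mul_cup_assoc (show 2 * k + 2 ≤ 2 * k + 1 + i + 2 by omega),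
    oddJW_mul_cup_assoc (by omega)]
  rw [show 2 * k + 1 + i + 2 + 2 = 2 * (k + 1) + 1 + (i + 2) by ring]

theorem dagger_mul_mul_mul {a b c : Diag} (h : dagger a * b = c) (x y : Diag) :
    dagger (a * x) * (b * y) = dagger x * (c * y) := by
  rw [dagger_mul, mul_assoc, ← mul_assoc (dagger a), h]

/-- Reflection is linear, so each factor i contributes −1; this offsets the negative squares of R −
L and T. -/
theorem half_norm {j k : ℕ} (p : Path j k) : dagger (half p) * half p = oddJW k := by
  induction p with
  | nil => rw [half_nil, dagger_one, mul_one, oddJW_zero]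
  | zero p ih =>
    rw [half_zero, dagger_mul_mul_mul ih, dagger_oddJW, oddJW_mul_of_le (Nat.le_succ _),
      oddJW_idem]
  | @plus j k p ih =>
    rw [half_plus, dagger_smul, smul_mul_assoc, mul_smul_comm, smul_smul, dagger_mul_mul_mul ih,
      inv_sqrt_two_sq, mul_add, oddJW_mul_stepRight,
      oddJW_mul_stepLeft, dagger_add, add_mul, mul_add, mul_add, stepRight_stepRight,
      stepRight_stepLeft, stepLeft_stepRight, stepLeft_stepLeft, zero_add, add_zero, ← two_smul ℂ,
      smul_smul]
    norm_num
  | @minus j k p ih =>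
    rw [half_minus, dagger_smul, smul_mul_assoc, mul_smul_comm, smul_smul, dagger_mul_mul_mul ih,
      mul_sub, oddJW_mul_stepRight,
      oddJW_mul_stepLeft, dagger_sub, sub_mul, mul_sub, mul_sub, stepRight_stepRight,
      stepRight_stepLeft, stepLeft_stepRight, stepLeft_stepLeft, mul_mul_mul_comm, inv_sqrt_two_sq,
      Complex.I_mul_I, zero_sub, sub_zero]
    exact neg_half_smul_neg_sub _
  | @two j k p ih =>
    have h : (-1 : ℂ) * ((k + 1 : ℂ) / (k + 2 : ℂ)) * (-((k + 2 : ℂ) / (k + 1))) = 1 := by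
      have : (k + 1 : ℂ) ≠ 0 := Nat.cast_add_one_ne_zero k
      have : (k + 2 : ℂ) ≠ 0 := by exact_mod_cast (show k + 2 ≠ 0 by omega)
      field_simp
    rw [half_two, dagger_smul, smul_mul_assoc, mul_smul_comm, smul_smul, dagger_mul_mul_mul ih,
      oddJW_mul_stepTwo, stepTwo_stepTwo, mul_mul_mul_comm,
      sqrt_ratio_sq, Complex.I_mul_I, smul_smul, h, one_smul]

theorem dagger_mul_eq_zero_comm {x y : Diag} (h : dagger x * y = 0) : dagger y * x = 0 := by
  rw [← dagger_dagger x, ← dagger_mul, h, dagger_zero]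

theorem half_orthogonal {j k l : ℕ} (p : Path j k) (q : Path j l) :
    dagger (half p) * half q = 0 ∨ (⟨k, p⟩ : Σ k, Path j k) = ⟨l, q⟩ := by
  -- Different prefixes are already orthogonal; for equal prefixes only the pairing of the last
  -- steps remains.
  have key : ∀ {j k l : ℕ} {p : Path j k} {q : Path j l}, (dagger (half p) * half q = 0 ∨
      (⟨k, p⟩ : Σ k, Path j k) = ⟨l, q⟩) → ∀ x y,
      ((∀ h : k = l, h ▸ p = q → dagger x * (oddJW k * y) = 0) →
        dagger (half p * x) * (half q * y) = 0) := by
    intro j k l p q h x y hxy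
    rcases h with h | h
    · rw [dagger_mul_mul_mul h, zero_mul, mul_zero]
    · cases h
      rw [dagger_mul_mul_mul (half_norm p), hxy rfl rfl]
  induction p generalizing l with
  | nil => cases q with
    | nil => exact Or.inr rfl
  | @zero j k p ih =>
    cases q with
    | @zero _ l q =>
      rcases ih q with h | h
      · left
        rw [half_zero, half_zero, dagger_mul_mul_mul h, zero_mul, mul_zero]
      · cases h
        exact Or.inr rfl
    | plus q =>
      left
      rw [half_zero, half_plus, mul_smul_comm, key (ih q), smul_zero]
      rintro rfl -
      rw [mul_add, oddJW_mul_stepRight, oddJW_mul_stepLeft, dagger_oddJW, mul_add,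
        oddJW_succ_mul_stepRight, oddJW_succ_mul_stepLeft, add_zero]
    | minus q =>
      left
      rw [half_zero, half_minus, mul_smul_comm, key (ih q), smul_zero]
      rintro rfl -
      rw [mul_sub, oddJW_mul_stepRight, oddJW_mul_stepLeft, dagger_oddJW, mul_sub,
        oddJW_succ_mul_stepRight, oddJW_succ_mul_stepLeft, sub_zero]
    | two q =>
      left
      rw [half_zero, half_two, mul_smul_comm, key (ih q), smul_zero]
      rintro rfl -
      rw [oddJW_mul_stepTwo, dagger_oddJW, oddJW_succ_mul_stepTwo]
  | @plus j k p ih =>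
    cases q with
    | zero q =>
      left
      rw [half_zero, half_plus, dagger_smul, smul_mul_assoc, key (ih q), smul_zero]
      rintro rfl -
      rw [oddJW_mul_of_le (Nat.le_succ _)]
      apply dagger_mul_eq_zero_comm
      rw [dagger_oddJW, mul_add, oddJW_succ_mul_stepRight, oddJW_succ_mul_stepLeft, add_zero]
    | plus q =>
      rcases ih q with h | h
      · left
        rw [half_plus, half_plus, dagger_smul, smul_mul_assoc, mul_smul_comm, dagger_mul_mul_mul h,
          zero_mul, mul_zero, smul_zero, smul_zero]
      · cases h
        exact Or.inr rfl
    | minus q =>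
      left
      rw [half_plus, half_minus, dagger_smul, smul_mul_assoc, mul_smul_comm, key (ih q), smul_zero,
        smul_zero]
      rintro rfl -
      rw [mul_sub, oddJW_mul_stepRight, oddJW_mul_stepLeft, dagger_add, add_mul, mul_sub, mul_sub,
        stepRight_stepRight, stepRight_stepLeft, stepLeft_stepRight, stepLeft_stepLeft]
      abel
    | two q =>
      left
      rw [half_plus, half_two, dagger_smul, smul_mul_assoc, mul_smul_comm, key (ih q), smul_zero,
        smul_zero]
      rintro rfl -
      rw [oddJW_mul_stepTwo, dagger_add, add_mul, stepRight_stepTwo, stepLeft_stepTwo, add_zero]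
  | @minus j k p ih =>
    cases q with
    | zero q =>
      left
      rw [half_zero, half_minus, dagger_smul, smul_mul_assoc, key (ih q), smul_zero]
      rintro rfl -
      rw [oddJW_mul_of_le (Nat.le_succ _)]
      apply dagger_mul_eq_zero_comm
      rw [dagger_oddJW, mul_sub, oddJW_succ_mul_stepRight, oddJW_succ_mul_stepLeft, sub_zero]
    | plus q =>
      left
      rw [half_plus, half_minus, dagger_smul, smul_mul_assoc, mul_smul_comm, key (ih q), smul_zero,
        smul_zero]
      rintro rfl -
      rw [mul_add, oddJW_mul_stepRight, oddJW_mul_stepLeft, dagger_sub, sub_mul, mul_add, mul_add,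
        stepRight_stepRight, stepRight_stepLeft, stepLeft_stepRight, stepLeft_stepLeft]
      abel
    | minus q =>
      rcases ih q with h | h
      · left
        rw [half_minus, half_minus, dagger_smul, smul_mul_assoc, mul_smul_comm,
          dagger_mul_mul_mul h, zero_mul, mul_zero, smul_zero, smul_zero]
      · cases h
        exact Or.inr rfl
    | two q =>
      left
      rw [half_minus, half_two, dagger_smul, smul_mul_assoc, mul_smul_comm, key (ih q), smul_zero,
        smul_zero]
      rintro rfl -
      rw [oddJW_mul_stepTwo, dagger_sub, sub_mul, stepRight_stepTwo, stepLeft_stepTwo, sub_zero]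
  | @two j k p ih =>
    cases q with
    | zero q =>
      left
      rw [half_zero, half_two, dagger_smul, smul_mul_assoc, key (ih q), smul_zero]
      rintro rfl -
      rw [oddJW_mul_of_le (Nat.le_succ _)]
      apply dagger_mul_eq_zero_comm
      rw [dagger_oddJW, oddJW_succ_mul_stepTwo]
    | plus q =>
      left
      rw [half_plus, half_two, dagger_smul, smul_mul_assoc, mul_smul_comm, key (ih q), smul_zero,
        smul_zero]
      rintro rfl -
      apply dagger_mul_eq_zero_comm
      rw [mul_add, oddJW_mul_stepRight, oddJW_mul_stepLeft, dagger_add, add_mul,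
        stepRight_stepTwo, stepLeft_stepTwo, add_zero]
    | minus q =>
      left
      rw [half_minus, half_two, dagger_smul, smul_mul_assoc, mul_smul_comm, key (ih q), smul_zero,
        smul_zero]
      rintro rfl -
      apply dagger_mul_eq_zero_comm
      rw [mul_sub, oddJW_mul_stepRight, oddJW_mul_stepLeft, dagger_sub, sub_mul,
        stepRight_stepTwo, stepLeft_stepTwo, sub_zero]
    | two q =>
      rcases ih q with h | h
      · left
        rw [half_two, half_two, dagger_smul, smul_mul_assoc, mul_smul_comm,
          dagger_mul_mul_mul h, zero_mul, mul_zero, smul_zero, smul_zero]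
      · cases h
        exact Or.inr rfl

/-- A diagram that annihilates all half diagrams of some level is zero. -/
theorem eq_zero_of_mul_half {j : ℕ} {y : Diag} (h : ∀ k (p : Path j k), y * half p = 0) :
    y = 0 := by
  induction j with
  | zero => simpa [half_nil] using h 0 Path.nil
  | succ j ih =>
    refine ih fun k p => ?_
    have h0 : y * (half p * oddJW (k + 1)) = 0 := by rw [← half_zero, h]
    have hs : ((1 / Real.sqrt 2 : ℝ) : ℂ) ≠ 0 := by simp
    have h1 : y * (half p * (stepRight k + stepLeft k)) = 0 := by
      have := h _ p.plus
      rw [half_plus, mul_smul_comm] at this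
      exact (smul_eq_zero.1 this).resolve_left hs
    have h2 : y * (half p * (stepRight k - stepLeft k)) = 0 := by
      have := h _ p.minus
      rw [half_minus, mul_smul_comm] at this
      exact (smul_eq_zero.1 this).resolve_left (mul_ne_zero Complex.I_ne_zero hs)
    have h3 : y * (half p * stepTwo k) = 0 := by
      cases k with
      | zero => simp [stepTwo_zero]
      | succ k =>
        have := h _ p.two
        rw [half_two, mul_smul_comm] at this
        refine (smul_eq_zero.1 this).resolve_left (mul_ne_zero Complex.I_ne_zero ?_)
        rw [Complex.ofReal_ne_zero]
        positivity
    rw [mul_add, mul_add] at h1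
    rw [mul_sub, mul_sub] at h2
    have h4 : y * (half p * stepLeft k) = 0 := eq_zero_of_add_of_sub h1 h2
    have h5 : y * (half p * stepRight k) = 0 := by rw [h4, add_zero] at h1; exact h1
    -- Since v_p absorbs f_k, the splitting expresses y v_p through the products of y with the
    -- extensions of p.
    rw [← half_mul_oddJW p, oddJW_eq_sum]
    simp only [mul_add, mul_sub, mul_smul_comm, h0, zero_add]
    simp only [← mul_assoc] at h3 h4 h5 ⊢
    simp [h3, h4, h5]

/-- A half diagram from 2k+1 to 2j+1 points leaves the strands to its right alone. With the analogue
for caps, this makes level j commute with everything beyond its 2j+1 strands. -/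
theorem half_mul_cup {j k : ℕ} (p : Path j k) (i : ℕ) :
    half p * cup (2 * k + 1 + i) = cup (2 * j + 1 + i) * half p := by
  induction p generalizing i with
  | nil => simp [half_nil]
  | @zero j k p ih =>
    have := ih (i + 2)
    rw [show 2 * k + 1 + (i + 2) = 2 * (k + 1) + 1 + i by ring,
      show 2 * j + 1 + (i + 2) = 2 * (j + 1) + 1 + i by ring] at this
    rw [half_zero, mul_assoc, oddJW_mul_cup (by omega), ← mul_assoc, this, mul_assoc]
  | @plus j k p ih =>
    rw [half_plus, smul_mul_assoc, mul_smul_comm, mul_assoc, add_mul, stepRight_mul_cup,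
      stepLeft_mul_cup, ← mul_add, ← mul_assoc, ih (i + 2), mul_assoc]
    rw [show 2 * j + 1 + (i + 2) = 2 * (j + 1) + 1 + i by ring]
  | @minus j k p ih =>
    rw [half_minus, smul_mul_assoc, mul_smul_comm, mul_assoc, sub_mul, stepRight_mul_cup,
      stepLeft_mul_cup, ← mul_sub, ← mul_assoc, ih (i + 2), mul_assoc]
    rw [show 2 * j + 1 + (i + 2) = 2 * (j + 1) + 1 + i by ring]
  | @two j k p ih =>
    have := ih (i + 2)
    rw [show 2 * j + 1 + (i + 2) = 2 * (j + 1) + 1 + i by ring] at this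
    rw [half_two, smul_mul_assoc, mul_smul_comm, mul_assoc, stepTwo_mul_cup, ← mul_assoc, this,
      mul_assoc]

theorem stepRight_mul_cap (k i : ℕ) :
    stepRight k * cap (2 * k + 1 + i) = cap (2 * k + 1 + (i + 2)) * stepRight k := by
  rw [stepRight, mul_assoc, oddJW_mul_cap (by omega),
    ← cap_mul_cup_of_ge_assoc (show 2 * k + 1 ≤ 2 * k + 1 + i by omega)]
  rfl

theorem stepLeft_mul_cap (k i : ℕ) :
    stepLeft k * cap (2 * k + 1 + i) = cap (2 * k + 1 + (i + 2)) * stepLeft k := by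
  rw [stepLeft, mul_assoc, mul_assoc, oddJW_mul_cap (by omega),
    ← cap_mul_cup_of_ge_assoc (show 2 * k ≤ 2 * k + 1 + i by omega),
    oddJW_mul_cap_assoc (by omega)]
  rfl

theorem stepTwo_mul_cap (k i : ℕ) : stepTwo (k + 1) * cap (2 * k + 1 + i) =
    cap (2 * (k + 1) + 1 + (i + 2)) * stepTwo (k + 1) := by
  rw [stepTwo_succ, mul_assoc, mul_assoc,
    ← cap_mul_cup_of_ge (show 2 * k + 1 ≤ 2 * k + 1 + i by omega),
    ← cap_mul_cup_of_ge_assoc (show 2 * k + 2 ≤ 2 * k + 1 + i + 2 by omega),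
    oddJW_mul_cap_assoc (by omega)]
  rw [show 2 * k + 1 + i + 2 + 2 = 2 * (k + 1) + 1 + (i + 2) by ring]

theorem half_mul_cap {j k : ℕ} (p : Path j k) (i : ℕ) :
    half p * cap (2 * k + 1 + i) = cap (2 * j + 1 + i) * half p := by
  induction p generalizing i with
  | nil => simp [half_nil]
  | @zero j k p ih =>
    have := ih (i + 2)
    rw [show 2 * k + 1 + (i + 2) = 2 * (k + 1) + 1 + i by ring,
      show 2 * j + 1 + (i + 2) = 2 * (j + 1) + 1 + i by ring] at this
    rw [half_zero, mul_assoc, oddJW_mul_cap (by omega), ← mul_assoc, this, mul_assoc]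
  | @plus j k p ih =>
    rw [half_plus, smul_mul_assoc, mul_smul_comm, mul_assoc, add_mul, stepRight_mul_cap,
      stepLeft_mul_cap, ← mul_add, ← mul_assoc, ih (i + 2), mul_assoc]
    rw [show 2 * j + 1 + (i + 2) = 2 * (j + 1) + 1 + i by ring]
  | @minus j k p ih =>
    rw [half_minus, smul_mul_assoc, mul_smul_comm, mul_assoc, sub_mul, stepRight_mul_cap,
      stepLeft_mul_cap, ← mul_sub, ← mul_assoc, ih (i + 2), mul_assoc]
    rw [show 2 * j + 1 + (i + 2) = 2 * (j + 1) + 1 + i by ring]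
  | @two j k p ih =>
    have := ih (i + 2)
    rw [show 2 * j + 1 + (i + 2) = 2 * (j + 1) + 1 + i by ring] at this
    rw [half_two, smul_mul_assoc, mul_smul_comm, mul_assoc, stepTwo_mul_cap, ← mul_assoc, this,
      mul_assoc]

theorem dagger_half_mul_cap {j k : ℕ} (p : Path j k) (i : ℕ) :
    dagger (half p) * cap (2 * j + 1 + i) = cap (2 * k + 1 + i) * dagger (half p) := by
  rw [← dagger_cup, ← dagger_mul, ← half_mul_cup, dagger_mul, dagger_cup]

theorem dagger_half_mul_cup {j k : ℕ} (p : Path j k) (i : ℕ) :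
    dagger (half p) * cup (2 * j + 1 + i) = cup (2 * k + 1 + i) * dagger (half p) := by
  rw [← dagger_cap, ← dagger_mul, ← half_mul_cap, dagger_mul, dagger_cap]

theorem matrixElt_mul_cup {j k : ℕ} (p q : Path j k) (i : ℕ) :
    matrixElt p q * cup (2 * j + 1 + i) = cup (2 * j + 1 + i) * matrixElt p q := by
  rw [matrixElt, mul_assoc, dagger_half_mul_cup, ← mul_assoc, half_mul_cup, mul_assoc]

theorem matrixElt_mul_cap {j k : ℕ} (p q : Path j k) (i : ℕ) :
    matrixElt p q * cap (2 * j + 1 + i) = cap (2 * j + 1 + i) * matrixElt p q := by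
  rw [matrixElt, mul_assoc, dagger_half_mul_cap, ← mul_assoc, half_mul_cap, mul_assoc]

/-! ### Matrix elements lie in `TL_∞` -/

theorem cup_zero_mul_of_mem {x : Diag} (hx : x ∈ TLInf) :
    ∃ y ∈ TLInf, cup 0 * x = y * cup 0 := by
  refine Algebra.adjoin_induction (p := fun x _ => ∃ y ∈ TLInf, cup 0 * x = y * cup 0)
    ?_ ?_ ?_ ?_ hx
  · rintro _ ⟨i, hi, rfl⟩
    obtain ⟨i, rfl⟩ := Nat.exists_eq_add_of_le' hi
    refine ⟨gen (i + 3), gen_mem _, ?_⟩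
    rw [gen_succ, gen_succ, cup_mul_cup_assoc (Nat.zero_le i), mul_assoc,
      ← cap_mul_cup_of_ge (Nat.zero_le i)]
  · exact fun r => ⟨_, TLInf.algebraMap_mem r, (Algebra.commutes r _).symm⟩
  · rintro x y _ _ ⟨a, ha, h1⟩ ⟨b, hb, h2⟩
    exact ⟨a + b, add_mem ha hb, by rw [mul_add, h1, h2, add_mul]⟩
  · rintro x y _ _ ⟨a, ha, h1⟩ ⟨b, hb, h2⟩
    exact ⟨a * b, mul_mem ha hb, by rw [← mul_assoc, h1, mul_assoc, h2, mul_assoc]⟩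

theorem cup_pow_mul_of_mem {x : Diag} (hx : x ∈ TLInf) (r : ℕ) :
    ∃ y ∈ TLInf, cup 0 ^ r * x = y * cup 0 ^ r := by
  induction r with
  | zero => exact ⟨x, hx, by simp⟩
  | succ r ih =>
    obtain ⟨y, hy, h1⟩ := ih
    obtain ⟨z, hz, h2⟩ := cup_zero_mul_of_mem hy
    exact ⟨z, hz, by rw [pow_succ', mul_assoc, h1, ← mul_assoc, h2, mul_assoc]⟩

/-- By a zigzag e_{i+2}·`cup i` = `cup (i + 1)`, so generators can move a cup to the right. -/
theorem cup_eq_mul_cup_zero (i : ℕ) : ∃ y ∈ TLInf, cup i = y * cup 0 := by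
  induction i with
  | zero => exact ⟨1, one_mem _, (one_mul _).symm⟩
  | succ i ih =>
    obtain ⟨y, hy, h⟩ := ih
    refine ⟨gen (i + 2) * y, mul_mem (gen_mem _) hy, ?_⟩
    rw [mul_assoc, ← h, gen_succ, mul_assoc, cap_succ_mul_cup, mul_one]

/-- The diagrams that are the product of an element of `TL_∞` and of `r` cups. -/
def cupModule (r : ℕ) : Submodule ℂ Diag where
  carrier := {x | ∃ y ∈ TLInf, x = y * cup 0 ^ r}
  add_mem' := by
    rintro x y ⟨a, ha, rfl⟩ ⟨b, hb, rfl⟩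
    exact ⟨a + b, add_mem ha hb, (add_mul _ _ _).symm⟩
  zero_mem' := ⟨0, zero_mem _, (zero_mul _).symm⟩
  smul_mem' := by
    rintro c x ⟨a, ha, rfl⟩
    exact ⟨c • a, Subalgebra.smul_mem _ ha c, (smul_mul_assoc _ _ _).symm⟩

theorem mul_mem_cupModule {r s t : ℕ} (h : r + s = t) {x y : Diag} (hx : x ∈ cupModule r)
    (hy : y ∈ cupModule s) : x * y ∈ cupModule t := by
  obtain ⟨a, ha, rfl⟩ := hx
  obtain ⟨b, hb, rfl⟩ := hy
  obtain ⟨c, hc, h'⟩ := cup_pow_mul_of_mem hb r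
  exact ⟨a * c, mul_mem ha hc, by
    rw [mul_assoc, ← mul_assoc (_ ^ r), h', mul_assoc, ← pow_add, h, mul_assoc]⟩

theorem mem_cupModule_zero {x : Diag} (hx : x ∈ TLInf) : x ∈ cupModule 0 :=
  ⟨x, hx, by simp⟩

theorem cup_mem_cupModule (i : ℕ) : cup i ∈ cupModule 1 := by
  obtain ⟨y, hy, h⟩ := cup_eq_mul_cup_zero i
  exact ⟨y, hy, by rwa [pow_one]⟩

theorem oddJW_mem_cupModule (k : ℕ) : oddJW k ∈ cupModule 0 :=
  mem_cupModule_zero (TL_le_TLInf _ (isJonesWenzl_oddJW k).mem)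

theorem stepRight_mem_cupModule (k : ℕ) : stepRight k ∈ cupModule 1 :=
  mul_mem_cupModule rfl (cup_mem_cupModule _) (oddJW_mem_cupModule k)

theorem stepLeft_mem_cupModule (k : ℕ) : stepLeft k ∈ cupModule 1 :=
  mul_mem_cupModule rfl (oddJW_mem_cupModule k)
    (mul_mem_cupModule rfl (cup_mem_cupModule _) (oddJW_mem_cupModule k))

theorem stepTwo_mem_cupModule (k : ℕ) : stepTwo k ∈ cupModule 2 := by
  cases k with
  | zero => exact zero_mem _
  | succ k =>
    exact mul_mem_cupModule rfl (oddJW_mem_cupModule _)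
      (mul_mem_cupModule rfl (cup_mem_cupModule _) (cup_mem_cupModule _))

/-- The number of cups depends only on the endpoint. Both halves of a matrix element therefore
contain equally many, and its middle is cup^r cap^r, which lies in TL_∞. -/
theorem half_mem_cupModule {j k : ℕ} (p : Path j k) : ∃ r, j = k + r ∧ half p ∈ cupModule r := by
  induction p with
  | nil => exact ⟨0, rfl, by rw [half_nil]; exact mem_cupModule_zero (one_mem _)⟩
  | zero p ih =>
    obtain ⟨r, h, hp⟩ := ih
    exact ⟨r, by omega, by
      rw [half_zero]; exact mul_mem_cupModule (add_zero r) hp (oddJW_mem_cupModule _)⟩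
  | plus p ih =>
    obtain ⟨r, h, hp⟩ := ih
    exact ⟨r + 1, by omega, by
      rw [half_plus]
      exact Submodule.smul_mem _ _ (mul_mem_cupModule rfl hp
        (add_mem (stepRight_mem_cupModule _) (stepLeft_mem_cupModule _)))⟩
  | minus p ih =>
    obtain ⟨r, h, hp⟩ := ih
    exact ⟨r + 1, by omega, by
      rw [half_minus]
      exact Submodule.smul_mem _ _ (mul_mem_cupModule rfl hp
        (sub_mem (stepRight_mem_cupModule _) (stepLeft_mem_cupModule _)))⟩
  | two p ih =>
    obtain ⟨r, h, hp⟩ := ih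
    exact ⟨r + 2, by omega, by
      rw [half_two]
      exact Submodule.smul_mem _ _ (mul_mem_cupModule rfl hp (stepTwo_mem_cupModule _))⟩

theorem dagger_mem_TLInf {x : Diag} (hx : x ∈ TLInf) : dagger x ∈ TLInf := by
  obtain ⟨n, hn⟩ := exists_mem_TL hx
  exact TL_le_TLInf n (dagger_mem_TL hn)

theorem cup_pow_mul_dagger_mem (r : ℕ) : cup 0 ^ r * dagger (cup 0 ^ r) ∈ TLInf := by
  induction r with
  | zero => simp
  | succ r ih =>
    obtain ⟨y, hy, h⟩ := cup_zero_mul_of_mem ih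
    have : cup 0 ^ (r + 1) * dagger (cup 0 ^ (r + 1)) = y * gen 1 := by
      rw [pow_succ', dagger_mul, dagger_cup, gen, ← mul_assoc y, ← h]
      simp only [mul_assoc]
    rw [this]
    exact mul_mem hy (gen_mem _)

theorem matrixElt_mem {j k : ℕ} (p q : Path j k) : matrixElt p q ∈ TLInf := by
  obtain ⟨r, h1, x, hx, hp⟩ := half_mem_cupModule p
  obtain ⟨s, h2, y, hy, hq⟩ := half_mem_cupModule q
  obtain rfl : r = s := by omega
  rw [matrixElt, hp, hq, dagger_mul, mul_assoc, ← mul_assoc (_ ^ r)]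
  exact mul_mem hx (mul_mem (cup_pow_mul_dagger_mem r) (dagger_mem_TLInf hy))

namespace Diag

protected theorem neg_one_smul (x : Diag) : (-1 : ℂ) • x = -x := _root_.neg_one_smul ℂ x

protected theorem neg_smul (c : ℂ) (x : Diag) : (-c) • x = -(c • x) := _root_.neg_smul c x

protected theorem smul_neg (c : ℂ) (x : Diag) : c • (-x) = -(c • x) := _root_.smul_neg c x

protected theorem neg_mul_neg (x y : Diag) : -x * -y = x * y := _root_.neg_mul_neg x y

protected theorem neg_mul (x y : Diag) : -x * y = -(x * y) := _root_.neg_mul x y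

protected theorem neg_add (x y : Diag) : -(x + y) = -x + -y := _root_.neg_add x y

end Diag

/-! ### Pairs of half diagrams with conjugate coefficients -/

/-- `a` and `a'` are linear combinations of the half diagrams `v_p` with conjugate coefficients. -/
inductive HalfPair (j k : ℕ) : Diag → Diag → Prop
  | zero : HalfPair j k 0 0
  | smul_half (c : ℂ) (p : Path j k) : HalfPair j k (c • half p) (conj c • half p)
  | add {a a' b b' : Diag} : HalfPair j k a a' → HalfPair j k b b' →
      HalfPair j k (a + b) (a' + b')

namespace HalfPair

variable {j k : ℕ} {a a' b b' : Diag}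

theorem half (p : Path j k) : HalfPair j k (half p) (TLZero.half p) := by
  simpa using smul_half 1 p

theorem smul (c : ℂ) (h : HalfPair j k a a') : HalfPair j k (c • a) (conj c • a') := by
  induction h with
  | zero => simpa using zero
  | smul_half d p => simpa [smul_smul] using smul_half (c * d) p
  | add _ _ h1 h2 => simpa [smul_add] using h1.add h2

theorem neg (h : HalfPair j k a a') : HalfPair j k (-a) (-a') := by
  simpa [Diag.neg_one_smul] using h.smul (-1)

theorem sub (h : HalfPair j k a a') (h' : HalfPair j k b b') :
    HalfPair j k (a - b) (a' - b') := by
  simpa [sub_eq_add_neg] using h.add h'.neg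

theorem congr (h : HalfPair j k a a') (h1 : a = b) (h2 : a' = b') : HalfPair j k b b' :=
  h1 ▸ h2 ▸ h

theorem mul_oddJW_left (h : HalfPair j k a a') : a * oddJW k = a := by
  induction h with
  | zero => simp
  | smul_half d p => rw [smul_mul_assoc, half_mul_oddJW]
  | add _ _ h1 h2 => rw [add_mul, h1, h2]

theorem mul_oddJW_right (h : HalfPair j k a a') : a' * oddJW k = a' := by
  induction h with
  | zero => simp
  | smul_half d p => rw [smul_mul_assoc, half_mul_oddJW]
  | add _ _ h1 h2 => rw [add_mul, h1, h2]

theorem stepZero (h : HalfPair j k a a') :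
    HalfPair (j + 1) (k + 1) (a * oddJW (k + 1)) (a' * oddJW (k + 1)) := by
  induction h with
  | zero => simpa using zero
  | smul_half d p => simpa [half_zero] using smul_half d p.zero
  | add _ _ h1 h2 => simpa [add_mul] using h1.add h2

end HalfPair

theorem eq_half_smul_add {A : Type*} [Ring A] [Algebra ℂ A] (x y : A) :
    x = (1 / 2 : ℂ) • (x + y) + (-((-1 : ℂ) * (1 / 2))) • (x - y) := by
  module

theorem eq_half_smul_sub {A : Type*} [Ring A] [Algebra ℂ A] (x y : A) :
    y = (1 / 2 : ℂ) • (x + y) + ((-1 : ℂ) * (1 / 2)) • (x - y) := by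
  module

theorem half_mul_stepRight {j k : ℕ} (p : Path j k) : half p * stepRight k =
    ((1 / Real.sqrt 2 : ℝ) : ℂ) • half p.plus +
      (-(Complex.I * ((1 / Real.sqrt 2 : ℝ) : ℂ))) • half p.minus := by
  rw [half_plus, half_minus, mul_add, mul_sub, smul_smul, smul_smul, inv_sqrt_two_sq, neg_mul,
    mul_mul_mul_comm, inv_sqrt_two_sq, Complex.I_mul_I]
  exact eq_half_smul_add _ _

theorem half_mul_stepLeft {j k : ℕ} (p : Path j k) : half p * stepLeft k =
    ((1 / Real.sqrt 2 : ℝ) : ℂ) • half p.plus +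
      (Complex.I * ((1 / Real.sqrt 2 : ℝ) : ℂ)) • half p.minus := by
  rw [half_plus, half_minus, mul_add, mul_sub, smul_smul, smul_smul, inv_sqrt_two_sq,
    mul_mul_mul_comm, inv_sqrt_two_sq, Complex.I_mul_I]
  exact eq_half_smul_sub _ _

theorem half_mul_stepTwo {j k : ℕ} (p : Path j (k + 1)) : half p * stepTwo (k + 1) =
    (-(Complex.I * (((Real.sqrt ((k + 1 : ℝ) / (k + 2 : ℝ)))⁻¹ : ℝ) : ℂ))) • half p.two := by
  have h : ((Real.sqrt ((k + 1 : ℝ) / (k + 2 : ℝ)) : ℝ) : ℂ) ≠ 0 := by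
    rw [Complex.ofReal_ne_zero]
    positivity
  rw [half_two, smul_smul, neg_mul, mul_mul_mul_comm, Complex.I_mul_I, Complex.ofReal_inv,
    inv_mul_cancel₀ h]
  simp

namespace HalfPair

variable {j k : ℕ} {a a' b b' : Diag}

/-- After v_p, the steps R and L are (v_{p+} ∓ i v_{p−})/√2, with conjugate coefficients;
conjugation exchanges them. -/
theorem stepRight (h : HalfPair j k a a') :
    HalfPair (j + 1) k (a * stepRight k) (a' * stepLeft k) := by
  induction h with
  | zero => simpa using zero
  | smul_half d p =>
    rw [smul_mul_assoc, smul_mul_assoc, half_mul_stepRight, half_mul_stepLeft]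
    refine HalfPair.smul d (.add ?_ ?_)
    · simpa only [Complex.conj_ofReal] using smul_half ((1 / Real.sqrt 2 : ℝ) : ℂ) p.plus
    · simpa only [map_neg, map_mul, Complex.conj_I, Complex.conj_ofReal, neg_mul, neg_neg] using
        smul_half (-(Complex.I * ((1 / Real.sqrt 2 : ℝ) : ℂ))) p.minus
  | add _ _ h1 h2 => simpa [add_mul] using h1.add h2

theorem stepLeft (h : HalfPair j k a a') :
    HalfPair (j + 1) k (a * stepLeft k) (a' * TLZero.stepRight k) := by
  induction h with
  | zero => simpa using zero
  | smul_half d p =>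
    rw [smul_mul_assoc, smul_mul_assoc, half_mul_stepRight, half_mul_stepLeft]
    refine HalfPair.smul d (.add ?_ ?_)
    · simpa only [Complex.conj_ofReal] using smul_half ((1 / Real.sqrt 2 : ℝ) : ℂ) p.plus
    · simpa only [map_mul, Complex.conj_I, Complex.conj_ofReal, neg_mul] using
        smul_half (Complex.I * ((1 / Real.sqrt 2 : ℝ) : ℂ)) p.minus
  | add _ _ h1 h2 => simpa [add_mul] using h1.add h2

/-- T is a purely imaginary multiple of the normalised step, hence the sign. The truncated `k - 1`
is harmless: at k = 0 both sides vanish. -/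
theorem stepTwo (h : HalfPair j k a a') :
    HalfPair (j + 1) (k - 1) (a * stepTwo k) (-(a' * stepTwo k)) := by
  cases k with
  | zero => simpa [stepTwo_zero] using zero
  | succ k =>
    rw [Nat.add_sub_cancel]
    induction h with
    | zero => simpa using zero
    | smul_half d p =>
      rw [smul_mul_assoc, smul_mul_assoc, half_mul_stepTwo, ← Diag.smul_neg, ← Diag.neg_smul]
      refine HalfPair.smul d ?_
      simpa only [map_neg, map_mul, Complex.conj_I, Complex.conj_ofReal, neg_mul, neg_neg] using
        smul_half (-(Complex.I * (((Real.sqrt ((k + 1 : ℝ) / (k + 2 : ℝ)))⁻¹ : ℝ) : ℂ))) p.two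
    | add _ _ h1 h2 => simpa [add_mul, add_comm] using h1.add h2

end HalfPair

/-! ### The graph of the corrected involution -/

/-- `x` and `y` are linear combinations of the matrix elements `v_{p,q}` and `v_{q,p}` with
conjugate coefficients. -/
inductive DiamondPair (j : ℕ) : Diag → Diag → Prop
  | zero : DiamondPair j 0 0
  | smul_matrixElt (c : ℂ) {k : ℕ} (p q : Path j k) :
      DiamondPair j (c • matrixElt p q) (conj c • matrixElt q p)
  | add {a a' b b' : Diag} : DiamondPair j a a' → DiamondPair j b b' →
      DiamondPair j (a + b) (a' + b')

namespace DiamondPair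

variable {j k : ℕ} {x y x' y' a a' b b' : Diag}

theorem matrixElt (p q : Path j k) : DiamondPair j (matrixElt p q) (TLZero.matrixElt q p) := by
  simpa using smul_matrixElt 1 p q

theorem smul (c : ℂ) (h : DiamondPair j x y) : DiamondPair j (c • x) (conj c • y) := by
  induction h with
  | zero => simpa using zero
  | smul_matrixElt d p q => simpa [smul_smul] using smul_matrixElt (c * d) p q
  | add _ _ h1 h2 => simpa [smul_add] using h1.add h2

theorem sub (h : DiamondPair j x y) (h' : DiamondPair j x' y') :
    DiamondPair j (x - x') (y - y') := by
  simpa [sub_eq_add_neg, Diag.neg_one_smul] using h.add (h'.smul (-1))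

theorem congr (h : DiamondPair j x y) (h1 : x = x') (h2 : y = y') : DiamondPair j x' y' :=
  h1 ▸ h2 ▸ h

theorem symm (h : DiamondPair j x y) : DiamondPair j y x := by
  induction h with
  | zero => exact zero
  | smul_matrixElt d p q => simpa using smul_matrixElt (conj d) q p
  | add _ _ h1 h2 => exact h1.add h2

theorem left_mem (h : DiamondPair j x y) : x ∈ TLInf := by
  induction h with
  | zero => exact zero_mem _
  | smul_matrixElt d p q => exact Subalgebra.smul_mem _ (matrixElt_mem p q) d
  | add _ _ h1 h2 => exact add_mem h1 h2

theorem mul_cup (h : DiamondPair j x y) (i : ℕ) :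
    x * cup (2 * j + 1 + i) = cup (2 * j + 1 + i) * x := by
  induction h with
  | zero => simp
  | smul_matrixElt d p q => rw [smul_mul_assoc, mul_smul_comm, matrixElt_mul_cup]
  | add _ _ h1 h2 => rw [add_mul, mul_add, h1, h2]

theorem mul_cap (h : DiamondPair j x y) (i : ℕ) :
    x * cap (2 * j + 1 + i) = cap (2 * j + 1 + i) * x := by
  induction h with
  | zero => simp
  | smul_matrixElt d p q => rw [smul_mul_assoc, mul_smul_comm, matrixElt_mul_cap]
  | add _ _ h1 h2 => rw [add_mul, mul_add, h1, h2]

theorem mul (h : DiamondPair j x y) (h' : DiamondPair j x' y') :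
    DiamondPair j (x * x') (y' * y) := by
  induction h with
  | zero => simpa using zero
  | smul_matrixElt d p q =>
    induction h' with
    | zero => simpa using zero
    | smul_matrixElt e r s =>
      rw [smul_mul_assoc, smul_mul_assoc, mul_smul_comm, mul_smul_comm, smul_comm (conj e)]
      refine smul d (smul e ?_)
      simp only [TLZero.matrixElt, mul_assoc]
      rw [← mul_assoc (dagger (half q)), ← mul_assoc (dagger (half r))]
      rcases half_orthogonal q r with h | h
      · rw [h, dagger_mul_eq_zero_comm h]
        simpa using zero
      · cases h
        rw [half_norm, oddJW_mul_dagger_half, oddJW_mul_dagger_half]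
        exact matrixElt p s
    | add _ _ h1 h2 => simpa [mul_add, add_mul] using h1.add h2
  | add _ _ h1 h2 => simpa [mul_add, add_mul] using h1.add h2

theorem of_half (h : HalfPair j k a a') (h' : HalfPair j k b b') :
    DiamondPair j (a * dagger b) (b' * dagger a') := by
  induction h with
  | zero => simpa using zero
  | smul_half d p =>
    induction h' with
    | zero => simpa using zero
    | smul_half e q =>
      rw [dagger_smul, dagger_smul, smul_mul_assoc, smul_mul_assoc, mul_smul_comm, mul_smul_comm,
        smul_comm (conj e)]
      exact smul d (smul e (matrixElt p q))
    | add _ _ h1 h2 => simpa [mul_add, add_mul] using h1.add h2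
  | add _ _ h1 h2 => simpa [mul_add, add_mul] using h1.add h2

/-- Sandwiching between v_p† and v_q reads off the coefficient of v_{p,q}, and in the partner that
of v_{q,p}. -/
theorem exists_coeff (h : DiamondPair j x y) {l : ℕ} (p : Path j k) (q : Path j l) : ∃ c : ℂ,
    dagger (half p) * (x * half q) = c • oddJW k ∧
    dagger (half q) * (y * half p) = conj c • oddJW k := by
  induction h with
  | zero => exact ⟨0, by simp, by simp⟩
  | smul_matrixElt d r s =>
    simp only [TLZero.matrixElt, mul_assoc, smul_mul_assoc, mul_smul_comm]
    rcases half_orthogonal p r with h | h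
    · refine ⟨0, ?_, ?_⟩
      · rw [← mul_assoc (dagger (half p)), h]
        simp
      · rw [dagger_mul_eq_zero_comm h]
        simp
    · cases h
      rcases half_orthogonal q s with h | h
      · refine ⟨0, ?_, ?_⟩
        · rw [dagger_mul_eq_zero_comm h]
          simp
        · rw [← mul_assoc (dagger (half q)), h]
          simp
      · cases h
        refine ⟨d, ?_, ?_⟩
        · rw [half_norm, ← mul_assoc, half_norm, oddJW_idem]
        · rw [half_norm, ← mul_assoc, half_norm, oddJW_idem]
  | add _ _ h1 h2 =>
    obtain ⟨c, hc, hc'⟩ := h1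
    obtain ⟨d, hd, hd'⟩ := h2
    refine ⟨c + d, ?_, ?_⟩
    · rw [add_mul, mul_add, hc, hd, add_smul]
    · rw [add_mul, mul_add, hc', hd', map_add, add_smul]

/-- All coefficients of the partner vanish, being conjugates of those of 0. Detection by half
diagrams is applied on the right and, after reflection, on the left; hence the relation is the graph
of a function. -/
theorem eq_zero (h : DiamondPair j 0 y) : y = 0 := by
  refine eq_zero_of_mul_half (j := j) fun k p => ?_
  rw [← dagger_dagger (y * half p), ← dagger_zero]
  congr 1
  refine eq_zero_of_mul_half (j := j) fun l q => ?_
  obtain ⟨c, hc, hc'⟩ := h.exists_coeff p q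
  have h0 : c = 0 := by
    rw [zero_mul, mul_zero] at hc
    exact (smul_eq_zero.1 hc.symm).resolve_right (oddJW_ne_zero k)
  rw [h0, map_zero, zero_smul] at hc'
  exact dagger_mul_eq_zero_comm hc'

theorem unique (h : DiamondPair j x y) (h' : DiamondPair j x y') : y = y' := by
  have := h.sub h'
  rw [sub_self] at this
  exact sub_eq_zero.1 this.eq_zero

end DiamondPair

theorem mul_oddJW_mul_dagger_eq_sum (k : ℕ) (u v : Diag) : u * (oddJW k * dagger v) =
    u * oddJW (k + 1) * dagger (v * oddJW (k + 1)) + u * stepRight k * dagger (v * stepLeft k) +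
      u * stepLeft k * dagger (v * stepRight k) -
        ((k : ℂ) / (k + 1)) • (u * stepTwo k * dagger (v * stepTwo k)) := by
  conv_lhs => rw [oddJW_eq_sum]
  simp only [dagger_mul, dagger_oddJW, mul_assoc, oddJW_idem_assoc, add_mul, sub_mul, mul_add,
    mul_sub, smul_mul_assoc, mul_smul_comm]

theorem conj_ratio (k : ℕ) : conj ((k : ℂ) / (k + 1)) = (k : ℂ) / (k + 1) := by simp

namespace DiamondPair

variable {j k : ℕ} {x y x' y' a a' b b' : Diag}

/-- Compatibility of consecutive levels: exchanging R and L and reversing the product together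
preserve the shape of each cross term of the splitting, and TT† receives the sign twice. -/
theorem of_half_succ (h : HalfPair j k a a') (h' : HalfPair j k b b') :
    DiamondPair (j + 1) (a * dagger b) (b' * dagger a') := by
  have h1 : oddJW k * dagger b = dagger b := by
    rw [← dagger_oddJW, ← dagger_mul, h'.mul_oddJW_left]
  have h2 : oddJW k * dagger a' = dagger a' := by
    rw [← dagger_oddJW, ← dagger_mul, h.mul_oddJW_right]
  rw [← h1, ← h2, mul_oddJW_mul_dagger_eq_sum, mul_oddJW_mul_dagger_eq_sum]
  refine .sub (.add (.add (of_half h.stepZero h'.stepZero) (of_half h.stepRight h'.stepLeft))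
    (of_half h.stepLeft h'.stepRight)) ?_
  have := smul ((k : ℂ) / (k + 1)) (of_half h.stepTwo h'.stepTwo)
  rwa [conj_ratio, dagger_neg, Diag.neg_mul_neg] at this

theorem succ (h : DiamondPair j x y) : DiamondPair (j + 1) x y := by
  induction h with
  | zero => exact zero
  | smul_matrixElt d p q => exact smul d (of_half_succ (.half p) (.half q))
  | add _ _ h1 h2 => exact h1.add h2

theorem of_le (h : DiamondPair j x y) {l : ℕ} (hl : j ≤ l) : DiamondPair l x y := by
  induction l, hl using Nat.le_induction with
  | base => exact h
  | succ l _ ih => exact ih.succ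

theorem one : DiamondPair j 1 1 := by
  refine of_le (j := 0) ?_ (Nat.zero_le j)
  have := matrixElt Path.nil Path.nil
  rwa [TLZero.matrixElt, half_nil, dagger_one, mul_one] at this

theorem exists_cup_mul_cap (h : DiamondPair j x y) :
    ∃ z, DiamondPair (j + 1) (cup (2 * j + 1) * (x * cap (2 * j + 1))) z := by
  induction h with
  | zero => exact ⟨0, by simpa using zero⟩
  | @smul_matrixElt d k p q =>
    -- The step R only adds a cup beyond the existing strands, so conjugating v_{p,q} by that cup
    -- and cap yields (v_p R)(v_q R)†.
    have h1 : ∀ r : Path j k, half r * stepRight k = cup (2 * j + 1) * half r := fun r => by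
      rw [stepRight, ← oddJW_mul_cup (by omega), ← mul_assoc, half_mul_oddJW]
      exact half_mul_cup r 0
    have h2 := smul d (of_half (HalfPair.half p).stepRight (HalfPair.half q).stepRight)
    rw [h1, h1] at h2
    refine ⟨_, h2.congr ?_ rfl⟩
    simp [TLZero.matrixElt, mul_assoc]
  | add _ _ h1 h2 =>
    obtain ⟨z, hz⟩ := h1
    obtain ⟨w, hw⟩ := h2
    exact ⟨z + w, by simpa [add_mul, mul_add] using hz.add hw⟩

end DiamondPair

/-! ### The corrected involution on the generators -/

theorem neg_add_add_sub_neg {A : Type*} [AddCommGroup A] (x y z w : A) :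
    -x + z + y - -w = z + y + (z + y) - (x + y + z - w) := by
  abel

namespace HalfPair

variable {j k : ℕ} {a a' : Diag}

theorem mul_cup_mul_oddJW_succ (h : HalfPair j k a a') :
    HalfPair (j + 2) (k + 1) (a * cup (2 * k + 2) * oddJW (k + 1))
      (a' * (cup (2 * k + 1) + cup (2 * k + 3)) * oddJW (k + 1)) := by
  refine (h.stepZero.stepLeft.add h.stepLeft.stepZero).congr ?_ ?_
  · rw [← h.mul_oddJW_left]
    simp only [mul_assoc]
    rw [cup_mul_oddJW_succ, mul_add, oddJW_mul_of_le_assoc (Nat.le_succ k),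
      oddJW_mul_stepLeft_assoc]
  · rw [← h.mul_oddJW_right]
    simp only [mul_assoc]
    rw [cups_mul_oddJW_succ, mul_add, oddJW_mul_of_le_assoc (Nat.le_succ k),
      oddJW_mul_stepRight_assoc, add_comm]

theorem mul_cups_mul_stepRight (h : HalfPair j k a a') :
    a' * (cup (2 * k + 1) + cup (2 * k + 3)) * TLZero.stepRight k =
      a' * (TLZero.stepRight k * TLZero.stepRight k) +
        a' * (TLZero.stepRight k * TLZero.stepRight k) := by
  conv_lhs => rw [← h.mul_oddJW_right]
  simp only [mul_assoc]
  rw [cups_mul_stepRight, mul_add]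

theorem mul_cups_mul_stepLeft (h : HalfPair j k a a') :
    a' * (cup (2 * k + 1) + cup (2 * k + 3)) * TLZero.stepLeft k =
      a' * (TLZero.stepRight k * TLZero.stepLeft k) +
        a' * (TLZero.stepLeft k * TLZero.stepRight k) := by
  conv_lhs => rw [← h.mul_oddJW_right]
  simp only [mul_assoc]
  rw [cups_mul_stepLeft, mul_add]

theorem mul_cup_mul_stepLeft (h : HalfPair j k a a') :
    HalfPair (j + 2) k (a * cup (2 * k + 2) * TLZero.stepLeft k)
      (a' * (TLZero.stepRight k * TLZero.stepRight k)) := by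
  refine h.stepLeft.stepLeft.congr ?_ (mul_assoc _ _ _)
  conv_rhs => rw [← h.mul_oddJW_left]
  simp only [mul_assoc]
  rw [cup_mul_stepLeft]

theorem stepTwo_stepZero (h : HalfPair j k a a') :
    HalfPair (j + 2) k (((k : ℂ) / (k + 1)) • (a * (TLZero.stepTwo k * oddJW k)))
      (-(((k : ℂ) / (k + 1)) • (a' * (TLZero.stepTwo k * oddJW k)))) := by
  cases k with
  | zero => simpa [stepTwo_zero] using zero
  | succ k =>
    have := h.stepTwo.stepZero.smul (((k + 1 : ℕ) : ℂ) / ((k + 1 : ℕ) + 1))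
    rw [conj_ratio, Nat.add_sub_cancel] at this
    refine this.congr (by rw [mul_assoc]) ?_
    rw [Diag.neg_mul, Diag.smul_neg, mul_assoc]

/-- The straddling cup gives fT + LR + RL − k/(k+1) Tf. Its image has both T terms negated, hence
equals 2(RL + LR) minus the original word, and RL + LR is the word of the two neighbouring cups
followed by L. -/
theorem mul_cup_mul_stepRight (h : HalfPair j k a a') :
    HalfPair (j + 2) k (a * cup (2 * k + 2) * TLZero.stepRight k)
      (a' * (cup (2 * k + 1) + cup (2 * k + 3)) * TLZero.stepLeft k +
        a' * (cup (2 * k + 1) + cup (2 * k + 3)) * TLZero.stepLeft k -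
          a' * cup (2 * k + 2) * TLZero.stepRight k) := by
  have key : ∀ b : Diag, b * oddJW k = b → b * cup (2 * k + 2) * TLZero.stepRight k =
      b * oddJW (k + 1) * TLZero.stepTwo (k + 1) + b * TLZero.stepLeft k * TLZero.stepRight k +
        b * TLZero.stepRight k * TLZero.stepLeft k -
          ((k : ℂ) / (k + 1)) • (b * (TLZero.stepTwo k * oddJW k)) := by
    intro b hb
    conv_lhs => rw [← hb]
    simp only [mul_assoc]
    rw [cup_mul_stepRight]
    conv_rhs => rw [← hb]
    simp only [mul_add, mul_sub, mul_assoc, mul_smul_comm, oddJW_mul_of_le_assoc (Nat.le_succ k),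
      oddJW_mul_stepLeft_assoc, oddJW_mul_stepRight_assoc, oddJW_mul_stepTwo_assoc]
  refine (((h.stepZero.stepTwo.add h.stepLeft.stepRight).add h.stepRight.stepLeft).sub
    h.stepTwo_stepZero).congr ?_ ?_
  · rw [key a h.mul_oddJW_left]
  · rw [h.mul_cups_mul_stepLeft, key a' h.mul_oddJW_right]
    simp only [mul_assoc]
    exact neg_add_add_sub_neg _ _ _ _

theorem mul_cup_mul_stepTwo (h : HalfPair j k a a') :
    HalfPair (j + 2) (k - 1) (a * cup (2 * k + 2) * TLZero.stepTwo k)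
      (-(a' * (cup (2 * k + 1) + cup (2 * k + 3)) * TLZero.stepTwo k)) := by
  cases k with
  | zero => simpa [stepTwo_zero] using zero
  | succ k =>
    refine (h.stepLeft.stepTwo.add h.stepTwo.stepLeft).congr ?_ ?_
    · rw [← h.mul_oddJW_left]
      simp only [mul_assoc, Nat.add_sub_cancel]
      rw [cup_mul_stepTwo_succ, mul_add, oddJW_mul_stepLeft_assoc, oddJW_mul_stepTwo_assoc]
    · rw [← h.mul_oddJW_right]
      simp only [mul_assoc, Nat.add_sub_cancel]
      rw [cups_mul_stepTwo_succ, mul_add, oddJW_mul_stepRight_assoc, Diag.neg_mul, Diag.neg_add]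
      simp only [mul_assoc, oddJW_mul_stepTwo_assoc]

end HalfPair

theorem oddJW_mul_cups (k : ℕ) : oddJW k * (cup (2 * k + 1) + cup (2 * k + 3)) =
    (cup (2 * k + 1) + cup (2 * k + 3)) * oddJW k := by
  rw [mul_add, add_mul, oddJW_mul_cup (by omega), oddJW_mul_cup (by omega)]

namespace DiamondPair

variable {j k : ℕ} {x y a a' b b' : Diag}

/-- If every straddling word went to the corresponding word for the neighbouring cups, only the
first summand would appear. The two subtractions come from the pairs R, L: RR is half of the word
for R, and the partner in `mul_cup_mul_stepRight` contains the original cup. -/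
theorem cup_mul_cap_of_half (h : HalfPair j k a a') (h' : HalfPair j k b b') :
    DiamondPair (j + 2) (a * cup (2 * k + 2) * dagger (b * cup (2 * k + 2)))
      (b' * (cup (2 * k + 1) + cup (2 * k + 3)) *
          dagger (a' * (cup (2 * k + 1) + cup (2 * k + 3))) -
        b' * (cup (2 * k + 1) * cup (2 * k + 1)) *
          dagger (a' * (cup (2 * k + 2) * cup (2 * k + 1))) -
        b' * (cup (2 * k + 2) * cup (2 * k + 1)) *
          dagger (a' * (cup (2 * k + 1) * cup (2 * k + 1)))) := by
  have absorb : ∀ {c c' : Diag}, c * oddJW k = c → ∀ {z}, oddJW k * z = z * oddJW k →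
      c * z * dagger c' = c * z * (oddJW k * dagger c') := by
    intro c c' hc z hz
    conv_lhs => rw [← hc]
    rw [mul_assoc c, hz]
    simp only [mul_assoc]
  have hR : ∀ {c : Diag}, c * oddJW k = c →
      c * (stepRight k * stepRight k) = c * (cup (2 * k + 1) * cup (2 * k + 1)) := by
    intro c hc
    rw [stepRight_mul_stepRight, ← mul_assoc, hc, ← oddJW_mul_cup (by omega),
      ← oddJW_mul_cup_assoc (by omega), ← mul_assoc, hc]
  have hN : ∀ {c : Diag}, c * oddJW k = c →
      c * (cup (2 * k + 2) * cup (2 * k + 1)) = c * cup (2 * k + 2) * stepRight k := by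
    intro c hc
    rw [stepRight, ← oddJW_mul_cup (by omega), mul_assoc, ← oddJW_mul_cup_assoc (by omega),
      ← mul_assoc c (oddJW k), hc]
  rw [← hR h.mul_oddJW_right, ← hR h'.mul_oddJW_right, hN h.mul_oddJW_right,
    hN h'.mul_oddJW_right, absorb h.mul_oddJW_left (oddJW_mul_cup (by omega)),
    absorb h'.mul_oddJW_right (oddJW_mul_cups k), mul_oddJW_mul_dagger_eq_sum,
    mul_oddJW_mul_dagger_eq_sum, h'.mul_cups_mul_stepRight, h.mul_cups_mul_stepRight]
  have hT := smul ((k : ℂ) / (k + 1)) (of_half h.mul_cup_mul_stepTwo h'.mul_cup_mul_stepTwo)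
  rw [conj_ratio, dagger_neg, Diag.neg_mul_neg] at hT
  refine (((of_half h.mul_cup_mul_oddJW_succ h'.mul_cup_mul_oddJW_succ).add
    (of_half h.mul_cup_mul_stepRight h'.mul_cup_mul_stepLeft)).add
      (of_half h.mul_cup_mul_stepLeft h'.mul_cup_mul_stepRight)).sub hT |>.congr rfl ?_
  simp only [dagger_add, dagger_sub, mul_add, mul_sub, add_mul, sub_mul]
  abel

theorem cup_mul_cap (h : DiamondPair j x y) :
    DiamondPair (j + 2) (cup (2 * j + 2) * (x * cap (2 * j + 2)))
      ((cup (2 * j + 1) + cup (2 * j + 3)) * (y * (cap (2 * j + 1) + cap (2 * j + 3))) -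
        cup (2 * j + 1) * (cup (2 * j + 1) * (y * (cap (2 * j + 1) * cap (2 * j + 2)))) -
        cup (2 * j + 2) * (cup (2 * j + 1) * (y * (cap (2 * j + 1) * cap (2 * j + 1))))) := by
  induction h with
  | zero => simpa using zero
  | @smul_matrixElt d k p q =>
    have h1 := (smul d (cup_mul_cap_of_half (HalfPair.half p) (HalfPair.half q)))
    have hc : ∀ (r : Path j k) i, half r * cup (2 * k + 1 + i) = cup (2 * j + 1 + i) * half r :=
      half_mul_cup
    have e0 := fun r => hc r 0
    have e1 := fun r => hc r 1
    have e2 := fun r => hc r 2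
    simp only [Nat.add_zero, add_assoc, Nat.reduceAdd] at e0 e1 e2
    refine h1.congr ?_ ?_
    · rw [e1, e1]
      simp [TLZero.matrixElt, mul_assoc]
    · rw [mul_add, mul_add, ← mul_assoc (half q), ← mul_assoc (half q), ← mul_assoc (half p),
        ← mul_assoc (half p), e0, e0, e1, e1, e2, e2]
      simp only [mul_assoc, e0, TLZero.matrixElt, dagger_add, dagger_mul, dagger_cup, smul_sub,
        mul_smul_comm, smul_mul_assoc, ← add_mul]
  | add _ _ h1 h2 =>
    refine (h1.add h2).congr ?_ ?_
    · simp only [add_mul, mul_add]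
    · simp only [add_mul, mul_add]
      abel

end DiamondPair

/-! ### Images of the generators -/

namespace DiamondPair

/-- On one strand R and L are the cups at 1 and 0, so e_2 = RR† has partner LL† = e_1. -/
theorem gen_two : DiamondPair 1 (gen 2) (gen 1) := by
  have h := (HalfPair.half Path.nil).stepRight
  rw [half_nil, one_mul, one_mul, stepRight, stepLeft, oddJW_zero, one_mul, mul_one, mul_one] at h
  simpa using of_half h h

theorem gen_odd (j : ℕ) : DiamondPair (j + 2) (gen (2 * j + 3))
    (gen (2 * j + 2) + gen (2 * j + 4) + gen (2 * j + 2) * gen (2 * j + 3) * gen (2 * j + 4) +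
      gen (2 * j + 4) * gen (2 * j + 3) * gen (2 * j + 2) -
      gen (2 * j + 3) * gen (2 * j + 2) * gen (2 * j + 4) -
      gen (2 * j + 2) * gen (2 * j + 4) * gen (2 * j + 3)) := by
  have h1 : gen (2 * j + 2) * gen (2 * j + 3) * gen (2 * j + 4) =
      cup (2 * j + 1) * cap (2 * j + 3) := by
    simp only [gen_succ, mul_assoc, cap_mul_cup_succ_assoc]
  have h2 : gen (2 * j + 4) * gen (2 * j + 3) * gen (2 * j + 2) =
      cup (2 * j + 3) * cap (2 * j + 1) := by
    simp only [gen_succ, mul_assoc, cap_succ_mul_cup_assoc]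
  have h3 : gen (2 * j + 3) * gen (2 * j + 2) * gen (2 * j + 4) =
      cup (2 * j + 2) * (cup (2 * j + 1) * (cap (2 * j + 1) * cap (2 * j + 1))) := by
    simp only [gen_succ, mul_assoc, cap_succ_mul_cup_assoc]
    rw [cap_mul_cup_of_le_assoc (le_refl (2 * j + 1)), cap_mul_cap (le_refl (2 * j + 1))]
  have h4 : gen (2 * j + 2) * gen (2 * j + 4) * gen (2 * j + 3) =
      cup (2 * j + 1) * (cup (2 * j + 1) * (cap (2 * j + 1) * cap (2 * j + 2))) := by
    simp only [gen_succ, mul_assoc, cap_succ_mul_cup_assoc]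
    rw [cap_mul_cup_of_le_assoc (le_refl (2 * j + 1))]
  refine (cup_mul_cap (one (j := j))).congr ?_ ?_
  · rw [one_mul, gen_succ]
  · rw [h1, h2, h3, h4, one_mul, one_mul, one_mul, gen_succ, gen_succ]
    simp only [add_mul, mul_add]
    abel

theorem exists_gen_even (j : ℕ) : ∃ y, DiamondPair (j + 1) (gen (2 * j + 2)) y := by
  obtain ⟨z, hz⟩ := exists_cup_mul_cap (one (j := j))
  exact ⟨z, by simpa using hz⟩

variable {i j : ℕ} {x y x' y' : Diag}

theorem eq_of_pairs (h : DiamondPair i x y) (h' : DiamondPair j x y') : y = y' :=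
  (h.of_le (le_max_left i j)).unique (h'.of_le (le_max_right i j))

theorem exists_of_mem (hx : x ∈ TLInf) : ∃ j y, DiamondPair j x y := by
  refine Algebra.adjoin_induction (p := fun x _ => ∃ j y, DiamondPair j x y) ?_ ?_ ?_ ?_ hx
  · rintro _ ⟨i, hi, rfl⟩
    rcases Nat.even_or_odd' i with ⟨j, rfl | rfl⟩
    · obtain ⟨j, rfl⟩ := Nat.exists_eq_add_of_le' (show 1 ≤ j by omega)
      exact ⟨_, exists_gen_even j⟩
    · cases j with
      -- e_1 has no left neighbour, so the formula for odd generators starts at e_3.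
      | zero => exact ⟨1, _, gen_two.symm⟩
      | succ j => exact ⟨_, _, gen_odd j⟩
  · intro r
    exact ⟨0, conj r • 1, by
      rw [Algebra.algebraMap_eq_smul_one]; exact smul r one⟩
  · rintro x y _ _ ⟨i, x', hx⟩ ⟨j, y', hy⟩
    exact ⟨max i j, _, (hx.of_le (le_max_left i j)).add (hy.of_le (le_max_right i j))⟩
  · rintro x y _ _ ⟨i, x', hx⟩ ⟨j, y', hy⟩
    exact ⟨max i j, _, (hx.of_le (le_max_left i j)).mul (hy.of_le (le_max_right i j))⟩

theorem right_mem (h : DiamondPair j x y) : y ∈ TLInf := h.symm.left_mem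

/-- A corrected involution is forced on matrix elements and thus by conjugate linearity on every
pair. As each element of TL_∞ belongs to a pair, this gives uniqueness. -/
theorem map_eq (h : DiamondPair j x y) {d : TLInf →ₛₗ[starRingEnd ℂ] TLInf}
    (hd : IsCorrectedInvolution d) : d ⟨x, h.left_mem⟩ = ⟨y, h.right_mem⟩ := by
  induction h with
  | zero => exact map_zero d
  | smul_matrixElt c p q =>
    have h1 := hd.map_matrixElt p q ⟨_, matrixElt_mem p q⟩ ⟨_, matrixElt_mem q p⟩ rfl rfl
    have h2 := map_smulₛₗ d c ⟨_, matrixElt_mem p q⟩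
    rw [h1] at h2
    exact h2
  | add h1 h2 ih1 ih2 =>
    have h3 := map_add d ⟨_, h1.left_mem⟩ ⟨_, h2.left_mem⟩
    rw [ih1, ih2] at h3
    exact h3

end DiamondPair

/-! ### Existence and uniqueness of the corrected involution -/

theorem exists_diamond (x : TLInf) : ∃ y : TLInf, ∃ j, DiamondPair j x y := by
  obtain ⟨j, y, h⟩ := DiamondPair.exists_of_mem x.2
  exact ⟨⟨y, h.right_mem⟩, j, h⟩

def diamondFun (x : TLInf) : TLInf := (exists_diamond x).choose

theorem diamondFun_pair (x : TLInf) : ∃ j, DiamondPair j x (diamondFun x) :=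
  (exists_diamond x).choose_spec

theorem diamondFun_eq {j : ℕ} {x y : TLInf} (h : DiamondPair j x y) : diamondFun x = y := by
  obtain ⟨i, hi⟩ := diamondFun_pair x
  exact Subtype.ext (hi.eq_of_pairs h)

/-- The corrected involution. -/
def diamond : TLInf →ₛₗ[starRingEnd ℂ] TLInf where
  toFun := diamondFun
  map_add' x y := by
    obtain ⟨i, hi⟩ := diamondFun_pair x
    obtain ⟨j, hj⟩ := diamondFun_pair y
    exact diamondFun_eq (j := max i j)
      ((hi.of_le (le_max_left i j)).add (hj.of_le (le_max_right i j)))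
  map_smul' c x := by
    obtain ⟨i, hi⟩ := diamondFun_pair x
    exact diamondFun_eq (hi.smul c)

theorem isCorrectedInvolution_diamond : IsCorrectedInvolution diamond where
  map_mul x y := by
    obtain ⟨i, hi⟩ := diamondFun_pair x
    obtain ⟨j, hj⟩ := diamondFun_pair y
    exact diamondFun_eq (j := max i j)
      ((hi.of_le (le_max_left i j)).mul (hj.of_le (le_max_right i j)))
  involutive x := by
    obtain ⟨i, hi⟩ := diamondFun_pair x
    exact diamondFun_eq hi.symm
  map_matrixElt p q x y hx hy := by
    have h := DiamondPair.matrixElt p q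
    rw [← hx, ← hy] at h
    exact diamondFun_eq h

theorem existsUnique_correctedInvolution :
    ∃! d : TLInf →ₛₗ[starRingEnd ℂ] TLInf, IsCorrectedInvolution d := by
  refine ⟨diamond, isCorrectedInvolution_diamond, fun d hd => LinearMap.ext fun x => ?_⟩
  obtain ⟨i, hi⟩ := diamondFun_pair x
  exact hi.map_eq hd

/-! ### Norms of the generators -/

theorem genInf_sq (i : ℕ) : genInf i * genInf i = 0 := Subtype.ext (gen_sq i)

theorem genInf_mul_succ_mul {i : ℕ} (hi : 1 ≤ i) :
    genInf i * genInf (i + 1) * genInf i = genInf i :=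
  Subtype.ext (gen_mul_gen_succ_mul_gen hi)

theorem genInf_succ_mul_mul_succ {i : ℕ} (hi : 1 ≤ i) :
    genInf (i + 1) * genInf i * genInf (i + 1) = genInf (i + 1) :=
  Subtype.ext (gen_succ_mul_gen_mul_gen_succ hi)

theorem mul_gen_of_mem_TL {n i : ℕ} {x : Diag} (hx : x ∈ TL n) (hi : n < i) :
    x * gen i = gen i * x := by
  rw [gen, ← mul_assoc, mul_cup_of_mem_TL hx (by omega), mul_assoc,
    mul_cap_of_mem_TL hx (by omega), mul_assoc]

theorem genInf_commute {i j : ℕ} (hi : 1 ≤ i) (h : i + 2 ≤ j) :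
    genInf i * genInf j = genInf j * genInf i :=
  Subtype.ext (mul_gen_of_mem_TL (gen_mem_TL hi (Nat.lt_succ_self i)) (by omega))

namespace IsNormalizedTrace

variable {χ : TLInf →ₗ[ℂ] ℂ}

/-- Insert e_{i+1} = e_{i+1} e_i e_{i+1}, rotate under the trace, and contract e_{i+1} e_{i+2}
e_{i+1}. -/
theorem map_gen_mul_gen_succ (hχ : IsNormalizedTrace χ) {i : ℕ} (hi : 1 ≤ i) :
    χ (genInf i * genInf (i + 1)) = χ (genInf 1 * genInf 2) := by
  induction i, hi using Nat.le_induction with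
  | base => rfl
  | succ i hi ih =>
    rw [← ih]
    conv_lhs => rw [← genInf_succ_mul_mul_succ hi]
    rw [mul_assoc, mul_assoc, hχ.map_mul_comm, mul_assoc, mul_assoc, ← mul_assoc (genInf (i + 1)),
      genInf_mul_succ_mul (Nat.le_add_left 1 i)]

theorem map_gen_succ_mul_gen (hχ : IsNormalizedTrace χ) {i : ℕ} (hi : 1 ≤ i) :
    χ (genInf (i + 1) * genInf i) = χ (genInf 1 * genInf 2) := by
  rw [hχ.map_mul_comm, hχ.map_gen_mul_gen_succ hi]

end IsNormalizedTrace

theorem sub_sub_add_add {A : Type*} [AddCommGroup A] (x y z : A) : x - y - z + y + z = x := by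
  abel

theorem diamond_gen_one {d : TLInf →ₛₗ[starRingEnd ℂ] TLInf} (hd : IsCorrectedInvolution d) :
    d (genInf 1) = genInf 2 :=
  DiamondPair.gen_two.symm.map_eq hd

theorem diamond_gen_odd {d : TLInf →ₛₗ[starRingEnd ℂ] TLInf} (hd : IsCorrectedInvolution d)
    (j : ℕ) : d (genInf (2 * j + 3)) +
      genInf (2 * j + 3) * genInf (2 * j + 2) * genInf (2 * j + 4) +
      genInf (2 * j + 2) * genInf (2 * j + 4) * genInf (2 * j + 3) =
      genInf (2 * j + 2) + genInf (2 * j + 4) +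
      genInf (2 * j + 2) * genInf (2 * j + 3) * genInf (2 * j + 4) +
      genInf (2 * j + 4) * genInf (2 * j + 3) * genInf (2 * j + 2) := by
  have h : d (genInf (2 * j + 3)) = _ := (DiamondPair.gen_odd j).map_eq hd
  rw [h]
  refine Subtype.ext ?_
  exact sub_sub_add_add _ _ _

/-- The image of e_{2j+2} is built at level j+1, on 2j+3 strands, and e_{2j+4} acts beyond them.
This locality replaces a closed form for the image. -/
theorem diamond_gen_even_commute {d : TLInf →ₛₗ[starRingEnd ℂ] TLInf}
    (hd : IsCorrectedInvolution d) (j : ℕ) :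
    d (genInf (2 * j + 2)) * genInf (2 * j + 4) = genInf (2 * j + 4) * d (genInf (2 * j + 2)) := by
  obtain ⟨y, hy⟩ := DiamondPair.exists_gen_even j
  have h1 : d (genInf (2 * j + 2)) = ⟨y, hy.right_mem⟩ := hy.map_eq hd
  rw [h1]
  refine Subtype.ext ?_
  change y * gen (2 * j + 4) = gen (2 * j + 4) * y
  have h2 := hy.symm.mul_cup 0
  have h3 := hy.symm.mul_cap 0
  rw [gen_succ, ← mul_assoc]
  change y * cup (2 * (j + 1) + 1 + 0) * cap (2 * (j + 1) + 1 + 0) = _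
  rw [h2, mul_assoc, h3, ← mul_assoc]
  rfl

/-- With n = 2j+3, multiplying e_n◇ by e_n contracts the two triple products with positive sign to
products of neighbours. Together with the two linear terms they give four values γ; the negative
terms vanish by e_n² = 0, one directly and one after rotation. -/
theorem sqNorm_gen_odd {d : TLInf →ₛₗ[starRingEnd ℂ] TLInf} (hd : IsCorrectedInvolution d)
    {χ : TLInf →ₗ[ℂ] ℂ} (hχ : IsNormalizedTrace χ) (j : ℕ) :
    sqNorm d χ (genInf (2 * j + 3)) = 4 * χ (genInf 1 * genInf 2) := by
  have h1 : genInf (2 * j + 3) * (genInf (2 * j + 2) * genInf (2 * j + 3) * genInf (2 * j + 4)) =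
      genInf (2 * j + 3) * genInf (2 * j + 4) := by
    rw [← mul_assoc, ← mul_assoc, genInf_succ_mul_mul_succ (by omega : 1 ≤ 2 * j + 2)]
  have h2 : genInf (2 * j + 3) * (genInf (2 * j + 4) * genInf (2 * j + 3) * genInf (2 * j + 2)) =
      genInf (2 * j + 3) * genInf (2 * j + 2) := by
    rw [← mul_assoc, ← mul_assoc, genInf_mul_succ_mul (by omega : 1 ≤ 2 * j + 3)]
  have h3 : genInf (2 * j + 3) * (genInf (2 * j + 3) * genInf (2 * j + 2) * genInf (2 * j + 4)) =
      0 := by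
    rw [← mul_assoc, ← mul_assoc, genInf_sq, zero_mul, zero_mul]
  have h4 : χ (genInf (2 * j + 3) *
      (genInf (2 * j + 2) * genInf (2 * j + 4) * genInf (2 * j + 3))) = 0 := by
    rw [hχ.map_mul_comm, mul_assoc, genInf_sq, mul_zero, map_zero]
  have h5 := hχ.map_gen_succ_mul_gen (by omega : 1 ≤ 2 * j + 2)
  have h6 := hχ.map_gen_mul_gen_succ (by omega : 1 ≤ 2 * j + 3)
  have h := congrArg (fun x => χ (genInf (2 * j + 3) * x)) (diamond_gen_odd hd j)
  simp only [mul_add, map_add, h1, h2, h3, h4, add_zero] at h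
  rw [sqNorm, h, h5, h6]
  ring

/-- Put a = e_{2j+2}, b = e_{2j+3}, C = e_{2j+4}◇. Applying ◇ to the formula for b◇ gives b + C a◇b◇
+ b◇C a◇ = a◇ + C + C b◇a◇ + a◇b◇C. After multiplication by a and the trace, `t1`, `t2` and `t3`
cancel the rest, because C commutes with a and with a◇. -/
theorem sqNorm_gen_even {d : TLInf →ₛₗ[starRingEnd ℂ] TLInf} (hd : IsCorrectedInvolution d)
    {χ : TLInf →ₗ[ℂ] ℂ} (hχ : IsNormalizedTrace χ) (j : ℕ) :
    sqNorm d χ (genInf (2 * j + 2)) = χ (genInf 1 * genInf 2) := by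
  have h1 := congrArg d (diamond_gen_odd hd j)
  have hac := congrArg d (genInf_commute (by omega : 1 ≤ 2 * j + 2) (le_refl (2 * j + 2 + 2)))
  have hc := congrArg d (diamond_gen_even_commute hd j)
  have h2 := hχ.map_gen_mul_gen_succ (by omega : 1 ≤ 2 * j + 2)
  have h3 := genInf_mul_succ_mul (by omega : 1 ≤ 2 * j + 2)
  have h4 := genInf_sq (2 * j + 2)
  simp only [map_add, hd.map_mul, hd.involutive] at h1 hac hc
  rw [sqNorm, ← h2]
  change d (genInf (2 * j + 4)) * d (genInf (2 * j + 2)) =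
    d (genInf (2 * j + 2)) * d (genInf (2 * j + 4)) at hac
  generalize genInf (2 * j + 2) = a at *
  change χ (a * d a) = χ (a * genInf (2 * j + 3))
  change a * genInf (2 * j + 3) * a = a at h3
  generalize genInf (2 * j + 3) = b at *
  generalize d (genInf (2 * j + 4)) = C at *
  -- Write a = a b a, move C past the last a, and rotate to create a².
  have t1 : χ (a * C) = 0 := by
    rw [← h3, mul_assoc, ← hc, ← mul_assoc, hχ.map_mul_comm, ← mul_assoc, ← mul_assoc, h4,
      zero_mul, zero_mul, map_zero]
  have t2 : χ (a * (C * (d b * d a))) = χ (a * (d b * (C * d a))) := by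
    rw [← mul_assoc, ← hc, mul_assoc, hχ.map_mul_comm, hac]
    simp only [mul_assoc]
  have t3 : χ (a * (d a * (d b * C))) = χ (a * (C * (d a * d b))) := by
    rw [← mul_assoc a C, ← hc, ← mul_assoc, ← mul_assoc, hχ.map_mul_comm]
    simp only [mul_assoc]
  have h := congrArg (fun x => χ (a * x)) h1
  simp only [mul_add, map_add, t1, t2, t3] at h
  linear_combination -h

/-! ### Uniqueness of multiplicative traces -/

/-- The sums of elements of `TL_n` and of products `a e_n b` with `a` and `b` in `TL_n`. -/
def bimoduleSum (n : ℕ) : AddSubmonoid Diag :=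
  AddSubmonoid.closure ({x | x ∈ TL n} ∪ {x | ∃ a ∈ TL n, ∃ b ∈ TL n, x = a * gen n * b})

theorem exists_algebraMap_of_mem_TL_one {x : Diag} (hx : x ∈ TL 1) :
    ∃ c : ℂ, x = algebraMap ℂ Diag c := by
  have h : {x | ∃ i, 1 ≤ i ∧ i < 1 ∧ x = gen i} = (∅ : Set Diag) := by
    refine Set.eq_empty_of_forall_notMem ?_
    rintro x ⟨i, h1, h2, -⟩
    omega
  rw [TL, h, Algebra.adjoin_empty, Algebra.mem_bot] at hx
  obtain ⟨c, hc⟩ := hx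
  exact ⟨c, hc.symm⟩

/-- The sum contains 1 and is stable under left multiplication by the generators; the hypothesis on
e_n a e_n handles the one case that would create a second e_n. -/
theorem TL_succ_le_bimoduleSum {n : ℕ} (hn : 1 ≤ n)
    (h : ∀ a ∈ TL n, ∃ u ∈ TL n, gen n * a * gen n = u * gen n) {x : Diag}
    (hx : x ∈ TL (n + 1)) : x ∈ bimoduleSum n := by
  have key : ∀ s ∈ bimoduleSum n, x * s ∈ bimoduleSum n := by
    refine Algebra.adjoin_induction (p := fun x _ => ∀ s ∈ bimoduleSum n, x * s ∈ bimoduleSum n)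
      ?_ ?_ ?_ ?_ hx
    · rintro _ ⟨i, h1, h2, rfl⟩ s hs
      refine AddSubmonoid.closure_induction (motive := fun s _ => gen i * s ∈ bimoduleSum n)
        ?_ ?_ ?_ hs
      · rintro s (hs | ⟨a, ha, b, hb, rfl⟩)
        · rcases Nat.lt_or_ge i n with h3 | h3
          · exact AddSubmonoid.subset_closure (Or.inl (mul_mem (gen_mem_TL h1 h3) hs))
          · obtain rfl : i = n := by omega
            exact AddSubmonoid.subset_closure (Or.inr ⟨1, one_mem _, s, hs, by rw [one_mul]⟩)
        · rcases Nat.lt_or_ge i n with h3 | h3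
          · exact AddSubmonoid.subset_closure (Or.inr ⟨gen i * a, mul_mem (gen_mem_TL h1 h3) ha,
              b, hb, by simp only [mul_assoc]⟩)
          · obtain rfl : i = n := by omega
            obtain ⟨u, hu, h4⟩ := h a ha
            exact AddSubmonoid.subset_closure (Or.inr ⟨u, hu, b, hb, by
              rw [← mul_assoc, ← mul_assoc, h4]⟩)
      · rw [mul_zero]; exact zero_mem _
      · intro s t _ _ hs ht
        rw [mul_add]; exact add_mem hs ht
    · intro r s hs
      refine AddSubmonoid.closure_induction
        (motive := fun s _ => algebraMap ℂ Diag r * s ∈ bimoduleSum n) ?_ ?_ ?_ hs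
      · rintro s (hs | ⟨a, ha, b, hb, rfl⟩)
        · exact AddSubmonoid.subset_closure (Or.inl (mul_mem ((TL n).algebraMap_mem r) hs))
        · exact AddSubmonoid.subset_closure (Or.inr ⟨algebraMap ℂ Diag r * a,
            mul_mem ((TL n).algebraMap_mem r) ha, b, hb, by simp only [mul_assoc]⟩)
      · rw [mul_zero]; exact zero_mem _
      · intro s t _ _ hs ht
        rw [mul_add]; exact add_mem hs ht
    · intro x y _ _ h1 h2 s hs
      rw [add_mul]; exact add_mem (h1 s hs) (h2 s hs)
    · intro x y _ _ h1 h2 s hs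
      rw [mul_assoc]; exact h1 _ (h2 s hs)
  rw [← mul_one x]
  exact key 1 (AddSubmonoid.subset_closure (Or.inl (one_mem (TL n))))

/-- The claim for n decomposes TL_{n+1}, and e_{n+1} e_n e_{n+1} = e_{n+1} applied to that
decomposition gives the claim for n+1. -/
theorem gen_mul_mul_gen {n : ℕ} (hn : 1 ≤ n) :
    ∀ a ∈ TL n, ∃ u ∈ TL n, gen n * a * gen n = u * gen n := by
  induction n, hn using Nat.le_induction with
  | base =>
    intro a ha
    obtain ⟨c, rfl⟩ := exists_algebraMap_of_mem_TL_one ha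
    exact ⟨0, zero_mem _, by rw [mul_assoc, Algebra.commutes, ← mul_assoc, gen_sq, zero_mul,
      zero_mul]⟩
  | succ n hn ih =>
    intro a ha
    refine AddSubmonoid.closure_induction
      (motive := fun a _ => ∃ u ∈ TL (n + 1), gen (n + 1) * a * gen (n + 1) = u * gen (n + 1))
      ?_ ?_ ?_ (TL_succ_le_bimoduleSum hn ih ha)
    · rintro a (ha | ⟨u, hu, v, hv, rfl⟩)
      · exact ⟨0, zero_mem _, by
          rw [mul_assoc, mul_gen_of_mem_TL ha (Nat.lt_succ_self n), ← mul_assoc, gen_sq, zero_mul,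
            zero_mul]⟩
      · refine ⟨u * v, TL_mono (Nat.le_succ n) (mul_mem hu hv), ?_⟩
        have h1 := mul_gen_of_mem_TL hu (Nat.lt_succ_self n)
        have h2 := mul_gen_of_mem_TL hv (Nat.lt_succ_self n)
        have h3 := gen_succ_mul_gen_mul_gen_succ hn
        rw [mul_assoc, mul_assoc (u * gen n), h2, ← mul_assoc, ← mul_assoc, ← mul_assoc, ← h1,
          mul_assoc u, mul_assoc u, h3, mul_assoc, ← h2, mul_assoc]
    · exact ⟨0, zero_mem _, by simp⟩
    · rintro x y _ _ ⟨u, hu, h1⟩ ⟨v, hv, h2⟩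
      exact ⟨u + v, add_mem hu hv, by rw [mul_add, add_mul, h1, h2, add_mul]⟩

theorem TLInf_succ_induction {n : ℕ} (hn : 1 ≤ n) {p : TLInf → Prop}
    (base : ∀ x : TLInf, (x : Diag) ∈ TL n → p x)
    (mul : ∀ a b : TLInf, (a : Diag) ∈ TL n → (b : Diag) ∈ TL n → p (a * genInf n * b))
    (add : ∀ x y, p x → p y → p (x + y)) {x : TLInf} (hx : (x : Diag) ∈ TL (n + 1)) : p x := by
  have : ∃ h : (x : Diag) ∈ TLInf, p ⟨x, h⟩ := by
    refine AddSubmonoid.closure_induction (motive := fun x _ => ∃ h : x ∈ TLInf, p ⟨x, h⟩)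
      ?_ ?_ ?_ (TL_succ_le_bimoduleSum hn (gen_mul_mul_gen hn) hx)
    · rintro y (hy | ⟨a, ha, b, hb, rfl⟩)
      · exact ⟨TL_le_TLInf n hy, base _ hy⟩
      · have h1 := TL_le_TLInf n ha
        have h2 := TL_le_TLInf n hb
        exact ⟨mul_mem (mul_mem h1 (gen_mem n)) h2, mul ⟨a, h1⟩ ⟨b, h2⟩ ha hb⟩
    · exact ⟨zero_mem _, base 0 (zero_mem _)⟩
    · rintro y z _ _ ⟨h1, h2⟩ ⟨h3, h4⟩
      exact ⟨add_mem h1 h3, add _ _ h2 h4⟩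
  exact this.2

/-- The product `e_k e_{k+1} ⋯ e_{k+r-1}`. -/
def genRun (k : ℕ) : ℕ → TLInf
  | 0 => 1
  | r + 1 => genRun k r * genInf (k + r)

theorem genInf_mul_genRun (k r : ℕ) : genInf k * genRun (k + 1) r = genRun k (r + 1) := by
  induction r with
  | zero => simp [genRun]
  | succ r ih =>
    rw [genRun, ← mul_assoc, ih, genRun, genRun, genRun, add_assoc k 1 r, add_comm 1 r]

theorem genRun_mem (r : ℕ) : (genRun 1 r : Diag) ∈ TL (r + 1) := by
  induction r with
  | zero => exact one_mem _
  | succ r ih =>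
    exact mul_mem (TL_mono (Nat.le_succ _) ih) (gen_mem_TL (by omega) (by omega))

theorem mul_genRun {k : ℕ} {x : TLInf} (hx : (x : Diag) ∈ TL k) (r : ℕ) :
    x * genRun (k + 1) r = genRun (k + 1) r * x := by
  induction r with
  | zero => simp [genRun]
  | succ r ih =>
    have : x * genInf (k + 1 + r) = genInf (k + 1 + r) * x :=
      Subtype.ext (mul_gen_of_mem_TL hx (by omega))
    rw [genRun, ← mul_assoc, ih, mul_assoc, this, mul_assoc]

theorem shift_cup (m i : ℕ) : shift m (cup i) = cup (i + m) := by
  simp [shift, cup, shiftGen]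

theorem shift_cap (m i : ℕ) : shift m (cap i) = cap (i + m) := by
  simp [shift, cap, shiftGen]

theorem shift_gen (m : ℕ) {i : ℕ} (hi : 1 ≤ i) : shift m (gen i) = gen (i + m) := by
  obtain ⟨i, rfl⟩ := Nat.exists_eq_add_of_le' hi
  rw [gen_succ, map_mul, shift_cup, shift_cap, Nat.add_right_comm, gen_succ]

theorem shift_genRun (k r : ℕ) : shift k (genRun 1 r) = genRun (k + 1) r := by
  induction r with
  | zero => exact map_one _
  | succ r ih =>
    have h1 : ((genRun 1 (r + 1) : TLInf) : Diag) = genRun 1 r * gen (1 + r) := rfl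
    have h2 : ((genRun (k + 1) (r + 1) : TLInf) : Diag) = genRun (k + 1) r * gen (k + 1 + r) := rfl
    rw [h1, h2, map_mul, ih, shift_gen k (Nat.le_add_right 1 r)]
    congr 2
    omega

namespace IsMultiplicative

variable {χ : TLInf →ₗ[ℂ] ℂ}

theorem map_mul_genRun (hm : IsMultiplicative χ) {k : ℕ} {x : TLInf} (hx : (x : Diag) ∈ TL k)
    (r : ℕ) : χ (x * genRun (k + 1) r) = χ x * χ (genRun 1 r) :=
  hm k x (genRun 1 r) _ hx (by rw [shift_genRun]; rfl)

/-- Under the trace, e_{r+1} e_{r+2} after a shorter run can be pushed one place right to e_{r+2}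
e_{r+3}, as for γ. It is then separated from the run, and multiplicativity applies. -/
theorem map_genRun_add_two (hm : IsMultiplicative χ) (hχ : IsNormalizedTrace χ) (r : ℕ) :
    χ (genRun 1 (r + 2)) = χ (genRun 1 r) * χ (genInf 1 * genInf 2) := by
  have h1 : genRun 1 2 = genInf 1 * genInf 2 := by
    rw [genRun, genRun, genRun, one_mul]
  rw [← h1, ← hm.map_mul_genRun (genRun_mem r), genRun, genRun, genRun, genRun, genRun, one_mul]
  have h2 := genInf_mul_succ_mul (by omega : 1 ≤ 1 + (r + 1))
  have h3 := genInf_succ_mul_mul_succ (by omega : 1 ≤ 1 + r)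
  have h4 : genRun 1 r * genInf (1 + (r + 1)) = genInf (1 + (r + 1)) * genRun 1 r :=
    Subtype.ext (mul_gen_of_mem_TL (genRun_mem r) (by omega))
  have e1 : r + 1 + 1 + 0 = 1 + (r + 1) := by omega
  have e3 : 1 + r + 1 = 1 + (r + 1) := by omega
  rw [e3] at h3
  rw [e1]
  conv_lhs => rw [← h2]
  rw [← mul_assoc, hχ.map_mul_comm, ← mul_assoc, ← mul_assoc, ← mul_assoc, ← h4,
    mul_assoc (genRun 1 r), mul_assoc (genRun 1 r), h3, mul_assoc]

end IsMultiplicative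

theorem multiplicative_trace_unique {χ χ' : TLInf →ₗ[ℂ] ℂ} (hχ : IsNormalizedTrace χ)
    (hm : IsMultiplicative χ) (hχ' : IsNormalizedTrace χ') (hm' : IsMultiplicative χ')
    (h : χ (genInf 1 * genInf 2) = χ' (genInf 1 * genInf 2)) : χ = χ' := by
  have hgen : ∀ {ψ : TLInf →ₗ[ℂ] ℂ}, IsNormalizedTrace ψ → ψ (genRun 1 1) = 0 := by
    intro ψ hψ
    rw [genRun, genRun, one_mul, ← genInf_mul_succ_mul le_rfl, hψ.map_mul_comm, ← mul_assoc,
      genInf_sq, zero_mul, map_zero]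
  have hrun : ∀ r, χ (genRun 1 r) = χ' (genRun 1 r) := by
    intro r
    induction r using Nat.twoStepInduction with
    | zero => exact hχ.map_one.trans hχ'.map_one.symm
    | one => rw [hgen hχ, hgen hχ']
    | more r ih _ => rw [hm.map_genRun_add_two hχ, hm'.map_genRun_add_two hχ', ih, h]
  -- Values on an element of TL_k followed by a run starting at e_k: a factor a e_{k−1} b is rotated
  -- to ba e_{k−1}, which lengthens the run and lowers k. When e_{k−1} is absent, multiplicativity
  -- splits off the run.
  have hW : ∀ k, 1 ≤ k → (∀ x : TLInf, (x : Diag) ∈ TL k → χ x = χ' x) →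
      ∀ z : TLInf, (z : Diag) ∈ TL k → ∀ r, χ (z * genRun k r) = χ' (z * genRun k r) := by
    intro k hk
    induction k, hk using Nat.le_induction with
    | base =>
      intro _ z hz r
      obtain ⟨c, hc⟩ := exists_algebraMap_of_mem_TL_one hz
      obtain rfl : z = algebraMap ℂ TLInf c := Subtype.ext hc
      rw [← Algebra.smul_def, map_smul, map_smul, hrun]
    | succ k hk ih =>
      intro hU z hz r
      have hU' : ∀ x : TLInf, (x : Diag) ∈ TL k → χ x = χ' x :=
        fun x hx => hU x (TL_mono (Nat.le_succ k) hx)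
      refine TLInf_succ_induction hk (p := fun z => χ (z * genRun (k + 1) r) =
        χ' (z * genRun (k + 1) r)) ?_ ?_ ?_ hz
      · intro x hx
        rw [hm.map_mul_genRun hx, hm'.map_mul_genRun hx, hU' x hx, hrun]
      · intro a b ha hb
        rw [mul_assoc, mul_genRun hb, ← mul_assoc, hχ.map_mul_comm, hχ'.map_mul_comm,
          mul_assoc a, genInf_mul_genRun, ← mul_assoc]
        exact ih hU' _ (mul_mem hb ha) _
      · intro x y hx hy
        rw [add_mul, map_add, map_add, hx, hy]
  have hU : ∀ n, 1 ≤ n → ∀ x : TLInf, (x : Diag) ∈ TL n → χ x = χ' x := by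
    intro n hn
    induction n, hn using Nat.le_induction with
    | base =>
      intro z hz
      obtain ⟨c, hc⟩ := exists_algebraMap_of_mem_TL_one hz
      obtain rfl : z = algebraMap ℂ TLInf c := Subtype.ext hc
      rw [Algebra.algebraMap_eq_smul_one, map_smul, map_smul, hχ.map_one, hχ'.map_one]
    | succ n hn ih =>
      intro x hx
      refine TLInf_succ_induction hn ih ?_ ?_ hx
      · intro a b ha hb
        rw [hχ.map_mul_comm, hχ'.map_mul_comm, ← mul_assoc]
        have := hW n hn ih (b * a) (mul_mem hb ha) 1
        rwa [genRun, genRun, one_mul] at this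
      · intro x y hx hy
        rw [map_add, map_add, hx, hy]
  refine LinearMap.ext fun x => ?_
  obtain ⟨n, hn⟩ := exists_mem_TL x.2
  exact hU (n + 1) (by omega) x (TL_mono (Nat.le_succ n) hn)

/-! ### Existence of multiplicative traces -/

def pushWord : List Bool → Chain
  | [] => 1
  | b :: s => push b * pushWord s

def pullWord : List Bool → Chain
  | [] => 1
  | b :: s => pullWord s * pull b

theorem pushWord_append (s t : List Bool) : pushWord (s ++ t) = pushWord s * pushWord t := by
  induction s with
  | nil => simp [pushWord]
  | cons b s ih => rw [List.cons_append, pushWord, ih, pushWord, mul_assoc]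

theorem pullWord_append (s t : List Bool) : pullWord (s ++ t) = pullWord t * pullWord s := by
  induction s with
  | nil => simp [pullWord]
  | cons b s ih => rw [List.cons_append, pullWord, ih, pullWord, mul_assoc]

theorem pull_mul_push (b c : Bool) : pull b * push c = if b = c then 1 else 0 := by
  cases b <;> cases c <;> simp

theorem pull_mul_addSite (b : Bool) (x : Chain) : pull b * addSite x = x * pull b := by
  cases b <;> simp [addSite, mul_add, mul_assoc]

theorem pullWord_mul_pushWord {s t : List Bool} (h : s.length = t.length) :
    pullWord s * pushWord t = if s = t then 1 else 0 := by
  induction s generalizing t with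
  | nil =>
    obtain rfl : t = [] := List.length_eq_zero_iff.1 h.symm
    simp [pullWord, pushWord]
  | cons b s ih =>
    cases t with
    | nil => simp at h
    | cons c t =>
      rw [pullWord, pushWord, mul_assoc, ← mul_assoc (pull b), pull_mul_push]
      have h' : s.length = t.length := by simpa using h
      by_cases hbc : b = c
      · simp [hbc, ih h']
      · simp [hbc]

/-- Operators on the first `n` sites that preserve the number of sites in each state. -/
def localOps (n : ℕ) : Submodule ℂ Chain :=
  Submodule.span ℂ {x | ∃ s t : List Bool, s.length = n ∧ s.Perm t ∧ x = pushWord s * pullWord t}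

theorem word_mem_localOps {s t : List Bool} (h : s.Perm t) :
    pushWord s * pullWord t ∈ localOps s.length :=
  Submodule.subset_span ⟨s, t, rfl, h, rfl⟩

theorem localOps_induction {n : ℕ} {p : Chain → Prop} (h0 : p 0)
    (hadd : ∀ x y, p x → p y → p (x + y)) (hsmul : ∀ (c : ℂ) x, p x → p (c • x))
    (hword : ∀ s t : List Bool, s.length = n → s.Perm t → p (pushWord s * pullWord t))
    {x : Chain} (hx : x ∈ localOps n) : p x := by
  refine Submodule.span_induction (p := fun x _ => p x) ?_ h0 (fun x y _ _ => hadd x y)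
    (fun c x _ => hsmul c x) hx
  rintro _ ⟨s, t, h1, h2, rfl⟩
  exact hword s t h1 h2

theorem localOps_le_succ (n : ℕ) : localOps n ≤ localOps (n + 1) := by
  intro x hx
  refine localOps_induction (zero_mem _) (fun _ _ => add_mem)
    (fun c _ => Submodule.smul_mem _ c) ?_ hx
  intro s t hs h
  have h1 : pushWord s * pullWord t = pushWord (s ++ [false]) * pullWord (t ++ [false]) +
      pushWord (s ++ [true]) * pullWord (t ++ [true]) := by
    simp only [pushWord_append, pullWord_append, pushWord, pullWord, mul_one, one_mul]
    rw [← mul_one (pushWord s), ← push_mul_pull_add]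
    simp only [mul_add, add_mul, mul_assoc]
    simp
  have h2 : ∀ b, pushWord (s ++ [b]) * pullWord (t ++ [b]) ∈ localOps (n + 1) := fun b => by
    have h3 : (s ++ [b]).length = n + 1 := by simp [hs]
    exact h3 ▸ word_mem_localOps (h.append_right [b])
  rw [h1]
  exact add_mem (h2 false) (h2 true)

theorem localOps_mono {m n : ℕ} (h : m ≤ n) : localOps m ≤ localOps n :=
  monotone_nat_of_le_succ localOps_le_succ h

theorem addSite_mem_localOps {n : ℕ} {x : Chain} (hx : x ∈ localOps n) :
    addSite x ∈ localOps (n + 1) := by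
  refine localOps_induction (p := fun x => addSite x ∈ localOps (n + 1)) ?_ ?_ ?_ ?_ hx
  · rw [addSite_zero]; exact zero_mem _
  · intro x y hx hy
    have : addSite (x + y) = addSite x + addSite y := by
      simp only [addSite, mul_add, add_mul]; abel
    rw [this]; exact add_mem hx hy
  · intro c x hx
    have : addSite (c • x) = c • addSite x := by simp [addSite]
    rw [this]; exact Submodule.smul_mem _ c hx
  · rintro s t rfl h
    have : ∀ b, push b * (pushWord s * pullWord t) * pull b =
        pushWord (b :: s) * pullWord (b :: t) := fun b => by
      simp only [pushWord, pullWord, mul_assoc]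
    have h1 : ∀ b, pushWord (b :: s) * pullWord (b :: t) ∈ localOps (s.length + 1) := fun b => by
      have h2 := word_mem_localOps (h.cons b)
      rwa [List.length_cons] at h2
    rw [addSite, this, this]
    exact add_mem (h1 _) (h1 _)

theorem addSites_mem_localOps {n : ℕ} {x : Chain} (hx : x ∈ localOps n) (m : ℕ) :
    addSites m x ∈ localOps (n + m) := by
  induction m with
  | zero => exact hx
  | succ m ih => rw [addSites_succ]; exact addSite_mem_localOps ih

theorem mul_mem_localOps {n : ℕ} {x y : Chain} (hx : x ∈ localOps n) (hy : y ∈ localOps n) :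
    x * y ∈ localOps n := by
  refine localOps_induction (p := fun x => x * y ∈ localOps n) ?_ ?_ ?_ ?_ hx
  · rw [zero_mul]; exact zero_mem _
  · intro x x' h h'; rw [add_mul]; exact add_mem h h'
  · intro c x h; rw [smul_mul_assoc]; exact Submodule.smul_mem _ c h
  · intro s t hs h
    refine localOps_induction (p := fun y => pushWord s * pullWord t * y ∈ localOps n)
      ?_ ?_ ?_ ?_ hy
    · rw [mul_zero]; exact zero_mem _
    · intro x x' h h'; rw [mul_add]; exact add_mem h h'
    · intro c x h; rw [mul_smul_comm]; exact Submodule.smul_mem _ c h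
    · intro u v hu h'
      rw [mul_assoc, ← mul_assoc (pullWord t), pullWord_mul_pushWord (by rw [← h.length_eq, hs, hu])]
      by_cases htu : t = u
      · rw [if_pos htu, one_mul, ← hs]
        exact word_mem_localOps (h.trans (htu ▸ h'))
      · simp [htu]

theorem algebraMap_mem_localOps (c : ℂ) (n : ℕ) : algebraMap ℂ Chain c ∈ localOps n := by
  refine localOps_mono (Nat.zero_le n) ?_
  rw [Algebra.algebraMap_eq_smul_one]
  have := word_mem_localOps (List.Perm.refl [])
  rw [pushWord, pullWord, mul_one] at this
  exact Submodule.smul_mem _ c this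

/-- Each word in the pair has one site of either kind, so creation after annihilation merely
permutes states; this conservation is what makes arbitrary weights tracial. -/
theorem pairCup_mul_pairCap_mem : pairCup * pairCap ∈ localOps 2 := by
  have h1 : pairCup = pushWord [false, true] + Complex.I • pushWord [true, false] := by
    simp [pairCup, pushWord]
  have h2 : pairCap = pullWord [true, false] + (-Complex.I) • pullWord [false, true] := by
    simp [-neg_smul, pairCap, pullWord]
  have h3 : [false, true].Perm [true, false] := List.Perm.swap _ _ _
  have key : ∀ (c : ℂ) {s t : List Bool}, s.length = 2 → s.Perm t →
      c • (pushWord s * pullWord t) ∈ localOps 2 := fun c s t hs h =>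
    Submodule.smul_mem _ c (hs ▸ word_mem_localOps h)
  have k1 := key 1 (s := [false, true]) rfl h3
  have k2 := key Complex.I (s := [true, false]) rfl (List.Perm.refl _)
  have k3 := key (-Complex.I) (s := [false, true]) rfl (List.Perm.refl _)
  have k4 := key (Complex.I * -Complex.I) (s := [true, false]) rfl h3.symm
  have h4 : pairCup * pairCap = (1 : ℂ) • (pushWord [false, true] * pullWord [true, false]) +
      Complex.I • (pushWord [true, false] * pullWord [true, false]) +
      ((-Complex.I) • (pushWord [false, true] * pullWord [false, true]) +
      (Complex.I * -Complex.I) • (pushWord [true, false] * pullWord [false, true])) := by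
    rw [h1, h2]
    simp only [mul_add, add_mul, smul_mul_assoc, mul_smul_comm, smul_add, smul_smul, one_smul]
    rw [mul_comm Complex.I]
  rw [h4]
  exact (localOps 2).add_mem ((localOps 2).add_mem k1 k2) ((localOps 2).add_mem k3 k4)

theorem chainRep_mem_localOps {n : ℕ} {x : Diag} (hx : x ∈ TL n) : chainRep x ∈ localOps n := by
  refine Algebra.adjoin_induction (p := fun x _ => chainRep x ∈ localOps n) ?_ ?_ ?_ ?_ hx
  · rintro _ ⟨i, h1, h2, rfl⟩
    obtain ⟨i, rfl⟩ := Nat.exists_eq_add_of_le' h1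
    rw [gen_succ, map_mul, chainRep_cup, chainRep_cap, ← addSites_mul]
    exact localOps_mono (by omega) (addSites_mem_localOps pairCup_mul_pairCap_mem i)
  · intro r
    rw [AlgHom.commutes]
    exact algebraMap_mem_localOps r n
  · intro x y _ _ hx hy
    rw [map_add]; exact add_mem hx hy
  · intro x y _ _ hx hy
    rw [map_mul]; exact mul_mem_localOps hx hy

theorem chainRep_shift (m : ℕ) (x : Diag) : chainRep (shift m x) = addSites m (chainRep x) := by
  obtain ⟨x, rfl⟩ := RingQuot.mkAlgHom_surjective ℂ Rel x
  induction x using FreeAlgebra.induction with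
  | grade0 r =>
    simp only [AlgHom.commutes]
    rw [Algebra.algebraMap_eq_smul_one]
    induction m with
    | zero => rfl
    | succ m ih =>
      rw [addSites_succ, ← ih]
      simpa [addSite] using congrArg (r • ·) push_mul_pull_add.symm
  | grade1 g =>
    cases g with
    | cup i =>
      change chainRep (shift m (cup i)) = addSites m (chainRep (cup i))
      rw [shift_cup, chainRep_cup, chainRep_cup, add_comm, addSites_add]
    | cap i =>
      change chainRep (shift m (cap i)) = addSites m (chainRep (cap i))
      rw [shift_cap, chainRep_cap, chainRep_cap, add_comm, addSites_add]
  | mul a b ha hb => rw [map_mul, map_mul, map_mul, map_mul, ha, hb, addSites_mul]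
  | add a b ha hb =>
    rw [map_add, map_add, map_add, map_add, ha, hb]
    clear ha hb
    generalize chainRep _ = x
    generalize chainRep _ = y
    induction m with
    | zero => rfl
    | succ m ih =>
      rw [addSites_succ, addSites_succ, addSites_succ, ← ih]
      simp only [addSite, mul_add, add_mul]
      abel

/-! ### The weighted trace on the spin chain -/

/-- The partial trace over the first site, where the states of the site have weights `w`. -/
def siteTrace (w : Bool → ℂ) : Chain →ₗ[ℂ] Chain where
  toFun x := w false • (pull false * x * push false) + w true • (pull true * x * push true)
  map_add' x y := by simp only [mul_add, add_mul, smul_add]; abel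
  map_smul' c x := by
    simp only [mul_smul_comm, smul_mul_assoc, smul_add, RingHom.id_apply, smul_comm c]

theorem siteTrace_apply (w : Bool → ℂ) (x : Chain) : siteTrace w x =
    w false • (pull false * x * push false) + w true • (pull true * x * push true) := rfl

def sitesTrace (w : Bool → ℂ) : ℕ → Chain →ₗ[ℂ] Chain
  | 0 => LinearMap.id
  | n + 1 => sitesTrace w n ∘ₗ siteTrace w

theorem sitesTrace_add (w : Bool → ℂ) (m n : ℕ) (x : Chain) :
    sitesTrace w (m + n) x = sitesTrace w n (sitesTrace w m x) := by
  induction m generalizing x with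
  | zero => rw [Nat.zero_add]; rfl
  | succ m ih => rw [Nat.add_right_comm]; exact ih _

def wordWeight (w : Bool → ℂ) (s : List Bool) : ℂ := (s.map w).prod

theorem wordWeight_perm (w : Bool → ℂ) {s t : List Bool} (h : s.Perm t) :
    wordWeight w s = wordWeight w t := (h.map w).prod_eq

theorem siteTrace_push_mul (w : Bool → ℂ) (b c : Bool) (x y : Chain) :
    siteTrace w (push b * x * pull c * addSite y) = if b = c then w b • (x * y) else 0 := by
  simp only [mul_assoc, pull_mul_addSite, siteTrace_apply]
  cases b <;> cases c <;> simp

theorem sitesTrace_word_mul (w : Bool → ℂ) {s t : List Bool} (h : s.length = t.length)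
    (y : Chain) : sitesTrace w s.length (pushWord s * pullWord t * addSites s.length y) =
      (if s = t then wordWeight w s else 0) • y := by
  induction s generalizing t with
  | nil =>
    obtain rfl : t = [] := List.length_eq_zero_iff.1 h.symm
    simp [pullWord, pushWord, wordWeight, sitesTrace, addSites]
  | cons b s ih =>
    cases t with
    | nil => simp at h
    | cons c t =>
      have h' : s.length = t.length := by simpa using h
      have h1 : pushWord (b :: s) * pullWord (c :: t) * addSites (s.length + 1) y =
          push b * (pushWord s * pullWord t) * pull c * addSite (addSites s.length y) := by
        simp only [pushWord, pullWord, addSites_succ, mul_assoc]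
      rw [List.length_cons, h1, sitesTrace, LinearMap.comp_apply, siteTrace_push_mul]
      by_cases hbc : b = c
      · rw [if_pos hbc, map_smul, ih h', smul_smul]
        congr 1
        by_cases hst : s = t <;> simp [hst, hbc, wordWeight]
      · simp [hbc]

/-- The value of the weighted trace on an operator on the first `m` sites. -/
theorem exists_trace_value (w : Bool → ℂ) {m : ℕ} {x : Chain} (hx : x ∈ localOps m) :
    ∃ c : ℂ, ∀ y, sitesTrace w m (x * addSites m y) = c • y := by
  refine localOps_induction (p := fun x => ∃ c : ℂ, ∀ y,
    sitesTrace w m (x * addSites m y) = c • y) ?_ ?_ ?_ ?_ hx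
  · exact ⟨0, fun y => by simp⟩
  · rintro x x' ⟨c, hc⟩ ⟨c', hc'⟩
    exact ⟨c + c', fun y => by rw [add_mul, map_add, hc, hc', add_smul]⟩
  · rintro d x ⟨c, hc⟩
    exact ⟨d * c, fun y => by rw [smul_mul_assoc, map_smul, hc, smul_smul]⟩
  · rintro s t rfl h
    exact ⟨_, sitesTrace_word_mul w h.length_eq⟩

/-- For matrix units of words, either order is non-zero under the same matching of words, with
weight of s or of t. These agree since s and t are permutations of each other. -/
theorem sitesTrace_mul_comm (w : Bool → ℂ) {n : ℕ} {x y : Chain} (hx : x ∈ localOps n)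
    (hy : y ∈ localOps n) : sitesTrace w n (x * y) = sitesTrace w n (y * x) := by
  refine localOps_induction (p := fun x => sitesTrace w n (x * y) = sitesTrace w n (y * x))
    ?_ ?_ ?_ ?_ hx
  · simp
  · intro x x' h h'; rw [add_mul, mul_add, map_add, map_add, h, h']
  · intro c x h; rw [smul_mul_assoc, mul_smul_comm, map_smul, map_smul, h]
  · intro s t hs h
    refine localOps_induction (p := fun y => sitesTrace w n (pushWord s * pullWord t * y) =
      sitesTrace w n (y * (pushWord s * pullWord t))) ?_ ?_ ?_ ?_ hy
    · simp
    · intro x x' h h'; rw [add_mul, mul_add, map_add, map_add, h, h']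
    · intro c x h; rw [smul_mul_assoc, mul_smul_comm, map_smul, map_smul, h]
    · intro u v hu h'
      have key : ∀ {s t u v : List Bool}, s.length = n → s.Perm t → u.length = n → u.Perm v →
          sitesTrace w n (pushWord s * pullWord t * (pushWord u * pullWord v)) =
            (if t = u ∧ s = v then wordWeight w s else 0) • 1 := by
        intro s t u v hs h hu h'
        rw [mul_assoc, ← mul_assoc (pullWord t),
          pullWord_mul_pushWord (by rw [← h.length_eq, hs, hu])]
        by_cases htu : t = u
        · have := sitesTrace_word_mul w (s := s) (t := v) (by rw [← h'.length_eq, hs, hu]) 1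
          rw [hs, addSites_one, mul_one] at this
          simp [htu, this]
        · simp [htu]
      rw [key hs h hu h', key hu h' hs h]
      congr 1
      by_cases h1 : t = u
      · by_cases h2 : s = v
        · rw [if_pos ⟨h1, h2⟩, if_pos ⟨h2.symm, h1.symm⟩, wordWeight_perm w h, h1]
        · rw [if_neg (fun h => h2 h.2), if_neg (fun h => h2 h.1.symm)]
      · rw [if_neg (fun h => h1 h.1), if_neg (fun h => h1 h.2.symm)]

/-- The weighted trace of the operator of `x` on the spin chain is `c`. -/
def HasTrace (w : Bool → ℂ) (x : Diag) (c : ℂ) : Prop :=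
  ∃ N, ∀ n, N ≤ n → sitesTrace w n (chainRep x) = c • 1

namespace HasTrace

variable {w : Bool → ℂ} {x y : Diag} {c d : ℂ}

theorem unique (h : HasTrace w x c) (h' : HasTrace w x d) : c = d := by
  obtain ⟨M, hM⟩ := h
  obtain ⟨N, hN⟩ := h'
  have h1 := (hM _ (le_max_left M N)).symm.trans (hN _ (le_max_right M N))
  have h2 := congrFun (LinearMap.congr_fun h1 fun _ => 1) 0
  simpa using h2

/-- Because the weights add up to 1, tracing further sites does not change a scalar. -/
theorem of_eq (hw : w false + w true = 1) {n : ℕ} (h : sitesTrace w n (chainRep x) = c • 1) :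
    HasTrace w x c := by
  refine ⟨n, fun m hm => ?_⟩
  obtain ⟨r, rfl⟩ := Nat.exists_eq_add_of_le hm
  rw [sitesTrace_add, h, map_smul]
  congr 1
  clear hm
  induction r with
  | zero => rfl
  | succ r ih =>
    rw [sitesTrace, LinearMap.comp_apply, siteTrace_apply]
    simpa [← add_smul, hw] using ih

theorem exists_of_mem (hw : w false + w true = 1) (hx : x ∈ TLInf) : ∃ c, HasTrace w x c := by
  obtain ⟨n, hn⟩ := exists_mem_TL hx
  obtain ⟨c, hc⟩ := exists_trace_value w (chainRep_mem_localOps hn)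
  have := hc 1
  rw [addSites_one, mul_one] at this
  exact ⟨c, of_eq hw this⟩

theorem add (h : HasTrace w x c) (h' : HasTrace w y d) : HasTrace w (x + y) (c + d) := by
  obtain ⟨M, hM⟩ := h
  obtain ⟨N, hN⟩ := h'
  exact ⟨max M N, fun n hn => by
    rw [map_add, map_add, hM n (le_of_max_le_left hn), hN n (le_of_max_le_right hn), add_smul]⟩

theorem smul (a : ℂ) (h : HasTrace w x c) : HasTrace w (a • x) (a * c) := by
  obtain ⟨M, hM⟩ := h
  exact ⟨M, fun n hn => by rw [map_smul, map_smul, hM n hn, smul_smul]⟩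

theorem mul_comm (hx : x ∈ TLInf) (hy : y ∈ TLInf) (h : HasTrace w (x * y) c) :
    HasTrace w (y * x) c := by
  obtain ⟨N, hN⟩ := h
  obtain ⟨k, hk⟩ := exists_mem_TL hx
  obtain ⟨l, hl⟩ := exists_mem_TL hy
  refine ⟨max N (max k l), fun n hn => ?_⟩
  have h1 := chainRep_mem_localOps (TL_mono (show k ≤ n by omega) hk)
  have h2 := chainRep_mem_localOps (TL_mono (show l ≤ n by omega) hl)
  rw [map_mul, sitesTrace_mul_comm w h2 h1, ← map_mul, hN n (by omega)]

/-- The first m sites are traced out to the scalar of x, leaving exactly the unshifted operator of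
y. -/
theorem mul_shift (hw : w false + w true = 1) {m : ℕ} (hx : x ∈ TL m) (h : HasTrace w x c)
    (h' : HasTrace w y d) : HasTrace w (x * shift m y) (c * d) := by
  obtain ⟨N, hN⟩ := h'
  obtain ⟨e, he⟩ := exists_trace_value w (chainRep_mem_localOps hx)
  have h1 := he 1
  rw [addSites_one, mul_one] at h1
  obtain rfl := h.unique (of_eq hw h1)
  refine of_eq (n := m + N) hw ?_
  rw [map_mul, chainRep_shift, sitesTrace_add, he, map_smul, hN N le_rfl, smul_smul]

end HasTrace

theorem hasTrace_gen_mul_gen {w : Bool → ℂ} (hw : w false + w true = 1) :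
    HasTrace w (gen 1 * gen 2) (w false * w true) := by
  refine HasTrace.of_eq (n := 2) hw ?_
  rw [gen_mul_gen_succ le_rfl, map_mul, chainRep_cup, chainRep_cap, ← push_mul_pull_add]
  change siteTrace w (siteTrace w (pairCup * addSite pairCap)) = _
  simp only [siteTrace_apply]
  simp [-neg_smul, pairCup, pairCap, addSite, mul_add, add_mul, mul_assoc, smul_smul]
  rw [mul_comm (w true), add_comm]

def weightedTraceFun (w : Bool → ℂ) (hw : w false + w true = 1) (x : TLInf) : ℂ :=
  (HasTrace.exists_of_mem hw x.2).choose

theorem hasTrace_weightedTraceFun (w : Bool → ℂ) (hw : w false + w true = 1) (x : TLInf) :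
    HasTrace w x (weightedTraceFun w hw x) :=
  (HasTrace.exists_of_mem hw x.2).choose_spec

/-- The restriction to `TL_∞` of the product state with weights `w`. -/
def weightedTrace (w : Bool → ℂ) (hw : w false + w true = 1) : TLInf →ₗ[ℂ] ℂ where
  toFun := weightedTraceFun w hw
  map_add' x y := (hasTrace_weightedTraceFun w hw (x + y)).unique
    ((hasTrace_weightedTraceFun w hw x).add (hasTrace_weightedTraceFun w hw y))
  map_smul' c x := (hasTrace_weightedTraceFun w hw (c • x)).unique
    ((hasTrace_weightedTraceFun w hw x).smul c)

theorem isNormalizedTrace_weightedTrace (w : Bool → ℂ) (hw : w false + w true = 1) :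
    IsNormalizedTrace (weightedTrace w hw) where
  map_one := by
    refine (hasTrace_weightedTraceFun w hw 1).unique (HasTrace.of_eq (n := 0) hw ?_)
    rw [OneMemClass.coe_one, map_one, one_smul]
    rfl
  map_mul_comm x y := by
    refine (hasTrace_weightedTraceFun w hw (x * y)).unique ?_
    exact HasTrace.mul_comm y.2 x.2 (hasTrace_weightedTraceFun w hw (y * x))

theorem isMultiplicative_weightedTrace (w : Bool → ℂ) (hw : w false + w true = 1) :
    IsMultiplicative (weightedTrace w hw) := by
  intro m x y z hx hz
  refine (hasTrace_weightedTraceFun w hw z).unique ?_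
  rw [hz]
  exact HasTrace.mul_shift hw hx (hasTrace_weightedTraceFun w hw x)
    (hasTrace_weightedTraceFun w hw y)

theorem exists_weights (γ : ℂ) : ∃ w : Bool → ℂ, w false + w true = 1 ∧ w false * w true = γ := by
  obtain ⟨s, hs⟩ := IsAlgClosed.exists_eq_mul_self (1 - 4 * γ)
  -- The weights are the roots of t² − t + γ, with s a square root of the discriminant.
  refine ⟨fun b => if b then (1 - s) / 2 else (1 + s) / 2, ?_, ?_⟩
  · simp only [Bool.false_eq_true, if_false, if_true]
    ring
  · simp only [Bool.false_eq_true, if_false, if_true]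
    linear_combination hs / 4

theorem existsUnique_multiplicative_trace (γ : ℂ) : ∃! χ : TLInf →ₗ[ℂ] ℂ, IsNormalizedTrace χ ∧
    IsMultiplicative χ ∧ χ (genInf 1 * genInf 2) = γ := by
  obtain ⟨w, hw, hγ⟩ := exists_weights γ
  have h : weightedTrace w hw (genInf 1 * genInf 2) = γ :=
    hγ ▸ (hasTrace_weightedTraceFun w hw (genInf 1 * genInf 2)).unique (hasTrace_gen_mul_gen hw)
  refine ⟨weightedTrace w hw, ⟨isNormalizedTrace_weightedTrace w hw,
    isMultiplicative_weightedTrace w hw, h⟩, ?_⟩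
  rintro χ ⟨h1, h2, h3⟩
  exact multiplicative_trace_unique h1 h2 (isNormalizedTrace_weightedTrace w hw)
    (isMultiplicative_weightedTrace w hw) (h3.trans h.symm)

end TLZero

end

theorem mainTheorem7 :
    (∃! d : TLZero.TLInf →ₛₗ[starRingEnd ℂ] TLZero.TLInf, TLZero.IsCorrectedInvolution d) ∧
    (∀ γ : ℂ, ∃! χ : TLZero.TLInf →ₗ[ℂ] ℂ, TLZero.IsNormalizedTrace χ ∧
      TLZero.IsMultiplicative χ ∧ χ (TLZero.genInf 1 * TLZero.genInf 2) = γ) ∧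
    (∀ (d : TLZero.TLInf →ₛₗ[starRingEnd ℂ] TLZero.TLInf) (χ : TLZero.TLInf →ₗ[ℂ] ℂ) (γ : ℂ),
      TLZero.IsCorrectedInvolution d → TLZero.IsExtremalTrace d χ →
      χ (TLZero.genInf 1 * TLZero.genInf 2) = γ →
      (∀ n : ℕ, 2 < n → Odd n → TLZero.sqNorm d χ (TLZero.genInf n) = 4 * γ) ∧
      (∀ n : ℕ, n = 1 ∨ (2 ≤ n ∧ Even n) →
        TLZero.sqNorm d χ (TLZero.genInf n) = γ)) := by
  refine ⟨TLZero.existsUnique_correctedInvolution, TLZero.existsUnique_multiplicative_trace,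
    fun d χ γ hd hχ hγ => ?_⟩
  have ht : TLZero.IsNormalizedTrace χ := by
    rcases hχ with hχ | hχ
    · exact hχ.1
    · exact hχ.1.1
  subst hγ
  constructor
  · rintro n hn ⟨j, rfl⟩
    obtain ⟨j, rfl⟩ := Nat.exists_eq_add_of_le' (show 1 ≤ j by omega)
    exact TLZero.sqNorm_gen_odd hd ht j
  · rintro n (rfl | ⟨hn, j, rfl⟩)
    -- Since e_1◇ = e_2, the norm of e_1 is the very expression defining γ.
    · rw [TLZero.sqNorm, TLZero.diamond_gen_one hd]
    · obtain ⟨j, rfl⟩ := Nat.exists_eq_add_of_le' (show 1 ≤ j by omega)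
      rw [show j + 1 + (j + 1) = 2 * j + 2 by ring]
      exact TLZero.sqNorm_gen_even hd ht j
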